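/- **Setting.** A graph here is a finite undirected graph $G=(V,E,\pi)$ with a vertex coloring $\pi$; $\mathrm{Aut}(G)\le \mathrm{Sym}(V)$ is the group of permutations of $V$ preserving $E$ and $\pi$. For a permutation $\varphi$ and a permutation group $\Gamma$, $\mathrm{supp}(\varphi)$ is the set of points moved by $\varphi$, and $\mathrm{supp}(\Gamma)$ is the set of points moved by some element of $\Gamma$. A *joint graph/group pair* is a pair $(G,S)$ of a graph and a finite set $S$ of permutations of $V(G)$ with $\langle S\rangle=\mathrm{Aut}(G)$. A *disjoint direct decomposition* of a permutation group $\Gamma$ is an internal direct product $\Gamma=H_1\times\dots\times H_m$ whose factors have pairwise disjoint supports; it is *finest* if every factor is non-trivial and no factor has a disjoint direct decomposition with two or more non-trivial factors (for trivial $\Gamma$ it is the empty product, $m=0$). A set $S'$ of permutations is *separable* for it if for every $\varphi\in S'$ there is exactly one $i$ with $\mathrm{supp}(\varphi)\cap\mathrm{supp}(H_i)\neq\emptyset$. Graphs are encoded by adjacency lists, permutations in cycle notation without fixed points, permutation groups by generating sets, and the orbit partition by the array of the orbit labels of the vertices. Let $\mathrm{enc}(S)=\sum_{\varphi\in S}|\mathrm{supp}(\varphi)|$.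 An algorithm is *instance-linear* if on a unit-cost random access machine (whose arithmetic is successor and predecessor) it takes $O(|V|+|E|+\mathrm{enc}(S)+1)$ steps, with an absolute constant. **Theorem.** There is an instance-linear algorithm which, given a joint graph/group pair $(G,S)$ and the orbit partition of $\langle S\rangle$, computes 1. the finest disjoint direct decomposition $\langle S\rangle=H_1\times H_2\times\dots\times H_m$ (each factor being represented by its generating set $S_i$ of item 3); 2. a set $S'$ that is separable for this decomposition, with $\langle S'\rangle=\langle S\rangle$; 3. for each $i\in\{1,\dots,m\}$ a joint graph/group pair $(G_i,S_i)$, where $G_i$ has vertex set $\mathrm{supp}(H_i)$, with $\mathrm{Aut}(G_i)=\langle S_i\rangle=H_i$ (a permutation of $\mathrm{supp}(H_i)$ being identified with its extension to $V(G)$ by the identity). The total running time, for all three items together, is instance-linear. -/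

import Mathlib

open Equiv

/-! ### Permutation groups -/

/-- The support of a permutation group: the points moved by some element. -/
def groupSupport {Ω : Type} (Γ : Subgroup (Perm Ω)) : Set Ω :=
  {x | ∃ σ ∈ Γ, σ x ≠ x}

/-- `Γ` is the (internal) direct product of the subgroups `H i`, and the `H i` have pairwise
disjoint supports. -/
structure IsDisjointDirectDecomposition {Ω ι : Type} (Γ : Subgroup (Perm Ω))
    (H : ι → Subgroup (Perm Ω)) : Prop where
  commute : ∀ i j, i ≠ j → ∀ σ ∈ H i, ∀ τ ∈ H j, σ * τ = τ * σ
  independent : iSupIndep H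
  iSup_eq : ⨆ i, H i = Γ
  disjoint_supports : ∀ i j, i ≠ j → Disjoint (groupSupport (H i)) (groupSupport (H j))

/-- Every disjoint direct decomposition of `Γ` is trivial: its factors are trivial or all of `Γ`. -/
def IsDisjointlyIndecomposable {Ω : Type} (Γ : Subgroup (Perm Ω)) : Prop :=
  ∀ (r : ℕ) (K : Fin r → Subgroup (Perm Ω)), IsDisjointDirectDecomposition Γ K →
    ∀ i, K i = ⊥ ∨ K i = Γ

/-- The finest disjoint direct decomposition: the factors are non-trivial and none of them can be
decomposed further. -/
structure IsFinestDecomposition {Ω ι : Type} (Γ : Subgroup (Perm Ω))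
    (H : ι → Subgroup (Perm Ω)) : Prop where
  isDecomposition : IsDisjointDirectDecomposition Γ H
  nontrivial : ∀ i, H i ≠ ⊥
  indecomposable : ∀ i, IsDisjointlyIndecomposable (H i)

/-- `S` is separable with respect to the factors `H i`: the support of every member of `S` meets
the support of exactly one factor. -/
def IsSeparableSet {Ω ι : Type} (S : Finset (Perm Ω)) (H : ι → Subgroup (Perm Ω)) : Prop :=
  ∀ σ ∈ S, ∃! i, ({x | σ x ≠ x} ∩ groupSupport (H i)).Nonempty

/-- The vertex coloring `orb` represents the orbit partition of `Γ`. -/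
def IsOrbitColoring {Ω C : Type} (Γ : Subgroup (Perm Ω)) (orb : Ω → C) : Prop :=
  ∀ u v, orb u = orb v ↔ u ∈ MulAction.orbit Γ v

/-- The encoding size of a set of permutations. -/
def encSize {n : ℕ} (S : Finset (Perm (Fin n))) : ℕ := ∑ σ ∈ S, σ.support.card

/-! ### Colored graphs and joint graph/group pairs -/

/-- A finite undirected vertex-colored graph (loops are allowed) whose vertices are taken from an
ambient type `Ω`. Only the colors of vertices matter. -/
structure ColoredGraph (Ω : Type) where
  V : Finset Ω
  E : Finset (Sym2 Ω)
  mem_V : ∀ e ∈ E, ∀ v ∈ e, v ∈ V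
  color : Ω → ℕ

/-- The automorphism group of a colored graph, as a group of permutations of the ambient type:
a permutation of the vertex set `V` is identified with its extension by the identity. -/
def ColoredGraph.Aut {Ω : Type} (G : ColoredGraph Ω) : Subgroup (Perm Ω) where
  carrier := {σ | (∀ x, x ∉ G.V → σ x = x) ∧ (∀ x y, s(σ x, σ y) ∈ G.E ↔ s(x, y) ∈ G.E) ∧
    ∀ x ∈ G.V, G.color (σ x) = G.color x}
  one_mem' := by simp
  mul_mem' := by
    rintro a b ⟨ha1, ha2, ha3⟩ ⟨hb1, hb2, hb3⟩
    refine ⟨fun x hx => by simp [hb1 x hx, ha1 x hx], fun x y => by simp [ha2, hb2], ?_⟩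
    intro x hx
    have hbx : b x ∈ G.V := by
      by_contra h
      have h2 := b.injective (hb1 _ h)
      exact h (h2.symm ▸ hx)
    simp [ha3 _ hbx, hb3 _ hx]
  inv_mem' := by
    rintro a ⟨ha1, ha2, ha3⟩
    have hfix : ∀ x, x ∉ G.V → a⁻¹ x = x := fun x hx => by
      rw [Perm.inv_eq_iff_eq]; exact (ha1 x hx).symm
    refine ⟨hfix, fun x y => ?_, fun x hx => ?_⟩
    · have := ha2 (a⁻¹ x) (a⁻¹ y)
      simpa using this.symm
    · have hax : a⁻¹ x ∈ G.V := by
        by_contra h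
        have h2 := ha1 _ h
        have h3 : a (a⁻¹ x) = x := by simp
        rw [h3] at h2
        exact h (h2 ▸ hx)
      have := ha3 _ hax
      simpa using this.symm

/-- `(G, S)` is a joint graph/group pair. -/
def IsJointPair {Ω : Type} (G : ColoredGraph Ω) (S : Finset (Perm Ω)) : Prop :=
  Subgroup.closure (S : Set (Perm Ω)) = G.Aut

/-! ### A random access machine

A program uses finitely many registers and finitely many arrays of natural numbers. Every
elementary instruction and every test of a condition costs one step. The only arithmetic is
successor and predecessor, so that after `t` steps no number exceeds the numbers in the input and
in the program by more than `t`. -/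

namespace RAM

structure State where
  reg : ℕ → ℕ
  arr : ℕ → ℕ → ℕ

def State.setReg (s : State) (x k : ℕ) : State :=
  { s with reg := Function.update s.reg x k }

def State.setArr (s : State) (A i k : ℕ) : State :=
  { s with arr := Function.update s.arr A (Function.update (s.arr A) i k) }

/-- Comparisons of two registers. -/
inductive Cond where
  | lt (x y : ℕ)
  | eq (x y : ℕ)

def Cond.Holds : Cond → State → Prop
  | .lt x y, s => s.reg x < s.reg y
  | .eq x y, s => s.reg x = s.reg y

/-- Programs. Registers and arrays are named by numbers; `load x A y` reads cell number
`reg y` of array `A` into register `x`, and `store A y x` writes register `x` to that cell. -/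
inductive Program where
  | const (x k : ℕ)
  | copy (x y : ℕ)
  | succ (x : ℕ)
  | pred (x : ℕ)
  | load (x A y : ℕ)
  | store (A y x : ℕ)
  | seq (p q : Program)
  | ite (b : Cond) (p q : Program)
  | loop (b : Cond) (p : Program)

/-- `Exec p s t s'`: the program `p`, started in state `s`, halts after exactly `t` steps in
state `s'`. -/
inductive Exec : Program → State → ℕ → State → Prop where
  | const (x k : ℕ) (s : State) : Exec (.const x k) s 1 (s.setReg x k)
  | copy (x y : ℕ) (s : State) : Exec (.copy x y) s 1 (s.setReg x (s.reg y))
  | succ (x : ℕ) (s : State) : Exec (.succ x) s 1 (s.setReg x (s.reg x + 1))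
  | pred (x : ℕ) (s : State) : Exec (.pred x) s 1 (s.setReg x (s.reg x - 1))
  | load (x A y : ℕ) (s : State) : Exec (.load x A y) s 1 (s.setReg x (s.arr A (s.reg y)))
  | store (A y x : ℕ) (s : State) : Exec (.store A y x) s 1 (s.setArr A (s.reg y) (s.reg x))
  | seq {p q : Program} {s s' s'' : State} {t t' : ℕ} :
      Exec p s t s' → Exec q s' t' s'' → Exec (.seq p q) s (t + t') s''
  | ite_true {b : Cond} {p q : Program} {s s' : State} {t : ℕ} :
      b.Holds s → Exec p s t s' → Exec (.ite b p q) s (t + 1) s'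
  | ite_false {b : Cond} {p q : Program} {s s' : State} {t : ℕ} :
      ¬ b.Holds s → Exec q s t s' → Exec (.ite b p q) s (t + 1) s'
  | loop_done {b : Cond} {p : Program} {s : State} :
      ¬ b.Holds s → Exec (.loop b p) s 1 s
  | loop_step {b : Cond} {p : Program} {s s' s'' : State} {t t' : ℕ} :
      b.Holds s → Exec p s t s' → Exec (.loop b p) s' t' s'' →
        Exec (.loop b p) s (t + t' + 1) s''

/-- The initial state: the input word is in array `0`; everything else is `0`. -/
def initial (w : List ℕ) : State where
  reg := fun _ => 0
  arr := fun A k => if A = 0 then w.getD k 0 else 0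

/-- On input `w` the program halts after `t` steps, and array `1` then starts with the word
`out`. (The output format below is self-delimiting.) -/
def Outputs (p : Program) (w : List ℕ) (t : ℕ) (out : List ℕ) : Prop :=
  ∃ s, Exec p (initial w) t s ∧ ∀ (k : ℕ) (hk : k < out.length), s.arr 1 k = out[k]

end RAM

/-! ### Encodings

Graphs are given by adjacency lists, permutations in cycle notation (fixed points omitted), and
permutation groups by generating sets. Lists are written with their length in front. -/

def encList {α : Type} (f : α → List ℕ) (l : List α) : List ℕ := l.length :: l.flatMap f

def encVertex {n : ℕ} (v : Fin n) : List ℕ := [(v : ℕ)]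

/-- A vertex, its color and its neighbors. -/
abbrev Row (n : ℕ) : Type := Fin n × ℕ × List (Fin n)

def encRow {n : ℕ} (r : Row n) : List ℕ :=
  (r.1 : ℕ) :: r.2.1 :: encList encVertex r.2.2

/-- The rows are adjacency lists of the colored graph `G`, in any order. -/
def IsAdjacencyLists {n : ℕ} (rows : List (Row n)) (G : ColoredGraph (Fin n)) : Prop :=
  (rows.map Prod.fst).Nodup ∧ (∀ v, v ∈ rows.map Prod.fst ↔ v ∈ G.V) ∧
    ∀ r ∈ rows, r.2.1 = G.color r.1 ∧ r.2.2.Nodup ∧ ∀ v, v ∈ r.2.2 ↔ s(r.1, v) ∈ G.E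

/-- A list of cycles, each given as the list of its points. -/
abbrev Cycles (n : ℕ) : Type := List (List (Fin n))

/-- The cycles are pairwise disjoint, without repeated points, and of length at least two. -/
def IsCycleNotation {n : ℕ} (cs : Cycles n) : Prop :=
  (∀ c ∈ cs, 2 ≤ c.length) ∧ cs.flatten.Nodup

/-- The permutation denoted by a list of cycles. -/
def permOfCycles {n : ℕ} (cs : Cycles n) : Perm (Fin n) := (cs.map List.formPerm).prod

/-- `gens` lists exactly the members of `S` (perhaps with repetitions) in cycle notation. -/
def ListsPerms {n : ℕ} (gens : List (Cycles n)) (S : Finset (Perm (Fin n))) : Prop :=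
  (∀ cs ∈ gens, IsCycleNotation cs) ∧ ∀ σ, σ ∈ S ↔ ∃ cs ∈ gens, permOfCycles cs = σ

def encPerms {n : ℕ} (gens : List (Cycles n)) : List ℕ :=
  encList (encList (encList encVertex)) gens

/-- `w` encodes the graph `G` together with the set `S` of permutations, where `S` may
be listed with repetitions. -/
def EncodesPair {n : ℕ} (w : List ℕ) (G : ColoredGraph (Fin n)) (S : Finset (Perm (Fin n))) :
    Prop :=
  ∃ (rows : List (Row n)) (gens : List (Cycles n)),
    IsAdjacencyLists rows G ∧ ListsPerms gens S ∧ w = encList encRow rows ++ encPerms gens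

/-- `w` encodes the input: the graph, the generating set (listed without repetitions), and the
array of the orbit labels of the vertices. -/
def EncodesInput {n : ℕ} (w : List ℕ) (G : ColoredGraph (Fin n)) (S : Finset (Perm (Fin n)))
    (orb : Fin n → Fin n) : Prop :=
  ∃ (rows : List (Row n)) (gens : List (Cycles n)),
    IsAdjacencyLists rows G ∧ ListsPerms gens S ∧ (gens.map permOfCycles).Nodup ∧
      w = encList encRow rows ++ encPerms gens ++ List.ofFn (fun v => (orb v : ℕ))

/-- `w` encodes the output: the number `m` of factors, the pairs `(G i, S i)` one after the other
(`S i` also represents the `i`-th factor, as its generating set), and then the set `S'`. -/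
def EncodesOutput {n m : ℕ} (w : List ℕ) (G : Fin m → ColoredGraph (Fin n))
    (S : Fin m → Finset (Perm (Fin n))) (S' : Finset (Perm (Fin n))) : Prop :=
  ∃ (ws : Fin m → List ℕ) (gens : List (Cycles n)),
    (∀ i, EncodesPair (ws i) (G i) (S i)) ∧ ListsPerms gens S' ∧
      w = encList id (List.ofFn ws) ++ encPerms gens

/-! ### Reasoning about programs -/

/-! Let Γ = Aut(G). Call an orbit o non-homogeneous to an orbit o' if some vertex of o is adjacent
to some but not all vertices of o'. An automorphism carrying a neighbor of x in o' to a non-neighbor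
shows that the relation is symmetric (`NonHomogeneous.symm`). The factors are the groups belonging
to the connected components of this relation on the orbits with at least two points.

The components split Γ. Between orbits in different components the edges are all or nothing
(`IsComponentColoring.edge_of_ne`), so an automorphism restricted to one component, and extended by
the identity, is again an automorphism. Conversely, an automorphism of the subgraph induced on a
component, with the orbits of Γ as colors, preserves the orbits and hence the whole graph
(`aut_component_le`). So each factor is the full automorphism group of an induced colored subgraph,
and Γ is their product (`isDisjointDirectDecomposition`).

The decomposition is finest. In a disjoint direct decomposition of a factor, points in the supports
of different parts can be moved independently. If x ~ y and x ≁ y' with y, y' in one orbit, and x, y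
lay in different parts, some automorphism would fix x and send y to y', destroying an edge. Hence
related orbits lie in the support of the same part, and by connectedness one part has all of the
support (`isDisjointlyIndecomposable`).

Generators. An automorphism preserves orbits, so each of its cycles lies in one component. Sorting
the cycles of each generator by component yields its restrictions. The non-empty ones for component
i form S_i, and S' is the union of the S_i.

Linear time. As Γ is transitive on an orbit, the neighbors of a single representative decide all
relations of that orbit (`meetsProperly_iff_nonHomogeneous`): count them by orbit and compare with
the orbit sizes. A breadth-first search therefore handles each orbit once, at the cost of the degree
of one vertex. Vertices and cycles are then bucket sorted by component and written out.

Memory: register 0 stays 0, register 1 reads the input and register 3 points to the next output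
cell. Array 0 is the input, 1 the output, 2 the positions of neighbor lists, 3 the orbit labels, 4
and 5 the sizes and representatives of orbits, 6 the component numbers, 7 the counters, 8 the queue,
9 to 12 the buckets of vertices and of cycles, 13 to 15 the tags, positions and points of the
cycles; 16 translates cell v + 1 to vertex v. -/

namespace RAM

infixr:60 " ;; " => Program.seq

@[simp] theorem State.setReg_reg (s : State) (x k y : ℕ) :
    (s.setReg x k).reg y = if y = x then k else s.reg y := by
  simp [State.setReg, Function.update_apply]

@[simp] theorem State.setReg_arr (s : State) (x k : ℕ) : (s.setReg x k).arr = s.arr := rfl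

@[simp] theorem State.setArr_reg (s : State) (A i k : ℕ) : (s.setArr A i k).reg = s.reg := rfl

@[simp] theorem State.setArr_arr (s : State) (A i k B : ℕ) :
    (s.setArr A i k).arr B = if B = A then Function.update (s.arr A) i k else s.arr B := by
  simp [State.setArr, Function.update_apply]

/-- `p`, started in `s`, halts after some number `t` of steps in a state `s'` with `Q t s'`. -/
def WP (p : Program) (s : State) (Q : ℕ → State → Prop) : Prop :=
  ∃ t s', Exec p s t s' ∧ Q t s'

theorem WP.mono {p : Program} {s : State} {Q R : ℕ → State → Prop} (h : WP p s Q)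
    (hQR : ∀ t s', Q t s' → R t s') : WP p s R := by
  obtain ⟨t, s', h1, h2⟩ := h
  exact ⟨t, s', h1, hQR _ _ h2⟩

theorem wp_const {x k : ℕ} {s : State} {Q : ℕ → State → Prop} :
    WP (.const x k) s Q ↔ Q 1 (s.setReg x k) :=
  ⟨by rintro ⟨_, _, ⟨⟩, h⟩; exact h, fun h => ⟨_, _, .const x k s, h⟩⟩

theorem wp_copy {x y : ℕ} {s : State} {Q : ℕ → State → Prop} :
    WP (.copy x y) s Q ↔ Q 1 (s.setReg x (s.reg y)) :=
  ⟨by rintro ⟨_, _, ⟨⟩, h⟩; exact h, fun h => ⟨_, _, .copy x y s, h⟩⟩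

theorem wp_succ {x : ℕ} {s : State} {Q : ℕ → State → Prop} :
    WP (.succ x) s Q ↔ Q 1 (s.setReg x (s.reg x + 1)) :=
  ⟨by rintro ⟨_, _, ⟨⟩, h⟩; exact h, fun h => ⟨_, _, .succ x s, h⟩⟩

theorem wp_pred {x : ℕ} {s : State} {Q : ℕ → State → Prop} :
    WP (.pred x) s Q ↔ Q 1 (s.setReg x (s.reg x - 1)) :=
  ⟨by rintro ⟨_, _, ⟨⟩, h⟩; exact h, fun h => ⟨_, _, .pred x s, h⟩⟩

theorem wp_load {x A y : ℕ} {s : State} {Q : ℕ → State → Prop} :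
    WP (.load x A y) s Q ↔ Q 1 (s.setReg x (s.arr A (s.reg y))) :=
  ⟨by rintro ⟨_, _, ⟨⟩, h⟩; exact h, fun h => ⟨_, _, .load x A y s, h⟩⟩

theorem wp_store {A y x : ℕ} {s : State} {Q : ℕ → State → Prop} :
    WP (.store A y x) s Q ↔ Q 1 (s.setArr A (s.reg y) (s.reg x)) :=
  ⟨by rintro ⟨_, _, ⟨⟩, h⟩; exact h, fun h => ⟨_, _, .store A y x s, h⟩⟩

theorem wp_seq {p q : Program} {s : State} {Q : ℕ → State → Prop} :
    WP (p ;; q) s Q ↔ WP p s fun t s' => WP q s' fun t' s'' => Q (t + t') s'' :=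
  ⟨by rintro ⟨_, _, h1, h⟩
      cases h1 with | seq h2 h3 => exact ⟨_, _, h2, _, _, h3, h⟩,
    by rintro ⟨t, s', h1, t', s'', h2, h3⟩; exact ⟨_, _, .seq h1 h2, h3⟩⟩

theorem wp_ite {b : Cond} {p q : Program} {s : State} {Q : ℕ → State → Prop} :
    WP (.ite b p q) s Q ↔ (b.Holds s → WP p s fun t s' => Q (t + 1) s') ∧
      (¬ b.Holds s → WP q s fun t s' => Q (t + 1) s') := by
  constructor
  · rintro ⟨_, _, h1, h⟩
    cases h1 with
    | ite_true h2 h3 => exact ⟨fun _ => ⟨_, _, h3, h⟩, fun h' => absurd h2 h'⟩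
    | ite_false h2 h3 => exact ⟨fun h' => absurd h' h2, fun _ => ⟨_, _, h3, h⟩⟩
  · rintro ⟨h1, h2⟩
    by_cases hb : b.Holds s
    · obtain ⟨t, s', h3, h4⟩ := h1 hb
      exact ⟨_, _, .ite_true hb h3, h4⟩
    · obtain ⟨t, s', h3, h4⟩ := h2 hb
      exact ⟨_, _, .ite_false hb h3, h4⟩

theorem WP.loop_done {b : Cond} {p : Program} {s : State} {Q : ℕ → State → Prop}
    (hb : ¬ b.Holds s) (h : Q 1 s) : WP (.loop b p) s Q :=
  ⟨_, _, .loop_done hb, h⟩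

theorem WP.loop_step {b : Cond} {p : Program} {s : State} {Q : ℕ → State → Prop}
    (hb : b.Holds s)
    (h : WP p s fun t s' => WP (.loop b p) s' fun t' s'' => Q (t + t' + 1) s'') :
    WP (.loop b p) s Q := by
  obtain ⟨t, s', h1, t', s'', h2, h3⟩ := h
  exact ⟨_, _, .loop_step hb h1 h2, h3⟩

/-! #### Frames -/

/-- The registers that occur as the target of an instruction. -/
def Program.writesReg : Program → ℕ → Bool
  | .const x _, z | .copy x _, z | .succ x, z | .pred x, z | .load x _ _, z => z == x
  | .store _ _ _, _ => false
  | .seq p q, z | .ite _ p q, z => p.writesReg z || q.writesReg z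
  | .loop _ p, z => p.writesReg z

/-- The arrays that occur as the target of an instruction. -/
def Program.writesArr : Program → ℕ → Bool
  | .const _ _, _ | .copy _ _, _ | .succ _, _ | .pred _, _ | .load _ _ _, _ => false
  | .store A _ _, z => z == A
  | .seq p q, z | .ite _ p q, z => p.writesArr z || q.writesArr z
  | .loop _ p, z => p.writesArr z

/-- `s'` differs from `s` only in registers and arrays which `p` may change. -/
structure Frame (p : Program) (s s' : State) : Prop where
  reg : ∀ x, p.writesReg x = false → s'.reg x = s.reg x
  arr : ∀ A, p.writesArr A = false → s'.arr A = s.arr A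

theorem Frame.refl (p : Program) (s : State) : Frame p s s := ⟨fun _ _ => rfl, fun _ _ => rfl⟩

theorem Frame.trans {p : Program} {s s' s'' : State} (h : Frame p s s') (h' : Frame p s' s'') :
    Frame p s s'' :=
  ⟨fun x hx => (h'.reg x hx).trans (h.reg x hx), fun A hA => (h'.arr A hA).trans (h.arr A hA)⟩

/-- An instruction changes only its target. Since `writesReg` and `writesArr` compute, side
conditions for a concrete program are closed by `rfl`, and later specifications need to mention only
what changes. -/
theorem Exec.frame {p : Program} {s s' : State} {t : ℕ} (h : Exec p s t s') : Frame p s s' := by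
  induction h with
  | const | copy | succ | pred | load =>
    constructor <;> intro x hx <;> simp_all [Program.writesReg]
  | store =>
    constructor <;> intro x hx <;> simp_all [Program.writesArr]
  | seq _ _ h1 h2 =>
    constructor <;> intro x hx <;> simp only [Program.writesReg, Program.writesArr,
      Bool.or_eq_false_iff] at hx
    · rw [h2.reg x hx.2, h1.reg x hx.1]
    · rw [h2.arr x hx.2, h1.arr x hx.1]
  | ite_true _ _ h1 =>
    constructor <;> intro x hx <;> simp only [Program.writesReg, Program.writesArr,
      Bool.or_eq_false_iff] at hx
    · rw [h1.reg x hx.1]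
    · rw [h1.arr x hx.1]
  | ite_false _ _ h1 =>
    constructor <;> intro x hx <;> simp only [Program.writesReg, Program.writesArr,
      Bool.or_eq_false_iff] at hx
    · rw [h1.reg x hx.2]
    · rw [h1.arr x hx.2]
  | loop_done => exact Frame.refl _ _
  | loop_step _ _ _ h1 h2 =>
    constructor <;> intro x hx
    · rw [h2.reg x hx, h1.reg x hx]
    · rw [h2.arr x hx, h1.arr x hx]

theorem WP.frame {p : Program} {s : State} {Q : ℕ → State → Prop} (h : WP p s Q) :
    WP p s fun t s' => Q t s' ∧ Frame p s s' := by
  obtain ⟨t, s', h1, h2⟩ := h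
  exact ⟨t, s', h1, h2, h1.frame⟩

/-- A loop that consumes a list, one element in each round. The invariant `I d r T s` says that
the elements of `d` are done, those of `r` remain, and `T` steps have been made. -/
theorem WP.loop_list_time {α : Type*} {b : Cond} {p : Program} (s₀ : State)
    (I : List α → List α → ℕ → State → Prop)
    (step : ∀ d a r T s, Frame p s₀ s → I d (a :: r) T s →
      b.Holds s ∧ WP p s fun t s' => I (d ++ [a]) r (T + t + 1) s')
    (halt : ∀ d T s, Frame p s₀ s → I d [] T s → ¬ b.Holds s) {r : List α} (h : I [] r 0 s₀) :
    WP (.loop b p) s₀ fun t s' => ∃ T, I r [] T s' ∧ t = T + 1 ∧ Frame (.loop b p) s₀ s' := by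
  -- Generalized for the induction to a loop entered after T₀ steps with `d` already done. The 1 in
  -- T + 1 is the final failing test.
  suffices H : ∀ r d T₀ s, Frame p s₀ s → I d r T₀ s → WP (.loop b p) s fun t s' =>
      ∃ T, I (d ++ r) [] T s' ∧ T₀ + t = T + 1 ∧ Frame p s₀ s' by
    refine (H r [] 0 s₀ (Frame.refl _ _) h).mono ?_
    rintro t s' ⟨T, h1, h2, h3⟩
    exact ⟨T, h1, by omega, h3.reg, h3.arr⟩
  intro r
  induction r with
  | nil =>
    intro d T s hf h
    exact WP.loop_done (halt d T s hf h) ⟨T, by simpa using ⟨h, hf⟩⟩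
  | cons a r ih =>
    intro d T s hf h
    obtain ⟨hb, hw⟩ := step d a r T s hf h
    refine WP.loop_step hb (hw.frame.mono ?_)
    rintro t s' ⟨h1, h3⟩
    refine (ih _ _ s' (hf.trans h3) h1).mono ?_
    rintro t' s'' ⟨T', h4, h5, h6⟩
    exact ⟨T', by simpa using h4, by omega, h6⟩

/-- A loop that consumes a list, where the elements of the list have individual costs. -/
theorem WP.loop_list {α : Type*} {b : Cond} {p : Program} (s₀ : State)
    (I : List α → List α → State → Prop) (cost : α → ℕ)
    (step : ∀ d a r s, Frame p s₀ s → I d (a :: r) s →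
      b.Holds s ∧ WP p s fun t s' => I (d ++ [a]) r s' ∧ t ≤ cost a)
    (halt : ∀ d s, Frame p s₀ s → I d [] s → ¬ b.Holds s) {r : List α} (h : I [] r s₀) :
    WP (.loop b p) s₀ fun t s' =>
      I r [] s' ∧ t ≤ (r.map fun a => cost a + 1).sum + 1 ∧ Frame (.loop b p) s₀ s' := by
  refine (WP.loop_list_time s₀
    (fun d r T s => I d r s ∧ T ≤ (d.map fun a => cost a + 1).sum) ?_ ?_ ⟨h, by simp⟩).mono ?_
  · rintro d a r T s hf ⟨h1, h2⟩
    obtain ⟨hb, hw⟩ := step d a r s hf h1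
    refine ⟨hb, hw.mono ?_⟩
    rintro t s' ⟨h3, h4⟩
    refine ⟨h3, ?_⟩
    simp only [List.map_append, List.sum_append, List.map_cons, List.map_nil, List.sum_cons,
      List.sum_nil]
    omega
  · rintro d T s hf ⟨h1, -⟩
    exact halt d s hf h1
  · rintro t s' ⟨T, ⟨h1, h2⟩, h3, h4⟩
    exact ⟨h1, by omega, h4⟩

/-! #### Words in arrays -/

/-- The cells of `f` from number `p` on contain the word `l`. -/
def Reads (f : ℕ → ℕ) : ℕ → List ℕ → Prop
  | _, [] => True
  | p, a :: l => f p = a ∧ Reads f (p + 1) l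

@[simp] theorem reads_nil {f : ℕ → ℕ} {p : ℕ} : Reads f p [] := trivial

@[simp] theorem reads_cons {f : ℕ → ℕ} {p a : ℕ} {l : List ℕ} :
    Reads f p (a :: l) ↔ f p = a ∧ Reads f (p + 1) l := Iff.rfl

@[simp] theorem reads_append {f : ℕ → ℕ} {p : ℕ} {l l' : List ℕ} :
    Reads f p (l ++ l') ↔ Reads f p l ∧ Reads f (p + l.length) l' := by
  induction l generalizing p with
  | nil => simp
  | cons a l ih => simp [ih, and_assoc, Nat.add_assoc, Nat.add_comm 1]

theorem reads_iff {f : ℕ → ℕ} {p : ℕ} {l : List ℕ} :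
    Reads f p l ↔ ∀ (k : ℕ) (hk : k < l.length), f (p + k) = l[k] := by
  induction l generalizing p with
  | nil => simp
  | cons a l ih =>
    rw [reads_cons, ih]
    constructor
    · rintro ⟨h1, h2⟩ (_ | k) hk
      · simpa using h1
      · simpa [Nat.add_assoc, Nat.add_comm 1] using h2 k (by simpa using hk)
    · intro h
      refine ⟨h 0 (by simp), fun k hk => ?_⟩
      rw [show p + 1 + k = p + (k + 1) by omega]
      exact h (k + 1) (by simpa using hk)

theorem Reads.congr {f g : ℕ → ℕ} {p : ℕ} {l : List ℕ} (h : Reads f p l)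
    (hfg : ∀ k, p ≤ k → k < p + l.length → g k = f k) : Reads g p l := by
  rw [reads_iff] at h ⊢
  intro k hk
  rw [hfg _ (by omega) (by omega), h k hk]

theorem Reads.update_of_lt {f : ℕ → ℕ} {p i a : ℕ} {l : List ℕ} (h : Reads f p l) (hi : i < p) :
    Reads (Function.update f i a) p l :=
  h.congr fun k hk _ => Function.update_of_ne (by omega) _ _

theorem Reads.update_of_ge {f : ℕ → ℕ} {p i a : ℕ} {l : List ℕ} (h : Reads f p l)
    (hi : p + l.length ≤ i) : Reads (Function.update f i a) p l :=
  h.congr fun k _ hk => Function.update_of_ne (by omega) _ _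

/-- Array `1` starts with `l`, and register `3` points behind it. -/
def Written (s : State) (l : List ℕ) : Prop := Reads (s.arr 1) 0 l ∧ s.reg 3 = l.length

theorem Written.congr {s s' : State} {l : List ℕ} (h : Written s l) (ha : s'.arr 1 = s.arr 1)
    (hr : s'.reg 3 = s.reg 3) : Written s' l := by
  unfold Written at *; rwa [ha, hr]

theorem Written.push {s s' : State} {l : List ℕ} {a : ℕ} (h : Written s l)
    (ha : s'.arr 1 = Function.update (s.arr 1) (s.reg 3) a) (hr : s'.reg 3 = s.reg 3 + 1) :
    Written s' (l ++ [a]) := by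
  obtain ⟨h1, h2⟩ := h
  refine ⟨?_, by simp [hr, h2]⟩
  rw [ha, h2]
  simpa using h1.update_of_ge (by simp)

/-- Lists are encoded with their length in front, but the length is known only after the members
have been written. A cell is left open with arbitrary content `a` and filled in later by this lemma.
-/
theorem Written.patch {s s' : State} {l r : List ℕ} {a b : ℕ} (h : Written s (l ++ a :: r))
    (ha : s'.arr 1 = Function.update (s.arr 1) l.length b) (hr : s'.reg 3 = s.reg 3) :
    Written s' (l ++ b :: r) := by
  obtain ⟨h1, h2⟩ := h
  refine ⟨?_, by simp [hr, h2]⟩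
  rw [ha]
  simp only [reads_append, reads_cons, Nat.zero_add] at h1 ⊢
  exact ⟨h1.1.update_of_ge (by simp), by simp, h1.2.2.update_of_lt (by simp)⟩

/-! ### Reading the input -/

@[simp] theorem length_encVertex {n : ℕ} (v : Fin n) : (encVertex v).length = 1 := rfl

@[simp] theorem length_encList_encVertex {n : ℕ} (l : List (Fin n)) :
    (encList encVertex l).length = l.length + 1 := by
  simp [encList]

theorem reads_encVertices_cons {n : ℕ} {f : ℕ → ℕ} {p : ℕ} {a : Fin n} {l : List (Fin n)} :
    Reads f p ((a :: l).flatMap encVertex) ↔ f p = a ∧ Reads f (p + 1) (l.flatMap encVertex) := by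
  simp [encVertex]

/-- Advances register `1` by the content of register `d`. -/
def skip (d : ℕ) : Program := .loop (.lt 0 d) (.succ 1 ;; .pred d)

theorem wp_skip {d k : ℕ} {s : State} (h0 : s.reg 0 = 0) (hd : 1 < d) (hk : s.reg d = k) :
    WP (skip d) s fun t s' => s'.reg 1 = s.reg 1 + k ∧ t ≤ 3 * k + 1 ∧ Frame (skip d) s s' := by
  have hd1 : (1 : ℕ) ≠ d := by omega
  have hd0 : 0 ≠ d := by omega
  -- The loop rule consumes a list, so a countdown from k is modelled by a list of k units.
  refine (WP.loop_list (α := Unit) s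
    (fun D r s' => s'.reg d = r.length ∧ s'.reg 1 = s.reg 1 + D.length) (fun _ => 2) ?_ ?_
    (r := List.replicate k ()) (by simp [hk])).mono ?_
  · rintro D a r s' hF ⟨h1, h2⟩
    have h0' := hF.reg 0 (by simp [Program.writesReg, hd0])
    refine ⟨by simp [Cond.Holds, h0', h0, h1], ?_⟩
    simp [wp_seq, wp_succ, wp_pred, hd1, hd1.symm, h1, h2, Nat.add_assoc]
  · rintro D s' hF ⟨h1, h2⟩
    simp [Cond.Holds, h1]
  · rintro t s' ⟨⟨h1, h2⟩, h3, h4⟩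
    exact ⟨by simpa using h2, by simpa [mul_comm] using h3, h4⟩

/-- Reads the adjacency lists: register `2` becomes the number of vertices, and `arr 2 v` the
position of the list of neighbors of `v`. -/
def parseRows : Program :=
  .load 4 0 1 ;; .copy 2 4 ;; .succ 1 ;;
  .loop (.lt 0 4) (.load 5 0 1 ;; .succ 1 ;; .succ 1 ;; .store 2 5 1 ;; .load 6 0 1 ;; .succ 1 ;;
    skip 6 ;; .pred 4)

theorem wp_parseRows {n : ℕ} {rows : List (Row n)} {s : State} (h0 : s.reg 0 = 0)
    (h1 : s.reg 1 = 0) (hr : Reads (s.arr 0) 0 (encList encRow rows))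
    (hnd : (rows.map Prod.fst).Nodup) :
    WP parseRows s fun t s' => s'.reg 1 = (encList encRow rows).length ∧
      s'.reg 2 = rows.length ∧
      (∀ r ∈ rows, Reads (s.arr 0) (s'.arr 2 r.1) (encList encVertex r.2.2)) ∧
      t ≤ 10 * (encList encRow rows).length ∧ Frame parseRows s s' := by
  suffices H : WP parseRows s fun t s' => s'.reg 1 = (encList encRow rows).length ∧
      s'.reg 2 = rows.length ∧
      (∀ r ∈ rows, Reads (s.arr 0) (s'.arr 2 r.1) (encList encVertex r.2.2)) ∧
      t ≤ 10 * (encList encRow rows).length by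
    refine H.frame.mono ?_
    tauto
  simp only [encList, reads_cons] at hr
  simp only [parseRows, wp_seq, wp_load, wp_copy, wp_succ]
  refine (WP.loop_list (α := Row n) _
    (fun D r s' => D ++ r = rows ∧ s'.reg 4 = r.length ∧
      s'.reg 1 = (encList encRow D).length ∧ Reads (s.arr 0) (s'.reg 1) (r.flatMap encRow) ∧
      ∀ r ∈ D, Reads (s.arr 0) (s'.arr 2 r.1) (encList encVertex r.2.2))
    (fun r => 3 * (encRow r).length + 6) ?_ ?_
    (r := rows) (by simp [h1, hr, encList])).mono ?_
  · rintro D a r s' hF ⟨h2, h3, h4, h5, h6⟩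
    have f0 := hF.reg 0 rfl
    have fa := hF.arr 0 rfl
    simp [h0] at f0 fa
    refine ⟨by simp [Cond.Holds, f0, h3], ?_⟩
    simp only [List.flatMap_cons, reads_append, encRow, reads_cons, List.cons_append] at h5
    obtain ⟨h7, h8, h9, h10⟩ := h5
    simp only [wp_seq, wp_load, wp_succ, wp_store]
    refine (wp_skip (k := a.2.2.length) (by simp [f0]) (by simp) ?_).mono ?_
    · simp [fa]
      simpa [encList] using h9.1
    · rintro t s'' ⟨h11, h12, h13⟩
      have g4 := h13.reg 4 rfl
      have g2 := h13.arr 2 rfl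
      simp [fa, h7] at h11 g4 g2
      simp only [wp_pred]
      refine ⟨⟨by simpa using h2, by simp [g4, h3], ?_, ?_, ?_⟩, ?_⟩
      · simp [h11, h4, encList, encRow]; omega
      · simp [h11]
        convert h10 using 1
        simp [encList]; omega
      · intro b hb
        simp only [State.setReg_arr, g2]
        rw [List.mem_append, List.mem_singleton] at hb
        rcases hb with hb | rfl
        · rw [Function.update_of_ne]
          · exact h6 b hb
          -- No vertex has two rows, so the new entry of array 2 does not overwrite an earlier one.
          · intro hab
            have hab : b.1 = a.1 := Fin.ext hab
            rw [← h2] at hnd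
            simp only [List.map_append, List.map_cons] at hnd
            have := List.disjoint_of_nodup_append hnd
            exact this (List.mem_map_of_mem hb) (by simp [hab])
        · simpa using h9
      · simp [encRow, encList]
        omega
  · rintro D s' hF ⟨h2, h3, h4, h5, h6⟩
    simp [Cond.Holds, h3]
  · rintro t s' ⟨⟨h2, h3, h4, h5, h6⟩, h7, h8⟩
    have g2 := h8.reg 2 rfl
    simp [h1, hr] at g2
    refine ⟨h4, g2, h6, ?_⟩
    have : (rows.map fun r => 3 * (encRow r).length + 6 + 1).sum ≤
        10 * (rows.flatMap encRow).length := by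
      rw [List.length_flatMap, ← List.sum_map_mul_left]
      refine List.sum_le_sum fun r _ => ?_
      simp [encRow, encList]; omega
    simp only [encList, List.length_cons]
    omega

/-! ### Parsing the generating permutations. -/

/-- Cell number `k` of the arrays `13`, `14` and `15` describes the cycle `x.1` with the tag `x.2`:
the arrays contain the tag, the position of the cycle in the input `f`, and a point of it. -/
def CycleAt {n : ℕ} (f : ℕ → ℕ) (s : State) (k : ℕ) (x : List (Fin n) × ℕ) : Prop :=
  Reads f (s.arr 14 k) (encList encVertex x.1) ∧ s.arr 13 k = x.2 ∧
    ∀ v ∈ x.1.head?, s.arr 15 k = v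

/-- The shift to cell i + 1 keeps cell 0 free as the end marker of linked lists. -/
def CyclesAt {n : ℕ} (f : ℕ → ℕ) (s : State) (l : List (List (Fin n) × ℕ)) : Prop :=
  ∀ i x, l[i]? = some x → CycleAt f s (i + 1) x

theorem CyclesAt.congr {n : ℕ} {f : ℕ → ℕ} {s s' : State} {l : List (List (Fin n) × ℕ)}
    (h : CyclesAt f s l) (h13 : s'.arr 13 = s.arr 13) (h14 : s'.arr 14 = s.arr 14)
    (h15 : s'.arr 15 = s.arr 15) : CyclesAt f s' l := by
  intro i x hx
  have := h i x hx
  unfold CycleAt at *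
  rwa [h13, h14, h15]

theorem CyclesAt.concat {n : ℕ} {f : ℕ → ℕ} {s s' : State} {l : List (List (Fin n) × ℕ)}
    {x : List (Fin n) × ℕ} {a b c : ℕ} (h : CyclesAt f s l)
    (h13 : s'.arr 13 = Function.update (s.arr 13) (l.length + 1) a)
    (h14 : s'.arr 14 = Function.update (s.arr 14) (l.length + 1) b)
    (h15 : s'.arr 15 = Function.update (s.arr 15) (l.length + 1) c)
    (ha : a = x.2) (hb : Reads f b (encList encVertex x.1)) (hc : ∀ v ∈ x.1.head?, c = v) :
    CyclesAt f s' (l ++ [x]) := by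
  intro i y hy
  unfold CycleAt
  rw [h13, h14, h15]
  rcases lt_trichotomy i l.length with hi | rfl | hi
  · rw [List.getElem?_append_left hi] at hy
    simpa [Function.update_of_ne (show i + 1 ≠ l.length + 1 by omega), CycleAt] using h i y hy
  · obtain rfl : x = y := by simpa using hy
    simpa [ha] using ⟨hb, hc⟩
  · rw [List.getElem?_eq_none (by simp; omega)] at hy
    cases hy

/-- All cycles of a list of permutations, tagged with the number of the permutation. -/
def taggedCycles {n : ℕ} : ℕ → List (Cycles n) → List (List (Fin n) × ℕ)
  | _, [] => []
  | k, cs :: r => cs.map (fun c => (c, k + 1)) ++ taggedCycles (k + 1) r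

/-- The definition recurses from the front, while the parser appends at the end. -/
theorem taggedCycles_concat {n : ℕ} (k : ℕ) (l : List (Cycles n)) (cs : Cycles n) :
    taggedCycles k (l ++ [cs]) =
      taggedCycles k l ++ cs.map (fun c => (c, k + l.length + 1)) := by
  induction l generalizing k with
  | nil => simp [taggedCycles]
  | cons a l ih => simp [taggedCycles, ih, Nat.add_assoc, Nat.add_comm 1]

/-- Reads a permutation with `reg 6` cycles. -/
def parseCycles : Program :=
  .loop (.lt 0 6) (.succ 9 ;; .store 14 9 1 ;; .store 13 9 7 ;; .load 8 0 1 ;; .succ 1 ;;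
    .load 5 0 1 ;; .store 15 9 5 ;; skip 8 ;; .pred 6)

theorem wp_parseCycles {n : ℕ} {cs : Cycles n} {its : List (List (Fin n) × ℕ)} {s : State}
    (h0 : s.reg 0 = 0) (h6 : s.reg 6 = cs.length) (h9 : s.reg 9 = its.length)
    (hr : Reads (s.arr 0) (s.reg 1) (cs.flatMap (encList encVertex)))
    (hi : CyclesAt (s.arr 0) s its) :
    WP parseCycles s fun t s' => s'.reg 1 = s.reg 1 + (cs.flatMap (encList encVertex)).length ∧
      s'.reg 9 = its.length + cs.length ∧
      CyclesAt (s.arr 0) s' (its ++ cs.map fun c => (c, s.reg 7)) ∧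
      t ≤ 10 * (cs.flatMap (encList encVertex)).length + 1 ∧ Frame parseCycles s s' := by
  refine (WP.loop_list (α := List (Fin n)) _
    (fun D r s' => D ++ r = cs ∧ s'.reg 6 = r.length ∧ s'.reg 9 = its.length + D.length ∧
      s'.reg 1 = s.reg 1 + (D.flatMap (encList encVertex)).length ∧
      Reads (s.arr 0) (s'.reg 1) (r.flatMap (encList encVertex)) ∧
      CyclesAt (s.arr 0) s' (its ++ D.map fun c => (c, s.reg 7)))
    (fun c => 3 * c.length + 9) ?_ ?_
    (r := cs) (by simp [h6, hr, h9, hi])).mono ?_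
  · rintro D a r s' hF ⟨h2, h3, h4, h5, h6, h7⟩
    have f0 := hF.reg 0 rfl
    have f7 := hF.reg 7 rfl
    have fa := hF.arr 0 rfl
    rw [h0] at f0
    refine ⟨by simp [Cond.Holds, f0, h3], ?_⟩
    simp only [List.flatMap_cons, reads_append] at h6
    obtain ⟨h8, h9⟩ := h6
    have hlen : s.arr 0 (s'.reg 1) = a.length := h8.1
    simp only [wp_seq, wp_load, wp_succ, wp_store]
    refine (wp_skip (k := a.length) (by simp [f0]) (by simp) ?_).mono ?_
    · simp [fa, hlen]
    · rintro t s'' ⟨h11, h12, h13⟩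
      have g6 := h13.reg 6 rfl
      have g9 := h13.reg 9 rfl
      have g13 := h13.arr 13 rfl
      have g14 := h13.arr 14 rfl
      have g15 := h13.arr 15 rfl
      simp [fa] at h11 g6 g9 g13 g14 g15
      simp only [wp_pred]
      refine ⟨⟨by simpa using h2, by simp [g6, h3], by simp [g9, h4]; omega, ?_, ?_, ?_⟩, ?_⟩
      · simp [h11, h5]; omega
      · simp [h11]
        convert h9 using 1
        simp; omega
      · rw [List.map_append, ← List.append_assoc]
        refine h7.concat (x := (a, s.reg 7)) (a := s.reg 7) (b := s'.reg 1)
          (c := s.arr 0 (s'.reg 1 + 1)) ?_ ?_ ?_ rfl h8 ?_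
        · simp [g13, h4, f7]
        · simp [g14, h4]
        · simp [g15, h4]
        -- For an empty cycle the cell read as its point belongs to something else; `head?` makes
        -- the claim vacuous then.
        · intro v hv
          cases a with
          | nil => simp at hv
          | cons b a =>
            obtain rfl : b = v := by simpa using hv
            exact h8.2.1
      · omega
  · rintro D s' hF ⟨h2, h3, -⟩
    simp [Cond.Holds, h3]
  · rintro t s' ⟨⟨h2, h3, h4, h5, h6, h7⟩, h8, h9⟩
    refine ⟨h5, h4, h7, ?_, h9⟩
    refine h8.trans ?_
    rw [List.length_flatMap, ← List.sum_map_mul_left]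
    gcongr
    refine List.sum_le_sum fun c _ => ?_
    simp; omega

/-- Reads the permutations: register `9` becomes the number of cycles. -/
def parseGens : Program :=
  .load 4 0 1 ;; .succ 1 ;; .const 7 0 ;; .const 9 0 ;;
  .loop (.lt 0 4) (.succ 7 ;; .load 6 0 1 ;; .succ 1 ;; parseCycles ;; .pred 4)

theorem wp_parseGens {n : ℕ} {gens : List (Cycles n)} {s : State}
    (h0 : s.reg 0 = 0) (hr : Reads (s.arr 0) (s.reg 1) (encPerms gens)) :
    WP parseGens s fun t s' => s'.reg 1 = s.reg 1 + (encPerms gens).length ∧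
      s'.reg 9 = (taggedCycles 0 gens).length ∧
      CyclesAt (s.arr 0) s' (taggedCycles 0 gens) ∧
      t ≤ 10 * (encPerms gens).length ∧ Frame parseGens s s' := by
  suffices H : WP parseGens s fun t s' => s'.reg 1 = s.reg 1 + (encPerms gens).length ∧
      s'.reg 9 = (taggedCycles 0 gens).length ∧
      CyclesAt (s.arr 0) s' (taggedCycles 0 gens) ∧
      t ≤ 10 * (encPerms gens).length by
    refine H.frame.mono ?_
    tauto
  simp only [encPerms] at hr ⊢
  rw [encList, reads_cons] at hr
  simp only [parseGens, wp_seq, wp_load, wp_const, wp_succ]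
  refine (WP.loop_list (α := Cycles n) _
    (fun D r s' => D ++ r = gens ∧ s'.reg 4 = r.length ∧ s'.reg 7 = D.length ∧
      s'.reg 9 = (taggedCycles 0 D).length ∧
      s'.reg 1 = s.reg 1 + (encList (encList (encList encVertex)) D).length ∧
      Reads (s.arr 0) (s'.reg 1) (r.flatMap (encList (encList encVertex))) ∧
      CyclesAt (s.arr 0) s' (taggedCycles 0 D))
    -- The loop rule adds 1 per round for the test, which makes the bound exactly ten times the
    -- length of the encoding.
    (fun c => 10 * (encList (encList encVertex) c).length - 1) ?_ ?_
    (r := gens) ?_).mono ?_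
  · rintro D a r s' hF ⟨h2, h3, h4, h5, h6, h7, h8⟩
    have f0 := hF.reg 0 rfl
    have fa := hF.arr 0 rfl
    simp [h0] at f0 fa
    refine ⟨by simp [Cond.Holds, f0, h3], ?_⟩
    simp only [List.flatMap_cons, reads_append] at h7
    obtain ⟨h9, h10⟩ := h7
    simp only [wp_seq, wp_load, wp_succ]
    refine (wp_parseCycles (cs := a) (its := taggedCycles 0 D) (by simp [f0]) ?_ ?_ ?_ ?_).mono ?_
    · simpa [fa] using h9.1
    · simp [h5]
    · simpa [fa] using h9.2
    · simp only [State.setReg_arr, fa]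
      exact h8.congr rfl rfl rfl
    · rintro t s'' ⟨h11, h12, h13, h14, h15⟩
      have g4 := h15.reg 4 rfl
      have g7 := h15.reg 7 rfl
      simp [fa, h4] at h11 h12 h13 g4 g7
      simp only [wp_pred]
      refine ⟨⟨by simpa using h2, by simp [g4, h3], by simp [g7], ?_, ?_, ?_, ?_⟩, ?_⟩
      · simp [h12, taggedCycles_concat]
      · simp [h11, h6, encList]; omega
      · simp [h11]
        convert h10 using 1
        simp [encList]; omega
      · rw [taggedCycles_concat, Nat.zero_add]
        exact h13.congr rfl rfl rfl
      · simp only [encList, List.length_cons] at h14 ⊢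
        omega
  · rintro D s' hF ⟨h2, h3, -⟩
    simp [Cond.Holds, h3]
  · simp only [taggedCycles, CyclesAt]
    simp [encList, hr]
  · rintro t s' ⟨⟨h2, h3, h4, h5, h6, h7, h8⟩, h9, h10⟩
    refine ⟨h6, h5, h8, ?_⟩
    have : (gens.map fun r => 10 * (encList (encList encVertex) r).length - 1 + 1).sum ≤
        10 * (gens.flatMap (encList (encList encVertex))).length := by
      rw [List.length_flatMap, ← List.sum_map_mul_left]
      refine List.sum_le_sum fun r _ => ?_
      simp [encList]
    have h11 := h9.trans (Nat.add_le_add_right this 1)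
    rw [encList, List.length_cons]
    omega

/-! ### Orbit sizes, representatives, and passes over neighbor lists. -/

/-- Lets a counting loop over 0, …, n − 1 be treated as a loop that consumes the list of all
vertices. -/
theorem val_eq_length_of_finRange {n : ℕ} {d r : List (Fin n)} {a : Fin n}
    (h : d ++ a :: r = List.finRange n) : (a : ℕ) = d.length := by
  have h1 : (List.finRange n)[d.length]? = some a := by rw [← h]; simp
  rw [List.getElem?_eq_some_iff] at h1
  obtain ⟨h2, h3⟩ := h1
  rw [← h3]
  simp

theorem length_finRange_split {n : ℕ} {d r : List (Fin n)} (h : d ++ r = List.finRange n) :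
    d.length + r.length = n := by
  rw [← List.length_append, h, List.length_finRange]

/-- Reads the orbit labels of the vertices into array `3`; arrays `4` and `5` become the sizes
and representatives of the orbits, and `arr 16 (v + 1)` becomes `v`. -/
def readOrbits : Program :=
  .const 10 0 ;;
  .loop (.lt 10 2) (.load 5 0 1 ;; .store 3 10 5 ;; .load 6 4 5 ;; .succ 6 ;; .store 4 5 6 ;;
    .store 5 5 10 ;; .copy 7 10 ;; .succ 10 ;; .store 16 10 7 ;; .succ 1)

/-- The size of an orbit of vertices. -/
def orbitSize {n : ℕ} (orb : Fin n → Fin n) (o : Fin n) : ℕ :=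
  ((List.finRange n).map orb).count o

/-- Each vertex raises the counter of its label and overwrites the representative, so that the last
vertex of an orbit remains. Only the existence of some representative in the orbit is recorded. -/
theorem wp_readOrbits {n : ℕ} {orb : Fin n → Fin n} {s : State}
    (h2 : s.reg 2 = n) (hr : Reads (s.arr 0) (s.reg 1) (List.ofFn fun v => (orb v : ℕ)))
    (h4 : ∀ k, s.arr 4 k = 0) :
    WP readOrbits s fun t s' => (∀ v : Fin n, s'.arr 3 v = orb v) ∧
      (∀ o : Fin n, s'.arr 4 o = orbitSize orb o) ∧
      (∀ v, ∃ u, orb u = orb v ∧ s'.arr 5 (orb v) = u) ∧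
      (∀ v : Fin n, s'.arr 16 (v + 1) = v) ∧ t ≤ 11 * n + 2 ∧ Frame readOrbits s s' := by
  suffices H : WP readOrbits s fun t s' => (∀ v : Fin n, s'.arr 3 v = orb v) ∧
      (∀ o : Fin n, s'.arr 4 o = orbitSize orb o) ∧
      (∀ v, ∃ u, orb u = orb v ∧ s'.arr 5 (orb v) = u) ∧
      (∀ v : Fin n, s'.arr 16 (v + 1) = v) ∧ t ≤ 11 * n + 2 by
    refine H.frame.mono ?_
    tauto
  rw [List.ofFn_eq_map] at hr
  simp only [readOrbits, wp_seq, wp_const]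
  refine (WP.loop_list (α := Fin n) _
    (fun D r s' => D ++ r = List.finRange n ∧ s'.reg 10 = D.length ∧
      Reads (s.arr 0) (s'.reg 1) (r.map fun v => (orb v : ℕ)) ∧
      (∀ v ∈ D, s'.arr 3 v = orb v) ∧ (∀ o : Fin n, s'.arr 4 o = (D.map orb).count o) ∧
      (∀ v ∈ D, ∃ u, orb u = orb v ∧ s'.arr 5 (orb v) = u) ∧ ∀ v ∈ D, s'.arr 16 (v + 1) = v)
    (fun _ => 10) ?_ ?_
    (r := List.finRange n) (by simp [hr, h4])).mono ?_
  · rintro D a r s' hF ⟨h5, h6, h7, h8, h9, h10, h11⟩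
    have f2 := hF.reg 2 rfl
    have fa := hF.arr 0 rfl
    simp [h2] at f2 fa
    have ha := val_eq_length_of_finRange h5
    have hl := length_finRange_split h5
    simp at hl
    obtain ⟨h12, h13⟩ := h7
    refine ⟨by simp only [Cond.Holds]; omega, ?_⟩
    simp only [wp_seq, wp_load, wp_succ, wp_copy, wp_store]
    simp [fa, h12, h6, ← ha, Function.update_apply, ← Fin.ext_iff]
    refine ⟨by simpa using h5, h13, ?_, ?_, ?_, ?_⟩
    · rintro v (hv | rfl)
      · split_ifs with hva
        · rw [hva]
        · exact h8 v hv
      · simp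
    · intro o
      split_ifs with ho
      · simp [h9, ho]
      · simp [h9, Ne.symm ho]
    · rintro v (hv | rfl)
      · split_ifs with hva
        · exact ⟨a, hva.symm, rfl⟩
        · exact h10 v hv
      · exact ⟨v, rfl, by simp⟩
    · rintro v (hv | rfl)
      · split_ifs with hva
        · rw [hva]
        · exact h11 v hv
      · simp
  · rintro D s' hF ⟨h5, h6, -⟩
    have f2 := hF.reg 2 rfl
    have hl := length_finRange_split h5
    simp [h2] at f2 hl
    simp [Cond.Holds, f2, h6, hl]
  · rintro t s' ⟨⟨h5, h6, h7, h8, h9, h10, h11⟩, h12, h13⟩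
    simp at h12
    refine ⟨fun v => h8 v (by simp), h9, fun v => h10 v (by simp), fun v => h11 v (by simp), ?_⟩
    omega

/-- Runs `body` for each neighbor `u` of the vertex in register `r`, with `u` in register `17`
and the label of its orbit in register `18`. -/
def forNbrs (r : ℕ) (body : Program) : Program :=
  .load 15 2 r ;; .load 16 0 15 ;; .succ 15 ;;
  .loop (.lt 0 16) (.load 17 0 15 ;; .succ 15 ;; .load 18 3 17 ;; body ;; .pred 16)

/-- A loop rule with an invariant `I` of the caller's choice. By `hI` it must not depend on
registers 15 to 18, which the pass itself uses; `hb` keeps the body away from the loop variables and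
the tables that drive the pass. A round costs the body, four further instructions and the test,
whence c + 5. -/
theorem wp_forNbrs {n : ℕ} {orb : Fin n → Fin n} {l : List (Fin n)} {body : Program} {s : State}
    {r : ℕ} (I : List (Fin n) → State → Prop) (c : ℕ)
    (h0 : s.reg 0 = 0) (hl : Reads (s.arr 0) (s.arr 2 (s.reg r)) (encList encVertex l))
    (h3 : ∀ v : Fin n, s.arr 3 v = orb v)
    (hb : body.writesReg 0 = false ∧ body.writesReg 15 = false ∧ body.writesReg 16 = false ∧
      body.writesArr 0 = false ∧ body.writesArr 3 = false)
    (hI : ∀ D s s', s'.arr = s.arr → (∀ x, x < 15 ∨ 18 < x → s'.reg x = s.reg x) →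
      I D s → I D s')
    (step : ∀ D (a : Fin n) R s', D ++ a :: R = l → Frame (forNbrs r body) s s' → s'.reg 17 = a →
      s'.reg 18 = orb a → I D s' → WP body s' fun t s'' => I (D ++ [a]) s'' ∧ t ≤ c)
    (h : I [] s) :
    WP (forNbrs r body) s fun t s' => I l s' ∧ t ≤ (c + 5) * l.length + 4 ∧
      Frame (forNbrs r body) s s' := by
  suffices H : WP (forNbrs r body) s fun t s' => I l s' ∧ t ≤ (c + 5) * l.length + 4 by
    refine H.frame.mono ?_
    tauto
  obtain ⟨b0, b15, b16, ba0, ba3⟩ := hb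
  simp only [forNbrs, wp_seq, wp_load, wp_succ]
  refine (WP.loop_list (α := Fin n) _
    (fun D r s' => D ++ r = l ∧ s'.reg 16 = r.length ∧
      Reads (s.arr 0) (s'.reg 15) (r.flatMap encVertex) ∧ I D s')
    (fun _ => c + 4) ?_ ?_ (r := l) ?_).mono ?_
  · rintro D a R s' hF ⟨h5, h6, h7, h8⟩
    have f0 := hF.reg 0 (by simp [Program.writesReg, b0])
    have fa := hF.arr 0 (by simp [Program.writesArr, ba0])
    have fa3 := hF.arr 3 (by simp [Program.writesArr, ba3])
    simp [h0] at f0 fa fa3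
    refine ⟨by simp [Cond.Holds, f0, h6], ?_⟩
    rw [reads_encVertices_cons] at h7
    obtain ⟨h9, h10⟩ := h7
    simp only [wp_seq, wp_load, wp_succ, wp_pred]
    refine (step D a R _ h5 ?_ ?_ ?_ ?_).frame.mono ?_
    · constructor
      · intro x hx
        simp only [forNbrs, Program.writesReg, Bool.or_eq_false_iff, beq_eq_false_iff_ne] at hx
        have := hF.reg x (by simp [Program.writesReg, hx])
        simp [hx, this]
      · intro A hA
        simp only [forNbrs, Program.writesArr, Bool.or_eq_false_iff] at hA
        have := hF.arr A (by simp [Program.writesArr, hA])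
        simp [this]
    · simp [fa, h9]
    · simp [fa, h9, fa3, h3]
    · refine hI _ _ _ ?_ ?_ h8
      · simp
      · intro x hx
        have h15 : x ≠ 15 := by omega
        have h17 : x ≠ 17 := by omega
        have h18 : x ≠ 18 := by omega
        simp [h15, h17, h18]
    · rintro t s'' ⟨⟨h11, h12⟩, h13⟩
      have g15 := h13.reg 15 b15
      have g16 := h13.reg 16 b16
      simp at g15 g16
      refine ⟨⟨by simpa using h5, by simp [g16, h6], by simpa [g15] using h10, ?_⟩, by omega⟩
      refine hI _ _ _ ?_ ?_ h11
      · simp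
      · intro x hx
        have h16 : x ≠ 16 := by omega
        simp [h16]
  · rintro D s' hF ⟨h5, h6, -⟩
    simp [Cond.Holds, h6]
  · obtain ⟨h9, h10⟩ := hl
    refine ⟨rfl, by simpa using h9, by simpa using h10, hI _ _ _ (by simp) ?_ h⟩
    intro x hx
    have h15 : x ≠ 15 := by omega
    have h16 : x ≠ 16 := by omega
    simp [h15, h16]
  · rintro t s' ⟨⟨h5, h6, h7, h8⟩, h12, h13⟩
    refine ⟨h8, ?_⟩
    simp at h12
    have : (c + 5) * l.length = l.length * (c + 4 + 1) := by ring
    omega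

/-! ### Searching the connected components -/

/-- The state of a search for the components of the relation `R` on the set `D`, with the numbers
`comp` of the components found so far, which are at most `m`. The elements of `P` are processed,
those of `W` are waiting. -/
structure SearchInv {α : Type} (D : Set α) (R : α → α → Prop) (comp : α → ℕ) (m : ℕ)
    (P W : List α) : Prop where
  nodup : (P ++ W).Nodup
  ne_zero_iff : ∀ o, comp o ≠ 0 ↔ o ∈ P ++ W
  mem : ∀ o ∈ P ++ W, o ∈ D
  le : ∀ o, comp o ≤ m
  closed : ∀ o ∈ P, ∀ o', R o o' → comp o' = comp o
  waiting : ∀ o ∈ W, comp o = m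
  connected : ∀ o o', comp o ≠ 0 → comp o' = comp o → Relation.EqvGen (fun x y => x ∈ D ∧ R x y) o o'
  attained : ∀ c, 1 ≤ c → c ≤ m → ∃ o, comp o = c

theorem SearchInv.init {α : Type} (D : Set α) (R : α → α → Prop) :
    SearchInv D R (fun _ => 0) 0 [] [] := by
  constructor <;> simp
  omega

/-- With an empty queue all earlier components are closed, so an element without a number opens a
new one. The number m + 1 has not occurred before, which keeps the new component apart. -/
theorem SearchInv.start {α : Type} [DecidableEq α] {D : Set α} {R : α → α → Prop} {comp : α → ℕ}
    {m : ℕ} {P : List α} (h : SearchInv D R comp m P []) {o : α} (ho : o ∈ D) (h0 : comp o = 0) :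
    SearchInv D R (Function.update comp o (m + 1)) (m + 1) P [o] := by
  have hoP : o ∉ P := by simpa [h0] using (h.ne_zero_iff o).not
  have hne : ∀ x, comp x ≠ 0 → Function.update comp o (m + 1) x = comp x := by
    intro x hx
    rw [Function.update_of_ne]
    rintro rfl
    exact hx h0
  have hlt : ∀ x, comp x ≠ m + 1 := fun x => by have := h.le x; omega
  constructor
  · rw [List.nodup_append]
    refine ⟨by simpa using h.nodup, by simp, ?_⟩
    simp only [List.mem_singleton, forall_eq]
    rintro a ha rfl
    exact hoP ha
  · intro x
    have := h.ne_zero_iff x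
    by_cases hx : x = o
    · simp [hx]
    · simpa [hx, Function.update_of_ne hx] using this
  · intro x hx
    rw [List.mem_append, List.mem_singleton] at hx
    rcases hx with hx | rfl
    · exact h.mem x (by simpa using hx)
    · exact ho
  · intro x
    have := h.le x
    rw [Function.update_apply]
    split_ifs <;> omega
  · intro x hx y hxy
    have h1 : comp x ≠ 0 := (h.ne_zero_iff x).2 (by simpa using hx)
    have h2 := h.closed x hx y hxy
    rw [hne x h1, hne y (by rwa [h2]), h2]
  · intro x hx
    obtain rfl : x = o := by simpa using hx
    simp
  · intro x y h1 h2
    by_cases hx : x = o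
    · by_cases hy : y = o
      · rw [hx, hy]
        exact .refl o
      · rw [hx, Function.update_self, Function.update_of_ne hy] at h2
        exact absurd h2 (hlt y)
    · by_cases hy : y = o
      · rw [hy, Function.update_self, Function.update_of_ne hx] at h2
        exact absurd h2.symm (hlt x)
      · rw [Function.update_of_ne hx] at h1
        rw [Function.update_of_ne hx, Function.update_of_ne hy] at h2
        exact h.connected x y h1 h2
  · intro c h1 h2
    rcases Nat.lt_or_ge c (m + 1) with h3 | h3
    · obtain ⟨x, hx⟩ := h.attained c h1 (by omega)
      exact ⟨x, by rw [hne x (by omega), hx]⟩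
    · exact ⟨o, by rw [Function.update_self]; omega⟩

/-- The unnumbered successors `N` of `o` receive the current number m and join the queue. Symmetry
of `R` is what excludes a successor of `o` in an earlier component: such an element has been
processed, so its own closedness would have given `o` the earlier number. -/
theorem SearchInv.process {α : Type} {D : Set α} {R : α → α → Prop} {comp comp' : α → ℕ}
    {m : ℕ} {P W N : List α} {o : α} (h : SearchInv D R comp m P (o :: W))
    (hsymm : ∀ x ∈ D, ∀ y, R x y → R y x) (hD : ∀ x ∈ D, ∀ y, R x y → y ∈ D)
    (hnew : ∀ x, comp x = 0 → R o x → comp' x = m)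
    (hold : ∀ x, ¬ (comp x = 0 ∧ R o x) → comp' x = comp x)
    (hN : N.Nodup) (hmem : ∀ x, x ∈ N ↔ comp x = 0 ∧ R o x) :
    SearchInv D R comp' m (P ++ [o]) (W ++ N) := by
  have hoD : o ∈ D := h.mem o (by simp)
  have hom : comp o = m := h.waiting o (by simp)
  have ho0 : comp o ≠ 0 := (h.ne_zero_iff o).2 (by simp)
  have hne : ∀ x, comp x ≠ 0 → comp' x = comp x := fun x hx => hold x fun h => hx h.1
  have heq : (P ++ [o]) ++ (W ++ N) = (P ++ o :: W) ++ N := by simp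
  have hcases : ∀ x, comp' x ≠ 0 → comp' x = comp x ∧ comp x ≠ 0 ∨ comp' x = m ∧ R o x := by
    intro x hx
    by_cases h1 : comp x = 0 ∧ R o x
    · exact .inr ⟨hnew x h1.1 h1.2, h1.2⟩
    · exact .inl ⟨hold x h1, by rwa [← hold x h1]⟩
  constructor
  · rw [heq, List.nodup_append]
    refine ⟨h.nodup, hN, ?_⟩
    rintro a ha b hb rfl
    exact (h.ne_zero_iff a).2 ha ((hmem a).1 hb).1
  · intro x
    rw [heq, List.mem_append, ← h.ne_zero_iff x, hmem]
    by_cases h1 : comp x = 0 ∧ R o x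
    · rw [hnew x h1.1 h1.2]
      exact ⟨fun _ => .inr h1, fun _ => by omega⟩
    · rw [hold x h1]
      exact ⟨.inl, fun h2 => h2.resolve_right h1⟩
  · intro x hx
    rw [heq, List.mem_append] at hx
    rcases hx with hx | hx
    · exact h.mem x hx
    · exact hD o hoD x ((hmem x).1 hx).2
  · intro x
    by_cases h1 : comp x = 0 ∧ R o x
    · rw [hnew x h1.1 h1.2]
    · rw [hold x h1]
      exact h.le x
  · intro x hx y hxy
    rw [List.mem_append, List.mem_singleton] at hx
    rcases hx with hx | rfl
    · have h1 : comp x ≠ 0 := (h.ne_zero_iff x).2 (by simp [hx])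
      have h2 := h.closed x hx y hxy
      rw [hne x h1, hne y (by rwa [h2]), h2]
    · rw [hne x ho0, hom]
      by_cases hy : comp y = 0
      · exact hnew y hy hxy
      · rw [hne y hy]
        have hy' := (h.ne_zero_iff y).1 hy
        rw [List.mem_append] at hy'
        -- A numbered successor is either processed, and then symmetry and its closedness apply, or
        -- waiting, and then its number is m.
        rcases hy' with hy' | hy'
        · rw [← hom]
          exact (h.closed y hy' x (hsymm x hoD y hxy)).symm
        · exact h.waiting y hy'
  · intro x hx
    rw [List.mem_append] at hx
    rcases hx with hx | hx
    · rw [hne x ((h.ne_zero_iff x).2 (by simp [hx]))]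
      exact h.waiting x (by simp [hx])
    · rw [hmem] at hx
      exact hnew x hx.1 hx.2
  -- Everything numbered m is joined to `o`: old members by the invariant, new ones by a single
  -- step.
  · have key : ∀ x, comp' x = m → Relation.EqvGen (fun x y => x ∈ D ∧ R x y) o x := by
      intro x hx
      rcases hcases x (by omega) with ⟨h1, h2⟩ | ⟨h1, h2⟩
      · exact h.connected o x ho0 (by omega)
      · exact .rel _ _ ⟨hoD, h2⟩
    intro x y h1 h2
    rcases hcases x h1 with ⟨h3, h4⟩ | ⟨h3, h4⟩
    · rcases hcases y (by rwa [h2]) with ⟨h5, h6⟩ | ⟨h5, h6⟩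
      · exact h.connected x y h4 (by omega)
      · exact ((key x (by omega)).symm _ _).trans _ _ _ (key y h5)
    · exact ((key x h3).symm _ _).trans _ _ _ (key y (by omega))
  · intro c h1 h2
    obtain ⟨x, hx⟩ := h.attained c h1 h2
    exact ⟨x, by rw [hne x (by omega), hx]⟩

/-! ### The search on the machine. -/

/-- The graph with adjacency lists `nb` and the orbit labels `orb` have been read. -/
structure Loaded {n : ℕ} (nb : Fin n → List (Fin n)) (orb : Fin n → Fin n) (s : State) : Prop where
  zero : s.reg 0 = 0
  nbrs : ∀ v : Fin n, Reads (s.arr 0) (s.arr 2 v) (encList encVertex (nb v))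
  label : ∀ v : Fin n, s.arr 3 v = orb v

theorem Loaded.frame {n : ℕ} {nb : Fin n → List (Fin n)} {orb : Fin n → Fin n} {s s' : State}
    {p : Program} (h : Loaded nb orb s) (hF : Frame p s s')
    (hp : (p.writesReg 0 || p.writesArr 0 || p.writesArr 2 || p.writesArr 3) = false) :
    Loaded nb orb s' := by
  simp only [Bool.or_eq_false_iff] at hp
  constructor
  · rw [hF.reg 0 hp.1.1.1, h.zero]
  · rw [hF.arr 0 hp.1.1.2, hF.arr 2 hp.1.2]
    exact h.nbrs
  · rw [hF.arr 3 hp.2]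
    exact h.label

theorem Loaded.congr {n : ℕ} {nb : Fin n → List (Fin n)} {orb : Fin n → Fin n} {s s' : State}
    (h : Loaded nb orb s) (h0 : s'.reg 0 = s.reg 0) (h1 : s'.arr 0 = s.arr 0)
    (h2 : s'.arr 2 = s.arr 2) (h3 : s'.arr 3 = s.arr 3) :
    Loaded nb orb s' := by
  constructor
  · rw [h0, h.zero]
  · rw [h1, h2]
    exact h.nbrs
  · rw [h3]
    exact h.label

/-- The orbit `o` contains some but not all of the vertices of `l`. -/
def MeetsProperly {n : ℕ} (orb : Fin n → Fin n) (l : List (Fin n)) (o : Fin n) : Prop :=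
  (l.map orb).count o ≠ 0 ∧ (l.map orb).count o ≠ orbitSize orb o

/-- An instruction without effect on the algorithm. -/
def nop : Program := .const 22 0

def countBody : Program := .load 19 7 18 ;; .succ 19 ;; .store 7 18 19

/-- To be run after counting: a neighbor's orbit is hit improperly exactly if its counter equals its
size. Otherwise the orbit is numbered and enqueued, unless it has a number already; that test also
makes further neighbors in the same orbit harmless. -/
def labelBody : Program :=
  .load 19 7 18 ;; .load 20 4 18 ;;
  .ite (.eq 19 20) nop
    (.load 19 6 18 ;; .ite (.eq 19 0) (.store 6 18 11 ;; .store 8 13 18 ;; .succ 13) nop)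

/-- Only the counters raised for the current representative are cleared, by a second visit to the
same neighbors; clearing the whole array would cost n steps per orbit. -/
def resetBody : Program := .store 7 18 0

/-- Processes the next orbit of the queue. -/
def processOrbit : Program :=
  .load 14 8 12 ;; .succ 12 ;; .load 23 5 14 ;;
  forNbrs 23 countBody ;; forNbrs 23 labelBody ;; forNbrs 23 resetBody

theorem wp_count {n : ℕ} {nb : Fin n → List (Fin n)} {orb : Fin n → Fin n} {s : State} {v : Fin n}
    (hL : Loaded nb orb s) (hv : s.reg 23 = v) (h7 : ∀ x : Fin n, s.arr 7 x = 0) :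
    WP (forNbrs 23 countBody) s fun t s' =>
      (∀ x : Fin n, s'.arr 7 x = ((nb v).map orb).count x) ∧ t ≤ 8 * (nb v).length + 4 := by
  refine (wp_forNbrs (orb := orb) (l := nb v)
    (fun D s' => ∀ x : Fin n, s'.arr 7 x = (D.map orb).count x) 3
    hL.zero (by rw [hv]; exact hL.nbrs v) hL.label ⟨rfl, rfl, rfl, rfl, rfl⟩ ?_ ?_ ?_).mono ?_
  · intro D s s' h _ h'
    rwa [h]
  · intro D a R s' hl hF h17 h18 h
    simp only [countBody, wp_seq, wp_load, wp_succ, wp_store]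
    simp [h18, Function.update_apply, ← Fin.ext_iff]
    intro x
    split_ifs with hx
    · simp [h, hx]
    · simp [h, Ne.symm hx]
  · simpa using h7
  · rintro t s' ⟨h1, h2, -⟩
    exact ⟨h1, h2⟩

theorem wp_reset {n : ℕ} {nb : Fin n → List (Fin n)} {orb : Fin n → Fin n} {s : State} {v : Fin n}
    (hL : Loaded nb orb s) (hv : s.reg 23 = v)
    (h7 : ∀ x : Fin n, s.arr 7 x = ((nb v).map orb).count x) :
    WP (forNbrs 23 resetBody) s fun t s' =>
      (∀ x : Fin n, s'.arr 7 x = 0) ∧ t ≤ 6 * (nb v).length + 4 := by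
  refine (wp_forNbrs (orb := orb) (l := nb v)
    (fun D s' => ∀ x : Fin n, s'.arr 7 x = if x ∈ D.map orb then 0 else s.arr 7 x) 1
    hL.zero (by rw [hv]; exact hL.nbrs v) hL.label ⟨rfl, rfl, rfl, rfl, rfl⟩ ?_ ?_ ?_).mono ?_
  · intro D s s' h _ h'
    rwa [h]
  · intro D a R s' hl hF h17 h18 h
    have f0 := hF.reg 0 rfl
    rw [hL.zero] at f0
    simp only [resetBody, wp_store]
    refine ⟨fun x => ?_, le_rfl⟩
    simp only [State.setArr_arr, if_true, h18, f0, Function.update_apply, ← Fin.ext_iff]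
    by_cases hx : x = orb a
    · simp [hx]
    · rw [if_neg hx, h x]
      simp [hx]
  · simp
  · rintro t s' ⟨h1, h2, -⟩
    refine ⟨fun x => ?_, h2⟩
    rw [h1 x]
    split_ifs with hx
    · rfl
    · rw [h7 x, List.count_eq_zero]
      exact hx

/-- `N` lists the orbits newly enqueued. Because m ≠ 0, a number once given is recognized at the
next neighbor in that orbit, so `N` has no repetitions. -/
theorem wp_label {n : ℕ} {nb : Fin n → List (Fin n)} {orb : Fin n → Fin n} {s : State} {v : Fin n}
    {Q : List (Fin n)} {m : ℕ}
    (hL : Loaded nb orb s) (hv : s.reg 23 = v)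
    (h4 : ∀ x : Fin n, s.arr 4 x = orbitSize orb x)
    (h7 : ∀ x : Fin n, s.arr 7 x = ((nb v).map orb).count x)
    (h11 : s.reg 11 = m) (hm : m ≠ 0) (h13 : s.reg 13 = Q.length)
    (h8 : Reads (s.arr 8) 0 (Q.map Fin.val)) :
    WP (forNbrs 23 labelBody) s fun t s' => (∃ N : List (Fin n), N.Nodup ∧
      (∀ x, x ∈ N ↔ s.arr 6 x = 0 ∧ MeetsProperly orb (nb v) x) ∧
      (∀ x : Fin n, s'.arr 6 x = if x ∈ N then m else s.arr 6 x) ∧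
      Reads (s'.arr 8) 0 ((Q ++ N).map Fin.val) ∧ s'.reg 13 = (Q ++ N).length) ∧
      t ≤ 13 * (nb v).length + 4 := by
  refine (wp_forNbrs (orb := orb) (l := nb v)
    (fun D s' => ∃ N : List (Fin n), N.Nodup ∧
      (∀ x, x ∈ N ↔ s.arr 6 x = 0 ∧ x ∈ D.map orb ∧
        ((nb v).map orb).count x ≠ orbitSize orb x) ∧
      (∀ x : Fin n, s'.arr 6 x = if x ∈ N then m else s.arr 6 x) ∧
      Reads (s'.arr 8) 0 ((Q ++ N).map Fin.val) ∧ s'.reg 13 = (Q ++ N).length) 8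
    hL.zero (by rw [hv]; exact hL.nbrs v) hL.label ⟨rfl, rfl, rfl, rfl, rfl⟩ ?_ ?_ ?_).mono ?_
  · intro D s s' h hx h'
    rwa [h, hx 13 (by simp)]
  · rintro D a R s' hl hF h17 h18 ⟨N, hN1, hN2, hN3, hN4, hN5⟩
    have f0 := hF.reg 0 rfl
    have f11 := hF.reg 11 rfl
    have f4 := hF.arr 4 rfl
    have f7 := hF.arr 7 rfl
    rw [hL.zero] at f0
    rw [h11] at f11
    simp only [labelBody, nop, wp_seq, wp_load, wp_ite, wp_const, wp_store, wp_succ, Cond.Holds]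
    simp only [State.setReg_reg, State.setReg_arr, State.setArr_arr, State.setArr_reg, f0, f11,
      f4, f7, h7, h18]
    simp only [OfNat.zero_ne_ofNat, if_true, if_false, Nat.reduceEqDiff, h4]
    refine ⟨fun hc => ⟨⟨N, hN1, fun x => ?_, hN3, hN4, hN5⟩, by omega⟩, fun hc =>
      ⟨fun h6 => ⟨⟨N ++ [orb a], ?_, fun x => ?_, fun x => ?_, ?_, ?_⟩, by omega⟩, fun h6 =>
        ⟨⟨N, hN1, fun x => ?_, hN3, hN4, hN5⟩, by omega⟩⟩⟩
    · rw [hN2]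
      by_cases hx : x = orb a
      · subst hx
        simp [hc]
      · simp [hx]
    · rw [List.nodup_append]
      refine ⟨hN1, by simp, ?_⟩
      simp only [List.mem_singleton, forall_eq]
      rintro x hx rfl
      rw [hN3, if_pos hx] at h6
      exact hm h6
    · rw [List.mem_append, hN2]
      by_cases hx : x = orb a
      · subst hx
        rw [hN3] at h6
        split_ifs at h6 with h9
        · exact absurd h6 hm
        · simpa [h6] using hc
      · simp [hx]
    · simp only [Function.update_apply, ← Fin.ext_iff, List.mem_append, List.mem_singleton]
      by_cases hx : x = orb a
      · simp [hx]
      · simp [hx, hN3]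
    · rw [← List.append_assoc, List.map_append, reads_append, hN5]
      refine ⟨hN4.update_of_ge (by simp), ?_⟩
      simp
    · rw [hN5]
      simp [Nat.add_assoc]
    · rw [hN2]
      by_cases hx : x = orb a
      · subst hx
        rw [hN3] at h6
        split_ifs at h6 with h9
        · rw [hN2] at h9
          simp [h9]
        · simp [h6]
      · simp [hx]
  · exact ⟨[], by simpa using ⟨h8, h13⟩⟩
  · rintro t s' ⟨⟨N, hN1, hN2, hN3, hN4, hN5⟩, h2, -⟩
    refine ⟨⟨N, hN1, fun x => ?_, hN3, hN4, hN5⟩, h2⟩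
    simp only [hN2, MeetsProperly, ne_eq, List.count_eq_zero, not_not]

/-- The state of the search in the machine: the queue is `Q`, and its first `h` elements are
processed. -/
structure SearchState {n : ℕ} (orb : Fin n → Fin n) (rep : Fin n → Fin n) (Q : List (Fin n))
    (h m : ℕ) (s : State) : Prop where
  size : ∀ x : Fin n, s.arr 4 x = orbitSize orb x
  rep : ∀ v : Fin n, s.arr 5 (orb v) = rep (orb v)
  count : ∀ x : Fin n, s.arr 7 x = 0
  queue : Reads (s.arr 8) 0 (Q.map Fin.val)
  head : s.reg 12 = h
  tail : s.reg 13 = Q.length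
  num : s.reg 11 = m

/-- Three passes over the neighbors of the representative, with slopes 8 + 13 + 6 = 27 and overhead
3 · 4 + 3 = 15. -/
theorem wp_processOrbit {n : ℕ} {nb : Fin n → List (Fin n)} {orb rep : Fin n → Fin n} {s : State}
    {P W : List (Fin n)} {v : Fin n} {m : ℕ}
    (hL : Loaded nb orb s) (hS : SearchState orb rep (P ++ orb v :: W) P.length m s) (hm : m ≠ 0) :
    WP processOrbit s fun t s' => (∃ N : List (Fin n), N.Nodup ∧
      (∀ x, x ∈ N ↔ s.arr 6 x = 0 ∧ MeetsProperly orb (nb (rep (orb v))) x) ∧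
      (∀ x : Fin n, s'.arr 6 x = if x ∈ N then m else s.arr 6 x) ∧
      SearchState orb rep ((P ++ orb v :: W) ++ N) (P.length + 1) m s') ∧
      t ≤ 27 * (nb (rep (orb v))).length + 15 := by
  obtain ⟨h4, h5, h7, h8, h12, h13, h11⟩ := hS
  have hQ := h8
  rw [List.map_append, reads_append, List.map_cons, reads_cons] at hQ
  have hq : s.arr 8 P.length = orb v := by simpa using hQ.2.1
  simp only [processOrbit, wp_seq, wp_load, wp_succ]
  refine (wp_count (nb := nb) (orb := orb) (v := rep (orb v)) ?_ ?_ ?_).frame.mono ?_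
  · exact hL.congr rfl rfl rfl rfl
  · simp [h12, hq, h5]
  · simpa using h7
  rintro t1 s1 ⟨⟨h1a, h1b⟩, hF1⟩
  have a4 := hF1.arr 4 rfl
  have a5 := hF1.arr 5 rfl
  have a6 := hF1.arr 6 rfl
  have a8 := hF1.arr 8 rfl
  have r11 := hF1.reg 11 rfl
  have r12 := hF1.reg 12 rfl
  have r13 := hF1.reg 13 rfl
  have r23 := hF1.reg 23 rfl
  simp [h12, hq, h5, h11, h13] at a4 a5 a6 a8 r11 r12 r13 r23
  have hL1 : Loaded nb orb s1 := by
    refine Loaded.frame ?_ hF1 rfl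
    exact hL.congr rfl rfl rfl rfl
  refine (wp_label (v := rep (orb v)) (Q := P ++ orb v :: W) (m := m) hL1 r23 ?_ h1a r11 hm
    (by simp [r13]) (by rwa [a8])).frame.mono ?_
  · rwa [a4]
  rintro t2 s2 ⟨⟨⟨N, hN1, hN2, hN3, hN4, hN5⟩, h2⟩, hF2⟩
  refine (wp_reset (v := rep (orb v)) (hL1.frame hF2 rfl) ?_ ?_).frame.mono ?_
  · rw [hF2.reg 23 rfl, r23]
  · rwa [hF2.arr 7 rfl]
  rintro t3 s3 ⟨⟨h3a, h3b⟩, hF3⟩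
  refine ⟨⟨N, hN1, ?_, ?_, ⟨?_, ?_, h3a, ?_, ?_, ?_, ?_⟩⟩, by omega⟩
  · rwa [a6] at hN2
  · rw [hF3.arr 6 rfl]
    rwa [a6] at hN3
  · rw [hF3.arr 4 rfl, hF2.arr 4 rfl, a4]
    exact h4
  · rw [hF3.arr 5 rfl, hF2.arr 5 rfl, a5]
    exact h5
  · rwa [hF3.arr 8 rfl]
  · rw [hF3.reg 12 rfl, hF2.reg 12 rfl, r12]
  · rw [hF3.reg 13 rfl, hN5]
  · rw [hF3.reg 11 rfl, hF2.reg 11 rfl, r11]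

/-- Processes the queue. -/
def processQueue : Program := .loop (.lt 12 13) processOrbit

/-- Numbers the components of the orbits of size at least two; register `11` becomes the number
of components and `arr 6 o` the number of the component of the orbit `o`. -/
def search : Program :=
  .const 10 0 ;; .const 11 0 ;; .const 12 0 ;; .const 13 0 ;; .const 21 1 ;;
  .loop (.lt 10 2) (.load 14 3 10 ;; .load 20 4 14 ;;
    .ite (.lt 21 20)
      (.load 19 6 14 ;; .ite (.eq 19 0)
        (.succ 11 ;; .store 6 14 11 ;; .store 8 13 14 ;; .succ 13 ;; processQueue) nop) nop ;;
    .succ 10)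

/-- The orbits with at least two elements. -/
def nontrivialOrbits {n : ℕ} (orb : Fin n → Fin n) : Set (Fin n) :=
  {o | o ∈ Set.range orb ∧ 1 < orbitSize orb o}

/-- The numbers of the components in array `6`. -/
def State.comp (s : State) (n : ℕ) (o : Fin n) : ℕ := s.arr 6 o

/-- The queue grows while it is consumed, so the rule for loops over a fixed list does not apply.
Instead one inducts on a bound `k` for n minus the number of processed orbits. -/
theorem wp_processQueue {n : ℕ} {nb : Fin n → List (Fin n)} {orb rep : Fin n → Fin n} {s : State}
    {P W : List (Fin n)} {m : ℕ}
    (hsymm : ∀ x ∈ nontrivialOrbits orb, ∀ y, MeetsProperly orb (nb (rep x)) y →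
      MeetsProperly orb (nb (rep y)) x)
    (hD : ∀ x ∈ nontrivialOrbits orb, ∀ y, MeetsProperly orb (nb (rep x)) y →
      y ∈ nontrivialOrbits orb)
    (hL : Loaded nb orb s) (hS : SearchState orb rep (P ++ W) P.length m s) (hm : m ≠ 0)
    (hI : SearchInv (nontrivialOrbits orb) (fun x y => MeetsProperly orb (nb (rep x)) y)
      (s.comp n) m P W) :
    WP processQueue s fun t s' => ∃ P',
      SearchState orb rep (P ++ P') (P ++ P').length m s' ∧
      SearchInv (nontrivialOrbits orb) (fun x y => MeetsProperly orb (nb (rep x)) y)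
        (s'.comp n) m (P ++ P') [] ∧
      (∀ x, s.comp n x ≠ 0 → s'.comp n x ≠ 0) ∧
      t ≤ (P'.map fun o => 27 * (nb (rep o)).length + 16).sum + 1 := by
  suffices H : ∀ k P W s, n ≤ P.length + k → Loaded nb orb s →
      SearchState orb rep (P ++ W) P.length m s →
      SearchInv (nontrivialOrbits orb) (fun x y => MeetsProperly orb (nb (rep x)) y)
        (s.comp n) m P W →
      WP processQueue s fun t s' => ∃ P',
      SearchState orb rep (P ++ P') (P ++ P').length m s' ∧
      SearchInv (nontrivialOrbits orb) (fun x y => MeetsProperly orb (nb (rep x)) y)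
        (s'.comp n) m (P ++ P') [] ∧
      (∀ x, s.comp n x ≠ 0 → s'.comp n x ≠ 0) ∧
      t ≤ (P'.map fun o => 27 * (nb (rep o)).length + 16).sum + 1 from
    H n P W s (by omega) hL hS hI
  clear hL hS hI
  intro k
  induction k with
  | zero =>
    intro P W s hk hL hS hI
    -- No orbit enters the queue twice, so after n processed orbits nothing can be waiting.
    have h1 := List.Nodup.length_le_card hI.nodup
    rw [Fintype.card_fin, List.length_append] at h1
    obtain rfl : W = [] := List.length_eq_zero_iff.1 (by omega)
    rw [List.append_nil] at hS
    refine WP.loop_done (by simp [Cond.Holds, hS.head, hS.tail]) ⟨[], ?_⟩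
    simpa using ⟨hS, hI⟩
  | succ k ih =>
    intro P W s hk hL hS hI
    cases W with
    | nil =>
      rw [List.append_nil] at hS
      refine WP.loop_done (by simp [Cond.Holds, hS.head, hS.tail]) ⟨[], ?_⟩
      simpa using ⟨hS, hI⟩
    | cons o W =>
      refine WP.loop_step (by simp [Cond.Holds, hS.head, hS.tail]) ?_
      obtain ⟨v, rfl⟩ := (hI.mem o (by simp)).1
      refine (wp_processOrbit hL hS hm).frame.mono ?_
      rintro t1 s1 ⟨⟨⟨N, hN1, hN2, hN3, hN4⟩, ht1⟩, hF⟩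
      have hI1 : SearchInv (nontrivialOrbits orb) (fun x y => MeetsProperly orb (nb (rep x)) y)
          (s1.comp n) m (P ++ [orb v]) (W ++ N) := by
        refine hI.process hsymm hD ?_ ?_ hN1 hN2
        · intro x h1 h2
          simp only [State.comp]
          rw [hN3, if_pos ((hN2 x).2 ⟨h1, h2⟩)]
        · intro x h1
          simp only [State.comp]
          rw [hN3, if_neg fun h => h1 ((hN2 x).1 h)]
      refine (ih (P ++ [orb v]) (W ++ N) s1 (by simp; omega) (hL.frame hF rfl)
        (by simpa using hN4) hI1).mono ?_
      rintro t2 s2 ⟨P', h1, h2, h3, h4⟩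
      refine ⟨orb v :: P', by simpa using h1, by simpa using h2, ?_, ?_⟩
      · intro x hx
        apply h3
        simp only [State.comp] at hx ⊢
        rw [hN3]
        split_ifs
        · exact hm
        · exact hx
      · simp only [List.map_cons, List.sum_cons]
        omega

theorem sum_map_le_sum_of_nodup {n : ℕ} {l : List (Fin n)} (h : l.Nodup) (f : Fin n → ℕ) :
    (l.map f).sum ≤ ∑ v, f v := by
  rw [← List.sum_toFinset _ h]
  exact Finset.sum_le_sum_of_subset (Finset.subset_univ _)

theorem wp_search {n : ℕ} {nb : Fin n → List (Fin n)} {orb rep : Fin n → Fin n} {s : State}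
    (hsymm : ∀ x ∈ nontrivialOrbits orb, ∀ y, MeetsProperly orb (nb (rep x)) y →
      MeetsProperly orb (nb (rep y)) x)
    (hD : ∀ x ∈ nontrivialOrbits orb, ∀ y, MeetsProperly orb (nb (rep x)) y →
      y ∈ nontrivialOrbits orb)
    (hL : Loaded nb orb s) (h2 : s.reg 2 = n)
    (h4 : ∀ x : Fin n, s.arr 4 x = orbitSize orb x)
    (h5 : ∀ v : Fin n, s.arr 5 (orb v) = rep (orb v)) (hrep : ∀ v, orb (rep (orb v)) = orb v)
    (h6 : ∀ k, s.arr 6 k = 0) (h7 : ∀ k, s.arr 7 k = 0) :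
    WP search s fun t s' => (∃ P,
      SearchInv (nontrivialOrbits orb) (fun x y => MeetsProperly orb (nb (rep x)) y)
        (s'.comp n) (s'.reg 11) P []) ∧
      (∀ v, 1 < orbitSize orb (orb v) → s'.comp n (orb v) ≠ 0) ∧
      t ≤ 27 * ∑ v, (nb v).length + 32 * n + 10 := by
  simp only [search, wp_seq, wp_const]
  -- Amortized: the time of the inner loop is charged to the list `P` of processed orbits, and only
  -- 16 steps to each vertex of the outer loop.
  refine (WP.loop_list_time (α := Fin n) _
    (fun D r T s' => D ++ r = List.finRange n ∧ s'.reg 10 = D.length ∧ ∃ P,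
      SearchState orb rep P P.length (s'.reg 11) s' ∧
      SearchInv (nontrivialOrbits orb) (fun x y => MeetsProperly orb (nb (rep x)) y)
        (s'.comp n) (s'.reg 11) P [] ∧
      (∀ v ∈ D, 1 < orbitSize orb (orb v) → s'.comp n (orb v) ≠ 0) ∧
      T ≤ (P.map fun o => 27 * (nb (rep o)).length + 16).sum + 16 * D.length)
    ?_ ?_ (r := List.finRange n) ?_).mono ?_
  · rintro D a r T s' hF ⟨hl, h10, P, hS, hI, hc, hT⟩
    have f0 := hF.reg 0 rfl
    have f2 := hF.reg 2 rfl
    have f21 := hF.reg 21 rfl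
    simp [hL.zero, h2] at f0 f2 f21
    have ha := val_eq_length_of_finRange hl
    have hL1 : Loaded nb orb s' := by
      refine Loaded.frame ?_ hF rfl
      exact hL.congr rfl rfl rfl rfl
    have hll := length_finRange_split hl
    simp only [List.length_cons] at hll
    refine ⟨by simp only [Cond.Holds]; omega, ?_⟩
    have hl' : (D ++ [a]) ++ r = List.finRange n := by simpa using hl
    have h14 : s'.arr 3 D.length = orb a := by rw [← ha]; exact hL1.label a
    simp only [nop, wp_seq, wp_load, wp_ite, wp_const, wp_store, wp_succ, Cond.Holds]
    simp only [State.setReg_reg, State.setReg_arr, State.setArr_reg, f0, f21,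
      h10, h14]
    simp only [OfNat.zero_ne_ofNat, if_true, if_false, Nat.reduceEqDiff, hS.size]
    refine ⟨fun h1 => ⟨fun h3 => ?_, fun h3 => ?_⟩, fun h1 => ?_⟩
    · have hstart : SearchInv (nontrivialOrbits orb)
          (fun x y => MeetsProperly orb (nb (rep x)) y)
          (Function.update (s'.comp n) (orb a) (s'.reg 11 + 1)) (s'.reg 11 + 1) P [orb a] :=
        hI.start ⟨⟨a, rfl⟩, h1⟩ h3
      refine (wp_processQueue (nb := nb) (orb := orb) (rep := rep) (P := P) (W := [orb a])
        (m := s'.reg 11 + 1) hsymm hD ?_ ?_ (by omega) ?_).frame.mono ?_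
      · exact hL1.congr rfl rfl rfl rfl
      · constructor
        · simpa using hS.size
        · simpa using hS.rep
        · simpa using hS.count
        · simp only [State.setReg_arr, State.setArr_arr, if_true, hS.tail]
          rw [List.map_append, reads_append]
          refine ⟨hS.queue.update_of_ge (by simp), by simp⟩
        · simpa using hS.head
        · simpa using hS.tail
        · simp
      · convert hstart using 1
        funext x
        simp [State.comp, Function.update_apply, ← Fin.ext_iff]
      · rintro t s'' ⟨⟨P', h8, h9, h11, h12⟩, hF'⟩
        have g10 := hF'.reg 10 rfl
        simp [h10] at g10
        have g11 := h8.num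
        simp only [g11]
        refine ⟨hl', by simp [g10], P ++ P', ?_, ?_, ?_, ?_⟩
        · exact ⟨by simpa using h8.size, by simpa using h8.rep, by simpa using h8.count,
            by simpa using h8.queue, by simpa using h8.head, by simpa using h8.tail,
            by simpa using h8.num⟩
        · exact h9
        · intro v hv hs
          apply h11
          by_cases hva : orb v = orb a
          · simp [State.comp, hva]
          · simp [State.comp, ← Fin.ext_iff, hva]
            rw [List.mem_append, List.mem_singleton] at hv
            exact hc v (hv.resolve_right fun h => hva (h ▸ rfl)) hs
        · simp only [List.map_append, List.sum_append, List.length_append, List.length_singleton]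
          omega
    · refine ⟨hl', by simp, P, ?_, hI, ?_, by
        simp only [List.length_append, List.length_singleton]; omega⟩
      · exact ⟨hS.size, hS.rep, hS.count, hS.queue, hS.head, hS.tail, by simp⟩
      · intro v hv hs
        rw [List.mem_append, List.mem_singleton] at hv
        rcases hv with hv | rfl
        · exact hc v hv hs
        · exact h3
    · refine ⟨hl', by simp, P, ?_, hI, ?_, by
        simp only [List.length_append, List.length_singleton]; omega⟩
      · exact ⟨hS.size, hS.rep, hS.count, hS.queue, hS.head, hS.tail, by simp⟩
      · intro v hv hs
        rw [List.mem_append, List.mem_singleton] at hv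
        rcases hv with hv | rfl
        · exact hc v hv hs
        · exact absurd hs h1
  · rintro D T s' hF ⟨hl, h10, -⟩
    have f2 := hF.reg 2 rfl
    have hl := length_finRange_split hl
    simp [h2] at f2 hl
    simp [Cond.Holds, f2, h10, hl]
  · refine ⟨rfl, by simp, [], ?_, ?_, by simp, by simp⟩
    · exact ⟨h4, h5, fun x => h7 x, by simp, by simp, by simp, by simp⟩
    · convert SearchInv.init _ _ using 1
      · funext x
        simp [State.comp, h6]
      · simp
  · rintro t s' ⟨T, ⟨hl, h10, P, hS, hI, hc, hT⟩, ht, hF⟩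
    refine ⟨⟨P, hI⟩, fun v => hc v (by simp), ?_⟩
    have hP : ∀ o ∈ P, orb (rep o) = o := by
      intro o ho
      obtain ⟨v, rfl⟩ := (hI.mem o (by simpa using ho)).1
      exact hrep v
    -- Different orbits have different representatives, so their degrees add up to at most the sum
    -- of all degrees.
    have hnd : (P.map rep).Nodup := by
      refine List.Nodup.map_on ?_ (by simpa using hI.nodup)
      intro x hx y hy hxy
      rw [← hP x hx, hxy, hP y hy]
    have h8 := sum_map_le_sum_of_nodup hnd fun v => 27 * (nb v).length + 16
    rw [List.map_map] at h8
    simp only [Finset.sum_add_distrib, ← Finset.mul_sum, Finset.sum_const, Finset.card_univ,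
      Fintype.card_fin, smul_eq_mul] at h8
    have h9 : (P.map fun o => 27 * (nb (rep o)).length + 16).sum ≤ _ := h8
    rw [List.length_finRange] at hT
    omega

/-! ### Linked lists -/

/-- The linked list which starts in cell `p` contains the items `l`; it ends with cell `0`. -/
def Linked {α : Type*} (next : ℕ → ℕ) (Rep : ℕ → α → Prop) : ℕ → List α → Prop
  | p, [] => p = 0
  | p, a :: l => p ≠ 0 ∧ Rep p a ∧ Linked next Rep (next p) l

theorem Linked.mono {α : Type*} {next : ℕ → ℕ} {Rep Rep' : ℕ → α → Prop} {p : ℕ} {l : List α}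
    (h : Linked next Rep p l) (hR : ∀ q a, Rep q a → Rep' q a) : Linked next Rep' p l := by
  induction l generalizing p with
  | nil => exact h
  | cons a l ih => exact ⟨h.1, hR _ _ h.2.1, ih h.2.2⟩

/-- Cell `k` represents no item, so the list does not pass through it and its link is irrelevant. -/
theorem Linked.update {α : Type*} {next : ℕ → ℕ} {Rep : ℕ → α → Prop} {p k v : ℕ} {l : List α}
    (h : Linked next Rep p l) (hR : ∀ a, ¬ Rep k a) :
    Linked (Function.update next k v) Rep p l := by
  induction l generalizing p with
  | nil => exact h
  | cons a l ih =>
    refine ⟨h.1, h.2.1, ?_⟩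
    rw [Function.update_of_ne]
    · exact ih h.2.2
    · rintro rfl
      exact hR a h.2.1

/-- Sorts the items `1, …, reg 25` into linked lists according to the components of their points
in the array `A`. The heads of the lists are in the array `H`, the links in the array `N`. -/
def bucket (A H N : ℕ) : Program :=
  .loop (.lt 0 25) (.load 5 A 25 ;; .load 6 3 5 ;; .load 6 6 6 ;; .load 7 H 6 ;; .store N 25 7 ;;
    .store H 6 25 ;; .pred 25)

/-- Items are pushed to the front from the last to the first, so the buckets keep the original
order; later this keeps the cycles of one permutation together. The invariant records that the lists
only use cells beyond the remaining items, so linking the next cell disturbs none of them. -/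
theorem wp_bucket {α : Type*} {A H N : ℕ} {l : List α} {key : α → ℕ} {s : State}
    (hHN : H ≠ N) (hA : A ≠ H ∧ A ≠ N) (h3 : 3 ≠ H ∧ 3 ≠ N) (h6 : 6 ≠ H ∧ 6 ≠ N)
    (h0 : s.reg 0 = 0) (h25 : s.reg 25 = l.length)
    (hkey : ∀ i a, l[i]? = some a → s.arr 6 (s.arr 3 (s.arr A (i + 1))) = key a)
    (hH : ∀ c, s.arr H c = 0) :
    WP (bucket A H N) s fun t s' => (∀ c, Linked (s'.arr N)
      (fun p a => 0 < p ∧ l[p - 1]? = some a) (s'.arr H c) (l.filter (key · = c))) ∧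
      t ≤ 8 * l.length + 1 := by
  refine (WP.loop_list (α := α) s
    (fun d r s' => d ++ r = l.reverse ∧ s'.reg 25 = r.length ∧ ∀ c, Linked (s'.arr N)
      (fun p a => r.length < p ∧ l[p - 1]? = some a) (s'.arr H c)
        (d.reverse.filter (key · = c)))
    (fun _ => 7) ?_ ?_ (r := l.reverse) ?_).mono ?_
  · rintro d a r s' hF ⟨hl, h1, h2⟩
    have f0 := hF.reg 0 rfl
    have fA := hF.arr A (by simp [Program.writesArr, hA])
    have f3 := hF.arr 3 (by simp [Program.writesArr, h3])
    have f6 := hF.arr 6 (by simp [Program.writesArr, h6])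
    rw [h0] at f0
    refine ⟨by simp [Cond.Holds, f0, h1], ?_⟩
    have hl' : l = r.reverse ++ a :: d.reverse := by
      rw [← l.reverse_reverse, ← hl]
      simp
    have hla : l[r.length]? = some a := by simp [hl']
    simp only [wp_seq, wp_load, wp_store, wp_pred]
    simp [h1, fA, f3, f6, hkey _ a hla, hHN, hHN.symm]
    refine ⟨by simpa using hl, fun c => ?_⟩
    have hup : ∀ v c, Linked (Function.update (s'.arr N) (r.length + 1) v)
        (fun p a => r.length < p ∧ l[p - 1]? = some a) (s'.arr H c)
        (d.reverse.filter (key · = c)) := by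
      intro v c
      refine ((h2 c).update (k := r.length + 1) ?_).mono ?_
      · simp
      · rintro q b ⟨h3, h4⟩
        rw [List.length_cons] at h3
        exact ⟨by omega, h4⟩
    rw [Function.update_apply]
    by_cases hc : c = key a
    · rw [if_pos hc, List.filter_cons_of_pos (by simp [hc])]
      refine ⟨by simp, ⟨by simp, by simpa using hla⟩, ?_⟩
      rw [Function.update_self, ← hc]
      exact hup _ c
    · rw [if_neg hc, List.filter_cons_of_neg (by simpa using Ne.symm hc)]
      exact hup _ c
  · rintro d s' hF ⟨hl, h1, -⟩
    simp [Cond.Holds, h1]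
  · refine ⟨rfl, by simp [h25], fun c => ?_⟩
    simpa [Linked] using hH c
  · rintro t s' ⟨⟨-, -, h1⟩, h2, -⟩
    refine ⟨fun c => ?_, by simpa [mul_comm] using h2⟩
    simpa using h1 c

/-! ### Writing the output -/

/-- The component of a cycle. -/
def cycleKey {n : ℕ} (κ : Fin n → ℕ) (c : List (Fin n)) : ℕ := (c.head?.map κ).getD 0

/-- Everything is ready for the output: the components `κ` of the vertices have been computed,
and the vertices and the cycles `its` are sorted by their components. -/
structure Tables {n : ℕ} (nb : Fin n → List (Fin n)) (orb : Fin n → Fin n) (κ : Fin n → ℕ)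
    (its : List (List (Fin n) × ℕ)) (s : State) : Prop extends Loaded nb orb s where
  comp : ∀ v, s.arr 6 (orb v) = κ v
  point : ∀ v : Fin n, s.arr 16 (v + 1) = v
  vertices : ∀ c, Linked (s.arr 10) (fun p (v : Fin n) => p = v + 1) (s.arr 9 c)
    ((List.finRange n).filter (κ · = c))
  cycles : ∀ c, Linked (s.arr 12) (CycleAt (s.arr 0) s) (s.arr 11 c)
    (its.filter (cycleKey κ ·.1 = c))
  tag_zero : s.arr 13 0 = 0

/-- The output phase writes only to array 1, so the tables stay valid throughout. -/
theorem Tables.congr {n : ℕ} {nb : Fin n → List (Fin n)} {orb : Fin n → Fin n} {κ : Fin n → ℕ}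
    {its : List (List (Fin n) × ℕ)} {s s' : State} (h : Tables nb orb κ its s)
    (h0 : s'.reg 0 = s.reg 0) (hA : ∀ A, A ≠ 1 → s'.arr A = s.arr A) : Tables nb orb κ its s' where
  toLoaded := h.toLoaded.congr h0 (hA _ (by simp)) (hA _ (by simp)) (hA _ (by simp))
  comp := by rw [hA 6 (by simp)]; exact h.comp
  point := by rw [hA 16 (by simp)]; exact h.point
  vertices := by rw [hA 9 (by simp), hA 10 (by simp)]; exact h.vertices
  cycles := by
    rw [hA 0 (by simp), hA 11 (by simp), hA 12 (by simp)]
    intro c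
    refine (h.cycles c).mono ?_
    intro q x hq
    unfold CycleAt at *
    rwa [hA 13 (by simp), hA 14 (by simp), hA 15 (by simp)]
  tag_zero := by rw [hA 13 (by simp)]; exact h.tag_zero

theorem Tables.frame {n : ℕ} {nb : Fin n → List (Fin n)} {orb : Fin n → Fin n} {κ : Fin n → ℕ}
    {its : List (List (Fin n) × ℕ)} {s s' : State} {p : Program} (h : Tables nb orb κ its s)
    (hF : Frame p s s') (h0 : p.writesReg 0 = false) (hp : ∀ A, A ≠ 1 → p.writesArr A = false) :
    Tables nb orb κ its s' :=
  h.congr (hF.reg 0 h0) fun A hA => hF.arr A (hp A hA)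

/-- Writes the neighbor in register `17` if it belongs to the component `reg 24`. -/
def filterBody : Program :=
  .load 5 6 18 ;; .ite (.eq 5 24) (.store 1 3 17 ;; .succ 3 ;; .succ 28) nop

/-- Writes the row of the vertex in register `26`. -/
def emitRow : Program :=
  .store 1 3 26 ;; .succ 3 ;; .load 5 3 26 ;; .store 1 3 5 ;; .succ 3 ;; .copy 27 3 ;; .succ 3 ;;
  .const 28 0 ;; forNbrs 26 filterBody ;; .store 1 27 28

theorem wp_emitRow {n : ℕ} {nb : Fin n → List (Fin n)} {orb : Fin n → Fin n} {κ : Fin n → ℕ}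
    {its : List (List (Fin n) × ℕ)} {s : State} {v : Fin n} {l : List ℕ}
    (hT : Tables nb orb κ its s) (hv : s.reg 26 = v) (hW : Written s l) :
    WP emitRow s fun t s' =>
      Written s' (l ++ encRow (v, (orb v : ℕ), (nb v).filter (κ · = s.reg 24))) ∧
      t ≤ 11 * (nb v).length + 13 := by
  simp only [emitRow, wp_seq, wp_load, wp_store, wp_succ, wp_copy, wp_const]
  obtain ⟨hW1, hW2⟩ := hW
  -- Here `x` is the unknown content of the cell reserved for the number of neighbors inside the
  -- component.
  refine (wp_forNbrs (orb := orb) (l := nb v)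
    (fun D s' => s'.reg 28 = (D.filter (κ · = s.reg 24)).length ∧
      ∃ x, Written s' ((l ++ [(v : ℕ), (orb v : ℕ)]) ++
        x :: (D.filter (κ · = s.reg 24)).flatMap encVertex)) 6
    ?_ ?_ ?_ ⟨rfl, rfl, rfl, rfl, rfl⟩ ?_ ?_ ?_).mono ?_
  · exact hT.zero
  · simpa [hv] using hT.nbrs v
  · exact hT.label
  · intro D s s' h hx h'
    rw [hx 28 (by simp)]
    exact ⟨h'.1, h'.2.imp fun x hW => hW.congr (by rw [h]) (hx 3 (by simp))⟩
  · rintro D a R s' hl hF h17 h18 ⟨h1, x, h2⟩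
    have f6 := hF.arr 6 rfl
    have f24 := hF.reg 24 rfl
    simp at f6 f24
    simp only [filterBody, nop, wp_seq, wp_load, wp_ite, wp_const, wp_store, wp_succ, Cond.Holds]
    simp only [State.setReg_reg, f6, f24, h18, hT.comp]
    simp only [if_true, if_false, Nat.reduceEqDiff]
    refine ⟨fun hc => ⟨⟨?_, x, ?_⟩, by omega⟩, fun hc => ⟨⟨?_, x, ?_⟩, by omega⟩⟩
    · simp [h1, hc]
    · rw [List.filter_append, List.filter_cons_of_pos (by simpa using hc), List.flatMap_append,
        ← List.cons_append, ← List.append_assoc]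
      exact h2.push (by simp [h17]) (by simp)
    · simp [h1, hc]
    · rw [List.filter_append, List.filter_cons_of_neg (by simpa using hc)]
      rw [List.filter_nil, List.append_nil]
      exact h2.congr rfl rfl
  · refine ⟨by simp, s.arr 1 (l.length + 2), ?_, by simp [hW2]⟩
    simp [hv, hW2, hT.label]
    refine ⟨Reads.update_of_ge (hW1.update_of_ge ?_) ?_, ?_⟩
    · simp
    · simp
    · rw [Function.update_of_ne (by omega)]
  · rintro t s' ⟨⟨h1, x, h2⟩, h3, hF⟩
    have r27 := hF.reg 27 rfl
    simp [hW2] at r27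
    refine ⟨?_, by omega⟩
    have := h2.patch (s' := s'.setArr 1 (s'.reg 27) (s'.reg 28)) (b := s'.reg 28)
      (by simp [r27]) rfl
    simpa [encRow, encList, h1] using this

/-- The rows of the subgraph induced on the component `c`, coloured by the orbit labels. -/
def componentRows {n : ℕ} (nb : Fin n → List (Fin n)) (orb : Fin n → Fin n) (κ : Fin n → ℕ)
    (c : ℕ) : List (Row n) :=
  ((List.finRange n).filter (κ · = c)).map fun v => (v, (orb v : ℕ), (nb v).filter (κ · = c))

/-- Writes the rows of the component `reg 24`. -/
def emitRows : Program :=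
  .copy 29 3 ;; .succ 3 ;; .const 30 0 ;; .load 31 9 24 ;;
  .loop (.lt 0 31) (.load 26 16 31 ;; emitRow ;; .succ 30 ;; .load 31 10 31) ;;
  .store 1 29 30

theorem wp_emitRows {n : ℕ} {nb : Fin n → List (Fin n)} {orb : Fin n → Fin n} {κ : Fin n → ℕ}
    {its : List (List (Fin n) × ℕ)} {s : State} {l : List ℕ}
    (hT : Tables nb orb κ its s) (hW : Written s l) :
    WP emitRows s fun t s' =>
      Written s' (l ++ encList encRow (componentRows nb orb κ (s.reg 24))) ∧
      t ≤ (((List.finRange n).filter (κ · = s.reg 24)).map fun v => 11 * (nb v).length + 17).sum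
        + 6 := by
  simp only [emitRows, wp_seq, wp_load, wp_store, wp_succ, wp_copy, wp_const]
  set row : Fin n → Row n := fun v => (v, (orb v : ℕ), (nb v).filter (κ · = s.reg 24)) with hrow
  refine (WP.loop_list (α := Fin n) _
    (fun D r s' => s'.reg 30 = D.length ∧
      Linked (s.arr 10) (fun p (v : Fin n) => p = v + 1) (s'.reg 31) r ∧
      ∃ x, Written s' (l ++ x :: (D.map row).flatMap encRow))
    (fun v => 11 * (nb v).length + 16) ?_ ?_
    (r := (List.finRange n).filter (κ · = s.reg 24)) ?_).mono ?_
  · rintro D a r s' hF ⟨h1, ⟨h2, h3, h4⟩, x, h5⟩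
    have f0 := hF.reg 0 rfl
    have f10 := hF.arr 10 rfl
    have f24 := hF.reg 24 rfl
    simp [hT.zero] at f0 f10 f24
    have hT' : Tables nb orb κ its s' := by
      refine Tables.frame ?_ hF rfl ?_
      · exact hT.congr rfl fun A hA => rfl
      · intro A hA
        simp [Program.writesArr, emitRow, forNbrs, filterBody, nop, hA]
    refine ⟨by simp only [Cond.Holds, f0]; omega, ?_⟩
    simp only [wp_seq, wp_load, wp_succ]
    refine (wp_emitRow (nb := nb) (orb := orb) (κ := κ) (its := its) (v := a)
      (l := l ++ x :: (D.map row).flatMap encRow) ?_ ?_ ?_).frame.mono ?_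
    · exact hT'.congr rfl fun A hA => rfl
    · simp [h3, hT'.point]
    · exact h5.congr rfl rfl
    · rintro t s'' ⟨⟨h6, h7⟩, hF'⟩
      have g10 := hF'.arr 10 rfl
      have g30 := hF'.reg 30 rfl
      have g31 := hF'.reg 31 rfl
      simp [h1] at g10 g30 g31
      refine ⟨⟨by simp [g30], by simpa [g10, g31, f10] using h4, x, ?_⟩, by omega⟩
      have h8 : Written s'' _ := h6
      simp only [State.setReg_reg, f24] at h8
      refine Written.congr (s := s'') ?_ rfl rfl
      simpa [hrow] using h8
  · rintro D s' hF ⟨h1, h2, -⟩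
    have f0 := hF.reg 0 rfl
    simp [hT.zero] at f0
    have h2 : s'.reg 31 = 0 := h2
    simp [Cond.Holds, f0, h2]
  · refine ⟨by simp, by simpa using hT.vertices (s.reg 24), s.arr 1 l.length, ?_⟩
    exact hW.push (by simp [hW.2]) (by simp)
  · rintro t s' ⟨⟨h1, h2, x, h3⟩, h4, hF⟩
    have r29 := hF.reg 29 rfl
    simp [hW.2] at r29
    have h5 : t ≤ (((List.finRange n).filter (κ · = s.reg 24)).map
      fun v => 11 * (nb v).length + 17).sum + 1 := h4
    refine ⟨?_, by omega⟩
    have := h3.patch (s' := s'.setArr 1 (s'.reg 29) (s'.reg 30)) (b := s'.reg 30)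
      (by simp [r29]) rfl
    rw [h1] at this
    simpa [encList, componentRows, h1] using this

/-! ### Writing the generators of a component. -/

/-- Writes the cycle in cell `reg 31` of the list of cycles. -/
def emitCycle : Program :=
  .load 15 14 31 ;; .load 16 0 15 ;; .store 1 3 16 ;; .succ 3 ;; .succ 15 ;;
  .loop (.lt 0 16) (.load 17 0 15 ;; .store 1 3 17 ;; .succ 3 ;; .succ 15 ;; .pred 16)

theorem wp_emitCycle {n : ℕ} {s : State} {l : List ℕ} {c : List (Fin n)} (h0 : s.reg 0 = 0)
    (hc : Reads (s.arr 0) (s.arr 14 (s.reg 31)) (encList encVertex c)) (hW : Written s l) :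
    WP emitCycle s fun t s' => Written s' (l ++ encList encVertex c) ∧ t ≤ 6 * c.length + 6 := by
  obtain ⟨hc1, hc2⟩ := hc
  simp only [emitCycle, wp_seq, wp_load, wp_store, wp_succ]
  refine (WP.loop_list (α := Fin n) _
    (fun D r s' => s'.reg 16 = r.length ∧ Reads (s.arr 0) (s'.reg 15) (r.flatMap encVertex) ∧
      Written s' ((l ++ [c.length]) ++ D.flatMap encVertex)) (fun _ => 5) ?_ ?_ (r := c) ?_).mono ?_
  · rintro D a r s' hF ⟨h1, h2, h3⟩
    have f0 := hF.reg 0 rfl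
    have a0 := hF.arr 0 rfl
    simp [h0] at f0 a0
    rw [reads_encVertices_cons] at h2
    refine ⟨by simp [Cond.Holds, f0, h1], ?_⟩
    simp only [wp_seq, wp_load, wp_store, wp_succ, wp_pred]
    refine ⟨⟨by simp [h1], by simpa using h2.2, ?_⟩, by omega⟩
    rw [List.flatMap_append, ← List.append_assoc]
    exact h3.push (by simp [a0, h2.1]) (by simp)
  · rintro D s' hF ⟨h1, -⟩
    simp [Cond.Holds, h1]
  · refine ⟨by simpa using hc1, by simpa using hc2, ?_⟩
    rw [List.flatMap_nil, List.append_nil]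
    exact hW.push (by simp [hc1]) (by simp)
  · rintro t s' ⟨⟨-, -, h1⟩, h2, -⟩
    simp at h2
    exact ⟨by simpa [encList] using h1, by omega⟩

/-- Writes the cycles from cell `reg 31` of the list of cycles on, as long as their tag is
`reg 33`, and counts them in register `30`. -/
def emitGroup : Program :=
  .loop (.eq 33 34) (.succ 30 ;; emitCycle ;; .load 31 12 31 ;; .load 34 13 31)

/-- Writes the permutations of the component `reg 24`, and counts them in register `32`. -/
def emitGens : Program :=
  .load 31 11 24 ;;
  .loop (.lt 0 31) (.load 33 13 31 ;; .copy 34 33 ;; .succ 32 ;; .copy 29 3 ;; .succ 3 ;;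
    .const 30 0 ;; emitGroup ;; .store 1 29 30)

/-- The restrictions of the permutations to the component `c`, tagged with their numbers. -/
def taggedGroups {n : ℕ} (κ : Fin n → ℕ) (c : ℕ) : ℕ → List (Cycles n) → List (ℕ × Cycles n)
  | _, [] => []
  | k, cs :: r =>
    if cs.filter (cycleKey κ · = c) = [] then taggedGroups κ c (k + 1) r
    else (k + 1, cs.filter (cycleKey κ · = c)) :: taggedGroups κ c (k + 1) r

/-- The non-trivial restrictions of the permutations to the component `c`. -/
def componentGens {n : ℕ} (κ : Fin n → ℕ) (c : ℕ) (gens : List (Cycles n)) : List (Cycles n) :=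
  (gens.map (·.filter (cycleKey κ · = c))).filter (· ≠ [])

theorem taggedGroups_map_snd {n : ℕ} (κ : Fin n → ℕ) (c k : ℕ) (gens : List (Cycles n)) :
    (taggedGroups κ c k gens).map Prod.snd = componentGens κ c gens := by
  induction gens generalizing k with
  | nil => rfl
  | cons cs r ih =>
    simp only [taggedGroups, componentGens, List.map_cons] at ih ⊢
    split_ifs with h
    · rw [List.filter_cons_of_neg (by simpa using h), ih]
    · rw [List.filter_cons_of_pos (by simpa using h), List.map_cons, ih]

/-- The bucket of a component is a concatenation of blocks, one for each generator acting on it.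
This is the link between the flat list in memory and the list of restricted permutations. -/
theorem taggedGroups_flatMap {n : ℕ} (κ : Fin n → ℕ) (c k : ℕ) (gens : List (Cycles n)) :
    ((taggedGroups κ c k gens).flatMap fun g => g.2.map fun x => (x, g.1)) =
      (taggedCycles k gens).filter (cycleKey κ ·.1 = c) := by
  induction gens generalizing k with
  | nil => rfl
  | cons cs r ih =>
    have h1 : (cs.map fun x => (x, k + 1)).filter (cycleKey κ ·.1 = c) =
        (cs.filter (cycleKey κ · = c)).map fun x => (x, k + 1) := by
      rw [List.filter_map]
      rfl
    rw [taggedGroups, taggedCycles, List.filter_append, h1]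
    split_ifs with h
    · rw [h, ih]
      rfl
    · rw [List.flatMap_cons, ih]

theorem lt_of_mem_taggedGroups {n : ℕ} {κ : Fin n → ℕ} {c k : ℕ} {gens : List (Cycles n)}
    {g : ℕ × Cycles n} (hg : g ∈ taggedGroups κ c k gens) : k < g.1 := by
  induction gens generalizing k with
  | nil => simp [taggedGroups] at hg
  | cons cs r ih =>
    rw [taggedGroups] at hg
    split_ifs at hg with h
    · have := ih hg
      omega
    · rw [List.mem_cons] at hg
      rcases hg with rfl | hg
      · simp
      · have := ih hg
        omega

/-- Hence a change of tag marks the end of a block. -/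
theorem pairwise_taggedGroups {n : ℕ} (κ : Fin n → ℕ) (c k : ℕ) (gens : List (Cycles n)) :
    (taggedGroups κ c k gens).Pairwise fun g g' => g.1 ≠ g'.1 := by
  induction gens generalizing k with
  | nil => simp [taggedGroups]
  | cons cs r ih =>
    rw [taggedGroups]
    split_ifs with h
    · exact ih _
    · refine List.Pairwise.cons (fun g hg => ?_) (ih _)
      have := lt_of_mem_taggedGroups hg
      simp
      omega

theorem ne_nil_of_mem_taggedGroups {n : ℕ} {κ : Fin n → ℕ} {c k : ℕ} {gens : List (Cycles n)}
    {g : ℕ × Cycles n} (hg : g ∈ taggedGroups κ c k gens) : g.2 ≠ [] := by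
  have h : g.2 ∈ (taggedGroups κ c k gens).map Prod.snd := List.mem_map_of_mem hg
  rw [taggedGroups_map_snd] at h
  simpa using (List.mem_filter.1 h).2

/-- Register 34 always holds the tag of the current cell. The loop stops at the first cell with
another tag, or at the end cell 0, whose tag 0 differs from g ≠ 0. -/
theorem wp_emitGroup {n : ℕ} {s : State} {l : List ℕ} {cs : Cycles n} {g : ℕ}
    {rest : List (List (Fin n) × ℕ)}
    (h0 : s.reg 0 = 0) (h13 : s.arr 13 0 = 0) (hg : g ≠ 0) (h33 : s.reg 33 = g)
    (h34 : s.reg 34 = s.arr 13 (s.reg 31)) (h30 : s.reg 30 = 0)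
    (hL : Linked (s.arr 12) (CycleAt (s.arr 0) s) (s.reg 31) (cs.map (fun c => (c, g)) ++ rest))
    (hrest : ∀ x ∈ rest.head?, g ≠ x.2) (hW : Written s l) :
    WP emitGroup s fun t s' => Written s' (l ++ cs.flatMap (encList encVertex)) ∧
      s'.reg 30 = cs.length ∧ Linked (s.arr 12) (CycleAt (s.arr 0) s) (s'.reg 31) rest ∧
      t ≤ (cs.map fun c => 6 * c.length + 10).sum + 1 := by
  unfold emitGroup
  refine (WP.loop_list (α := List (Fin n)) _
    (fun D r s' => s'.reg 30 = D.length ∧ s'.reg 34 = s.arr 13 (s'.reg 31) ∧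
      Linked (s.arr 12) (CycleAt (s.arr 0) s) (s'.reg 31) (r.map (fun c => (c, g)) ++ rest) ∧
      Written s' (l ++ D.flatMap (encList encVertex))) (fun c => 6 * c.length + 9)
    ?_ ?_ (r := cs) ⟨by simpa using h30, h34, hL, by simpa using hW⟩).mono ?_
  · rintro D a r s' hF ⟨h1, h2, ⟨h3, h4, h5⟩, h6⟩
    have f0 := hF.reg 0 rfl
    have f33 := hF.reg 33 rfl
    have a0 := hF.arr 0 rfl
    have a12 := hF.arr 12 rfl
    have a13 := hF.arr 13 rfl
    have a14 := hF.arr 14 rfl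
    rw [h0] at f0
    refine ⟨by simp only [Cond.Holds]; rw [f33, h33, h2, h4.2.1], ?_⟩
    simp only [wp_seq, wp_load, wp_succ]
    refine (wp_emitCycle (c := a) (l := l ++ D.flatMap (encList encVertex)) ?_ ?_ ?_).frame.mono ?_
    · simpa using f0
    · simpa [a0, a14] using h4.1
    · exact h6.congr rfl rfl
    · rintro t s'' ⟨⟨h7, h8⟩, hF'⟩
      have g30 := hF'.reg 30 rfl
      have g31 := hF'.reg 31 rfl
      have g12 := hF'.arr 12 rfl
      have g13 := hF'.arr 13 rfl
      simp [h1, a12, a13] at g30 g31 g12 g13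
      refine ⟨⟨by simp [g30], by simp [g13], by simpa [g12, g31] using h5, ?_⟩, by omega⟩
      rw [List.flatMap_append, ← List.append_assoc]
      refine Written.congr (s := s'') ?_ rfl rfl
      simpa using h7
  · rintro D s' hF ⟨h1, h2, h3, -⟩
    have f33 := hF.reg 33 rfl
    simp only [Cond.Holds, f33, h33, h2]
    cases rest with
    | nil =>
      have h3 : s'.reg 31 = 0 := h3
      rwa [h3, h13]
    | cons x rest =>
      rw [h3.2.1.2.1]
      exact hrest x rfl
  · rintro t s' ⟨⟨h1, h2, h3, h4⟩, h5, -⟩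
    exact ⟨h4, h1, h3, h5⟩

/-- A group contains at least one cycle, and ten extra steps per cycle pay for the overhead of nine
per group. -/
theorem sum_groups_le {n : ℕ} {G : List (ℕ × Cycles n)} (hG : ∀ g ∈ G, g.2 ≠ []) :
    (G.map fun g => (g.2.map fun c => 6 * c.length + 10).sum + 8 + 1).sum ≤
      ((G.flatMap fun g => g.2.map fun x => (x, g.1)).map fun x => 6 * x.1.length + 20).sum := by
  induction G with
  | nil => simp
  | cons g G ih =>
    rw [List.flatMap_cons, List.map_append, List.sum_append, List.map_cons, List.sum_cons,
      List.map_map]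
    refine Nat.add_le_add ?_ (ih fun g' hg' => hG g' (List.mem_cons_of_mem _ hg'))
    have h1 : ∀ cs : Cycles n, (cs.map fun c => 6 * c.length + 10).sum + 10 * cs.length ≤
        (cs.map fun c => 6 * c.length + 20).sum := by
      intro cs
      induction cs with
      | nil => simp
      | cons c cs ih =>
        simp only [List.map_cons, List.sum_cons, List.length_cons]
        omega
    have h2 := List.length_pos_iff.2 (hG g (by simp))
    refine le_trans ?_ (h1 g.2)
    omega

theorem wp_emitGens {n : ℕ} {nb : Fin n → List (Fin n)} {orb : Fin n → Fin n} {κ : Fin n → ℕ}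
    {gens : List (Cycles n)} {s : State} {l : List ℕ}
    (hT : Tables nb orb κ (taggedCycles 0 gens) s) (hW : Written s l) :
    WP emitGens s fun t s' =>
      Written s' (l ++ (componentGens κ (s.reg 24) gens).flatMap (encList (encList encVertex))) ∧
      s'.reg 32 = s.reg 32 + (componentGens κ (s.reg 24) gens).length ∧
      t ≤ (((taggedCycles 0 gens).filter (cycleKey κ ·.1 = s.reg 24)).map
        fun x => 6 * x.1.length + 20).sum + 2 := by
  have hbuck := hT.cycles (s.reg 24)
  rw [← taggedGroups_flatMap] at hbuck
  rw [← taggedGroups_flatMap, ← taggedGroups_map_snd κ (s.reg 24) 0 gens]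
  have hne := fun g => ne_nil_of_mem_taggedGroups (κ := κ) (c := s.reg 24) (k := 0)
    (gens := gens) (g := g)
  have hlt := fun g => lt_of_mem_taggedGroups (κ := κ) (c := s.reg 24) (k := 0)
    (gens := gens) (g := g)
  have hpw := pairwise_taggedGroups κ (s.reg 24) 0 gens
  -- Only three properties of the groups are used below: they are non-empty, their tags are
  -- positive, and their tags are pairwise distinct.
  generalize taggedGroups κ (s.reg 24) 0 gens = G at *
  simp only [emitGens, wp_seq, wp_load]
  refine (WP.loop_list (α := ℕ × Cycles n) _
    (fun D r s' => D ++ r = G ∧ s'.reg 32 = s.reg 32 + D.length ∧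
      Linked (s.arr 12) (CycleAt (s.arr 0) s) (s'.reg 31)
        (r.flatMap fun g => g.2.map fun x => (x, g.1)) ∧
      Written s' (l ++ (D.map Prod.snd).flatMap (encList (encList encVertex))))
    (fun g => (g.2.map fun c => 6 * c.length + 10).sum + 8) ?_ ?_ (r := G) ?_).mono ?_
  · rintro D a r s' hF ⟨hG, h1, h2, h3⟩
    have f0 := hF.reg 0 rfl
    have f12 := hF.arr 12 rfl
    have f13 := hF.arr 13 rfl
    have a0 := hF.arr 0 rfl
    have a14 := hF.arr 14 rfl
    have a15 := hF.arr 15 rfl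
    simp [hT.zero] at f0 f12 f13 a0 a14 a15
    have haG : a ∈ G := by simp [← hG]
    have hCA : CycleAt (n := n) (s.arr 0) s = CycleAt (s.arr 0) s' := by
      funext k x
      unfold CycleAt
      rw [f13, a14, a15]
    rw [List.flatMap_cons] at h2
    have hne' := hne a haG
    have h31 : s'.reg 31 ≠ 0 ∧ s.arr 13 (s'.reg 31) = a.1 := by
      obtain ⟨g, cs⟩ := a
      cases cs with
      | nil => exact absurd rfl hne'
      | cons c cs => exact ⟨h2.1, h2.2.1.2.1⟩
    refine ⟨by simp only [Cond.Holds, f0]; omega, ?_⟩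
    simp only [wp_seq, wp_load, wp_succ, wp_copy, wp_const, wp_store]
    refine (wp_emitGroup (cs := a.2) (g := a.1)
      (l := (l ++ (D.map Prod.snd).flatMap (encList (encList encVertex))) ++ [s'.arr 1 (s'.reg 3)])
      (rest := r.flatMap fun g => g.2.map fun x => (x, g.1)) ?_ ?_ ?_ ?_ ?_ ?_ ?_ ?_ ?_).frame.mono ?_
    · simpa using f0
    · simpa [f13] using hT.tag_zero
    · have := hlt a haG
      omega
    · simp [f13, h31]
    · simp
    · simp
    · rw [hCA, ← f12, ← a0] at h2
      exact h2
    · intro x hx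
      have hx' := List.mem_of_mem_head? hx
      rw [List.mem_flatMap] at hx'
      obtain ⟨b, hb, hx'⟩ := hx'
      obtain ⟨y, -, rfl⟩ := List.mem_map.1 hx'
      rw [← hG] at hpw
      exact List.rel_of_pairwise_cons (List.pairwise_append.1 hpw).2.1 hb
    · exact h3.push (by simp) (by simp)
    · rintro t s'' ⟨⟨h4, h5, h6, h7⟩, hF'⟩
      have g29 := hF'.reg 29 rfl
      have g32 := hF'.reg 32 rfl
      simp [h1] at g29 g32
      refine ⟨⟨by simpa using hG, by simp [g32]; omega, ?_, ?_⟩, by omega⟩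
      · have h8 : Linked (s'.arr 12) (CycleAt (s'.arr 0) s') (s''.reg 31) _ := h6
        rw [f12, a0, ← hCA] at h8
        exact h8
      · rw [List.append_assoc, List.singleton_append] at h4
        have := h4.patch (s' := s''.setArr 1 (s''.reg 29) (s''.reg 30)) (b := s''.reg 30)
          (by simp [g29, h3.2]) rfl
        rw [h5] at this
        simpa [encList, h5] using this
  · rintro D s' hF ⟨hG, h1, h2, h3⟩
    have f0 := hF.reg 0 rfl
    simp [hT.zero] at f0
    have h2 : s'.reg 31 = 0 := h2
    simp [Cond.Holds, f0, h2]
  · refine ⟨rfl, by simp, by simpa using hbuck, ?_⟩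
    rw [List.map_nil, List.flatMap_nil, List.append_nil]
    exact hW.congr rfl rfl
  · rintro t s' ⟨⟨hG, h1, h2, h3⟩, h4, hF⟩
    refine ⟨h3, by simpa using h1, ?_⟩
    have := sum_groups_le hne
    omega

/-- The encoding of the pair that belongs to the component `c`. -/
def componentWord {n : ℕ} (nb : Fin n → List (Fin n)) (orb : Fin n → Fin n) (κ : Fin n → ℕ)
    (gens : List (Cycles n)) (c : ℕ) : List ℕ :=
  encList encRow (componentRows nb orb κ c) ++ encPerms (componentGens κ c gens)

/-- A bound for the time for the rows of the component `c`. -/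
def rowsCost {n : ℕ} (nb : Fin n → List (Fin n)) (κ : Fin n → ℕ) (c : ℕ) : ℕ :=
  (((List.finRange n).filter (κ · = c)).map fun v => 11 * (nb v).length + 17).sum

/-- A bound for the time for the permutations of the component `c`. -/
def gensCost {n : ℕ} (κ : Fin n → ℕ) (gens : List (Cycles n)) (c : ℕ) : ℕ :=
  (((taggedCycles 0 gens).filter (cycleKey κ ·.1 = c)).map fun x => 6 * x.1.length + 20).sum

/-- Writes the pair that belongs to the component `reg 24`. -/
def emitComponent : Program :=
  emitRows ;; .copy 35 3 ;; .succ 3 ;; .const 32 0 ;; emitGens ;; .store 1 35 32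

theorem wp_emitComponent {n : ℕ} {nb : Fin n → List (Fin n)} {orb : Fin n → Fin n}
    {κ : Fin n → ℕ} {gens : List (Cycles n)} {s : State} {l : List ℕ}
    (hT : Tables nb orb κ (taggedCycles 0 gens) s) (hW : Written s l) :
    WP emitComponent s fun t s' => Written s' (l ++ componentWord nb orb κ gens (s.reg 24)) ∧
      t ≤ rowsCost nb κ (s.reg 24) + gensCost κ gens (s.reg 24) + 15 := by
  simp only [emitComponent, wp_seq, wp_copy, wp_succ, wp_const, wp_store]
  refine (wp_emitRows hT hW).frame.mono ?_
  rintro t1 s1 ⟨⟨h1, ht1⟩, hF1⟩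
  change t1 ≤ rowsCost nb κ (s.reg 24) + 6 at ht1
  have r24 := hF1.reg 24 rfl
  have hT1 : Tables nb orb κ (taggedCycles 0 gens) s1 := by
    refine hT.frame hF1 rfl ?_
    intro A hA
    simp [Program.writesArr, emitRows, emitRow, forNbrs, filterBody, nop, hA]
  refine (wp_emitGens (nb := nb) (orb := orb) (κ := κ) (gens := gens)
    (l := (l ++ encList encRow (componentRows nb orb κ (s.reg 24))) ++ [s1.arr 1 (s1.reg 3)])
    ?_ ?_).frame.mono ?_
  · exact hT1.congr rfl fun A hA => rfl
  · exact h1.push (by simp) (by simp)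
  rintro t2 s2 ⟨⟨h2, h3, ht2⟩, hF2⟩
  change t2 ≤ gensCost κ gens (s1.reg 24) + 2 at ht2
  rw [r24] at ht2
  have r35 := hF2.reg 35 rfl
  simp [r24, h1.2] at h2 h3 r35
  refine ⟨?_, by omega⟩
  rw [← List.append_assoc] at h2
  have := h2.patch (s' := s2.setArr 1 (s2.reg 35) (s2.reg 32)) (b := s2.reg 32)
    (by simp [r35]) rfl
  rw [h3] at this
  simpa [componentWord, encPerms, encList, h3] using this

/-- Writes the pairs of the components and the permutations of all components. -/
def emitAll : Program :=
  .store 1 3 11 ;; .succ 3 ;; .const 24 0 ;; .loop (.lt 24 11) (.succ 24 ;; emitComponent) ;;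
  .copy 35 3 ;; .succ 3 ;; .const 32 0 ;; .const 24 0 ;; .loop (.lt 24 11) (.succ 24 ;; emitGens) ;;
  .store 1 35 32

/-- The output of the program. -/
def outputWord {n : ℕ} (nb : Fin n → List (Fin n)) (orb : Fin n → Fin n) (κ : Fin n → ℕ)
    (gens : List (Cycles n)) (m : ℕ) : List ℕ :=
  m :: (List.range m).flatMap (fun c => componentWord nb orb κ gens (c + 1)) ++
    encPerms ((List.range m).flatMap fun c => componentGens κ (c + 1) gens)

theorem eq_length_of_range {m a : ℕ} {d r : List ℕ} (h : d ++ a :: r = List.range m) :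
    a = d.length := by
  have h1 : (List.range m)[d.length]? = some a := by rw [← h]; simp
  rw [List.getElem?_eq_some_iff] at h1
  obtain ⟨h2, h3⟩ := h1
  rw [← h3]
  simp

theorem length_range_split {m : ℕ} {d r : List ℕ} (h : d ++ r = List.range m) :
    d.length + r.length = m := by
  rw [← List.length_append, h, List.length_range]

/-- Each item belongs to at most one component, so the costs of the components add up to at most the
cost of the whole list. -/
theorem sum_filter_le {α : Type*} (l : List α) (key : α → ℕ) (f : α → ℕ) (m : ℕ) :
    ((List.range m).map fun c => ((l.filter (key · = c + 1)).map f).sum).sum ≤ (l.map f).sum := by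
  induction l with
  | nil => simp
  | cons a l ih =>
    have h1 : ∀ c, (((a :: l).filter (key · = c + 1)).map f).sum =
        (if key a = c + 1 then f a else 0) + ((l.filter (key · = c + 1)).map f).sum := by
      intro c
      by_cases h : key a = c + 1 <;> simp [h]
    simp only [h1, List.sum_map_add, List.map_cons, List.sum_cons]
    refine Nat.add_le_add ?_ ih
    rw [← List.sum_toFinset _ List.nodup_range]
    rcases key a with _ | k
    · simp
    · simp only [Nat.add_right_cancel_iff, Finset.sum_ite_eq]
      split_ifs <;> simp

/-- The restricted generators are written twice, once inside the pairs and once as the separable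
set, which explains the factor 2. -/
theorem wp_emitAll {n m : ℕ} {nb : Fin n → List (Fin n)} {orb : Fin n → Fin n}
    {κ : Fin n → ℕ} {gens : List (Cycles n)} {s : State}
    (hT : Tables nb orb κ (taggedCycles 0 gens) s) (hm : s.reg 11 = m) (h3 : s.reg 3 = 0) :
    WP emitAll s fun t s' => Written s' (outputWord nb orb κ gens m) ∧
      t ≤ 11 * ∑ v, (nb v).length + 17 * n +
        2 * ((taggedCycles 0 gens).map fun x => 6 * x.1.length + 20).sum + 21 * m + 20 := by
  simp only [emitAll, wp_seq, wp_copy, wp_succ, wp_const, wp_store]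
  refine (WP.loop_list (α := ℕ) _
    (fun D r s' => D ++ r = List.range m ∧ s'.reg 24 = D.length ∧
      Written s' ([m] ++ D.flatMap fun c => componentWord nb orb κ gens (c + 1)))
    (fun c => rowsCost nb κ (c + 1) + gensCost κ gens (c + 1) + 16) ?_ ?_ (r := List.range m) ?_).mono ?_
  · rintro D a r s' hF ⟨hl, h1, h2⟩
    have r11 := hF.reg 11 rfl
    simp [hm] at r11
    have ha := eq_length_of_range hl
    have hll := length_range_split hl
    rw [List.length_cons] at hll
    have hT' : Tables nb orb κ (taggedCycles 0 gens) s' := by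
      refine Tables.frame ?_ hF rfl ?_
      · exact hT.congr rfl fun A hA => by simp [hA]
      · intro A hA
        simp [Program.writesArr, emitComponent, emitRows, emitGens, emitGroup, emitCycle,
          emitRow, forNbrs, filterBody, nop, hA]
    refine ⟨by simp only [Cond.Holds]; omega, ?_⟩
    simp only [wp_seq, wp_succ]
    refine (wp_emitComponent (nb := nb) (orb := orb) (κ := κ) (gens := gens)
      (l := [m] ++ D.flatMap fun c => componentWord nb orb κ gens (c + 1)) ?_ ?_).frame.mono ?_
    · exact hT'.congr rfl fun A hA => rfl
    · exact h2.congr rfl rfl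
    · rintro t s'' ⟨⟨h4, h5⟩, hF'⟩
      have g24 := hF'.reg 24 rfl
      simp [h1, ← ha] at g24 h4 h5
      refine ⟨⟨by simpa using hl, by simp [g24, ha], by simpa using h4⟩, by omega⟩
  · rintro D s' hF ⟨hl, h1, -⟩
    have r11 := hF.reg 11 rfl
    simp [hm] at r11
    have hll := length_range_split hl
    simp at hll
    simp [Cond.Holds, r11, h1, hll]
  · refine ⟨rfl, by simp, ?_⟩
    simp [Written, hm, h3]
  rintro t s1 ⟨⟨-, h1, h2⟩, h4, hF⟩
  have r11 := hF.reg 11 rfl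
  simp [hm] at r11
  have hT1 : Tables nb orb κ (taggedCycles 0 gens) s1 := by
    refine Tables.frame ?_ hF rfl ?_
    · exact hT.congr rfl fun A hA => by simp [hA]
    · intro A hA
      simp [Program.writesArr, emitComponent, emitRows, emitGens, emitGroup, emitCycle,
        emitRow, forNbrs, filterBody, nop, hA]
  set L : List ℕ := [m] ++ (List.range m).flatMap fun c => componentWord nb orb κ gens (c + 1)
    with hL
  refine (WP.loop_list (α := ℕ) _
    (fun D r s' => D ++ r = List.range m ∧ s'.reg 24 = D.length ∧
      s'.reg 32 = (D.flatMap fun c => componentGens κ (c + 1) gens).length ∧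
      Written s' (L ++ s1.arr 1 (s1.reg 3) ::
        (D.flatMap fun c => componentGens κ (c + 1) gens).flatMap (encList (encList encVertex))))
    (fun c => gensCost κ gens (c + 1) + 3) ?_ ?_ (r := List.range m) ?_).mono ?_
  · rintro D a r s' hF ⟨hl, h5, h6, h7⟩
    have r11' := hF.reg 11 rfl
    simp [r11] at r11'
    have ha := eq_length_of_range hl
    have hll := length_range_split hl
    rw [List.length_cons] at hll
    have hT' : Tables nb orb κ (taggedCycles 0 gens) s' := by
      refine Tables.frame ?_ hF rfl ?_
      · exact hT1.congr rfl fun A hA => by simp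
      · intro A hA
        simp [Program.writesArr, emitGens, emitGroup, emitCycle, hA]
    refine ⟨by simp only [Cond.Holds]; omega, ?_⟩
    simp only [wp_seq, wp_succ]
    refine (wp_emitGens (nb := nb) (orb := orb) (κ := κ) (gens := gens)
      (l := (L ++ s1.arr 1 (s1.reg 3) ::
        (D.flatMap fun c => componentGens κ (c + 1) gens).flatMap (encList (encList encVertex))))
      ?_ ?_).frame.mono ?_
    · exact hT'.congr rfl fun A hA => rfl
    · exact h7.congr rfl rfl
    · rintro t s'' ⟨⟨h8, h9, h10⟩, hF'⟩
      have h10 : t ≤ gensCost κ gens (s'.reg 24 + 1) + 2 := by simpa only [State.setReg_reg] using! h10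
      have g24 := hF'.reg 24 rfl
      simp [h5, ← ha] at g24 h8 h9
      rw [h5, ← ha] at h10
      refine ⟨⟨by simpa using hl, by simp [g24, ha], ?_, ?_⟩, by omega⟩
      · rw [List.flatMap_append, List.length_append, ← h6]
        simpa using h9
      · rw [List.flatMap_append, List.flatMap_append]
        simpa using h8
  · rintro D s' hF ⟨hl, h5, -⟩
    have r11' := hF.reg 11 rfl
    simp [r11] at r11'
    have hll := length_range_split hl
    simp at hll
    simp [Cond.Holds, r11', h5, hll]
  · refine ⟨rfl, by simp, by simp, ?_⟩
    exact h2.push (by simp) (by simp)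
  rintro t' s2 ⟨⟨-, -, h5, h6⟩, h7, hF'⟩
  have r35 := hF'.reg 35 rfl
  simp [h2.2] at r35
  constructor
  · have := h6.patch (s' := s2.setArr 1 (s2.reg 35) (s2.reg 32)) (b := s2.reg 32)
      (by simp [r35, hL]) rfl
    rw [h5] at this
    simpa [outputWord, encPerms, encList, hL, h5] using this
  · have e1 := sum_filter_le (List.finRange n) κ (fun v => 11 * (nb v).length + 17) m
    have e2 := sum_filter_le (taggedCycles 0 gens) (cycleKey κ ·.1)
      (fun x => 6 * x.1.length + 20) m
    change ((List.range m).map fun c => rowsCost nb κ (c + 1)).sum ≤ _ at e1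
    change ((List.range m).map fun c => gensCost κ gens (c + 1)).sum ≤ _ at e2
    have e3 : ((List.finRange n).map fun v => 11 * (nb v).length + 17).sum =
        11 * ∑ v, (nb v).length + 17 * n := by
      rw [← List.sum_toFinset _ (List.nodup_finRange n)]
      simp [Finset.sum_add_distrib, Finset.mul_sum, mul_comm]
    simp only [List.sum_map_add] at h4 h7
    simp only [List.map_const', List.sum_replicate, List.length_range, smul_eq_mul] at h4 h7
    omega

/-! ### Assembly of the algorithm and its total running time. -/

/-- The whole algorithm. -/
def decompose : Program :=
  parseRows ;; parseGens ;; readOrbits ;; search ;; .copy 25 2 ;; bucket 16 9 10 ;; .copy 25 9 ;;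
    bucket 15 11 12 ;; .store 13 0 0 ;; emitAll

theorem reads_initial (w : List ℕ) : Reads ((initial w).arr 0) 0 w := by
  rw [reads_iff]
  intro k hk
  simp [initial, hk]

/-- Every number up to m is attained. This bounds the overhead per component in the output phase by
a multiple of n. -/
theorem SearchInv.le_card {α : Type} [Fintype α] {D : Set α} {R : α → α → Prop} {comp : α → ℕ}
    {m : ℕ} {P W : List α} (h : SearchInv D R comp m P W) : m ≤ Fintype.card α := by
  have h0 : ∀ i : Fin m, ∃ o, comp o = i + 1 := fun i =>
    h.attained (i + 1) (by omega) (by omega)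
  choose f hf using h0
  have h1 : Function.Injective f := by
    intro i j hij
    have h2 := hf i
    have h3 := hf j
    rw [hij] at h2
    exact Fin.ext (by omega)
  simpa using Fintype.card_le_of_injective _ h1

theorem sum_taggedCycles_le {n : ℕ} (k : ℕ) (gens : List (Cycles n)) :
    ((taggedCycles k gens).map fun x => 6 * x.1.length + 20).sum ≤
      20 * (gens.flatMap (encList (encList encVertex))).length := by
  induction gens generalizing k with
  | nil => simp [taggedCycles]
  | cons cs r ih =>
    have h1 : (cs.map fun c => 6 * c.length + 20).sum ≤
        20 * (cs.flatMap (encList encVertex)).length := by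
      rw [List.length_flatMap, ← List.sum_map_mul_left]
      refine List.sum_le_sum fun c _ => ?_
      simp
      omega
    have h2 := ih (k + 1)
    simp only [taggedCycles, List.map_append, List.sum_append, List.map_map, List.flatMap_cons,
      List.length_append]
    have h3 : (cs.map ((fun x : List (Fin n) × ℕ => 6 * x.1.length + 20) ∘
      fun c => (c, k + 1))).sum ≤ 20 * (cs.flatMap (encList encVertex)).length := h1
    have h4 : (cs.flatMap (encList encVertex)).length ≤ (encList (encList encVertex) cs).length := by
      simp [encList]
    omega

theorem length_taggedCycles_le {n : ℕ} (k : ℕ) (gens : List (Cycles n)) :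
    20 * (taggedCycles k gens).length ≤
      ((taggedCycles k gens).map fun x => 6 * x.1.length + 20).sum := by
  generalize taggedCycles k gens = l
  induction l with
  | nil => simp
  | cons x l ih =>
    simp only [List.length_cons, List.map_cons, List.sum_cons]
    omega

/-- The representatives are chosen by the run itself, so `hsymm` is required for every possible
choice. Nothing about automorphisms enters except through `hsymm`. -/
theorem wp_decompose {n : ℕ} {rows : List (Row n)} {gens : List (Cycles n)} {orb : Fin n → Fin n}
    {nb : Fin n → List (Fin n)} {w : List ℕ}
    (hw : w = encList encRow rows ++ encPerms gens ++ List.ofFn (fun v => (orb v : ℕ)))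
    (hnd : (rows.map Prod.fst).Nodup) (hall : ∀ v, v ∈ rows.map Prod.fst)
    (hnb : ∀ r ∈ rows, r.2.2 = nb r.1) (hc : ∀ cs ∈ gens, ∀ c ∈ cs, c ≠ [])
    (hsymm : ∀ rep : Fin n → Fin n, (∀ v, orb (rep (orb v)) = orb v) →
      ∀ x ∈ nontrivialOrbits orb, ∀ y, MeetsProperly orb (nb (rep x)) y →
        MeetsProperly orb (nb (rep y)) x ∧ y ∈ nontrivialOrbits orb) :
    WP decompose (initial w) fun t s' => ∃ (rep : Fin n → Fin n) (comp : Fin n → ℕ) (m : ℕ)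
      (P : List (Fin n)), (∀ v, orb (rep (orb v)) = orb v) ∧
      SearchInv (nontrivialOrbits orb) (fun x y => MeetsProperly orb (nb (rep x)) y) comp m P [] ∧
      (∀ v, 1 < orbitSize orb (orb v) → comp (orb v) ≠ 0) ∧
      Written s' (outputWord nb orb (comp ∘ orb) gens m) ∧
      t ≤ 100 * (∑ v, (nb v).length + n + (encList encRow rows).length +
        (encPerms gens).length) := by
  have hlen : rows.length = n := by
    have h1 := (List.nodup_iff_count_eq_one.1 hnd)
    have h2 : (rows.map Prod.fst).toFinset = Finset.univ := by
      ext v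
      simpa using hall v
    have h3 := List.toFinset_card_of_nodup hnd
    rw [h2] at h3
    simpa using h3.symm
  have hr := reads_initial w
  rw [hw, reads_append, reads_append] at hr
  rw [← hw] at hr
  obtain ⟨⟨hr1, hr2⟩, hr3⟩ := hr
  simp only [decompose, wp_seq, wp_copy, wp_store]
  refine (wp_parseRows (rows := rows) rfl rfl hr1 hnd).mono ?_
  rintro t1 s1 ⟨h1a, h1b, h1c, ht1, hF1⟩
  have a1 := hF1.arr 0 rfl
  refine (wp_parseGens (gens := gens) (hF1.reg 0 rfl) ?_).mono ?_
  · rw [a1, h1a]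
    simpa using hr2
  rintro t2 s2 ⟨h2a, h2b, h2c, ht2, hF2⟩
  have a2 := (hF2.arr 0 rfl).trans a1
  refine (wp_readOrbits (orb := orb) ?_ ?_ ?_).mono ?_
  · rw [hF2.reg 2 rfl, h1b, hlen]
  · rw [a2, h2a, h1a]
    simpa using hr3
  · intro k
    rw [hF2.arr 4 rfl, hF1.arr 4 rfl]
    rfl
  rintro t3 s3 ⟨h3a, h3b, h3c, h3d, ht3, hF3⟩
  have a3 := (hF3.arr 0 rfl).trans a2
  -- Array 5 is meaningful only at labels of vertices; elsewhere `rep` is the identity, an arbitrary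
  -- value.
  have hrep : ∃ rep : Fin n → Fin n, (∀ v, orb (rep (orb v)) = orb v) ∧
      ∀ v, s3.arr 5 (orb v) = rep (orb v) := by
    choose u hu1 hu2 using h3c
    refine ⟨fun o => if h : ∃ v, orb v = o then u h.choose else o, ?_, ?_⟩
    · intro v
      have h : ∃ v', orb v' = orb v := ⟨v, rfl⟩
      dsimp only
      rw [dif_pos h, hu1, h.choose_spec]
    · intro v
      have h : ∃ v', orb v' = orb v := ⟨v, rfl⟩
      dsimp only
      rw [dif_pos h, ← hu2, h.choose_spec]
  obtain ⟨rep, hrep1, hrep2⟩ := hrep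
  have hL3 : Loaded nb orb s3 := by
    refine ⟨?_, ?_, h3a⟩
    · rw [hF3.reg 0 rfl, hF2.reg 0 rfl, hF1.reg 0 rfl]
      rfl
    · intro v
      obtain ⟨r, hr, rfl⟩ := List.mem_map.1 (hall v)
      rw [a3, hF3.arr 2 rfl, hF2.arr 2 rfl, ← hnb r hr]
      exact h1c r hr
  -- Component numbers, counters and bucket heads rely on memory being zero initially; they are
  -- never cleared beforehand.
  have hzero : ∀ A, A ∉ [0, 1, 2, 3, 4, 5, 13, 14, 15, 16] → ∀ k, s3.arr A k = 0 := by
    intro A hA k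
    simp only [List.mem_cons, List.not_mem_nil, or_false, not_or] at hA
    rw [hF3.arr A (by simp [Program.writesArr, readOrbits, hA]),
      hF2.arr A (by simp [Program.writesArr, parseGens, parseCycles, skip, hA]),
      hF1.arr A (by simp [Program.writesArr, parseRows, skip, hA])]
    simp [initial, hA]
  refine (wp_search (nb := nb) (orb := orb) (rep := rep) (fun x hx y hy => (hsymm rep hrep1 x hx y hy).1)
    (fun x hx y hy => (hsymm rep hrep1 x hx y hy).2) hL3 ?_ h3b hrep2 hrep1
    (hzero 6 (by simp)) (hzero 7 (by simp))).frame.mono ?_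
  · rw [hF3.reg 2 rfl, hF2.reg 2 rfl, h1b, hlen]
  rintro t4 s4 ⟨⟨⟨P, hI⟩, h4b, ht4⟩, hF4⟩
  have hL4 := hL3.frame hF4 rfl
  have hn4 : s4.reg 2 = n := by
    rw [hF4.reg 2 rfl, hF3.reg 2 rfl, hF2.reg 2 rfl, h1b, hlen]
  refine (wp_bucket (s := s4.setReg 25 (s4.reg 2)) (A := 16) (H := 9) (N := 10) (l := List.finRange n)
    (key := s4.comp n ∘ orb) (by simp) (by simp) (by simp) (by simp)
    hL4.zero (by simp [hn4]) ?_ ?_).frame.mono ?_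
  · intro i a hia
    rw [List.getElem?_eq_some_iff] at hia
    obtain ⟨hi, rfl⟩ := hia
    have h5 := h3d (List.finRange n)[i]
    rw [← hF4.arr 16 rfl] at h5
    have h6 : s4.arr 16 (i + 1) = ((List.finRange n)[i] : Fin n) := by simpa using h5
    simp only [State.setReg_arr]
    rw [h6, hL4.label]
    rfl
  · intro c
    rw [State.setReg_arr, hF4.arr 9 rfl]
    exact hzero 9 (by simp) c
  rintro t5 s5 ⟨⟨h5a, ht5⟩, hF5⟩
  have b5 : ∀ A, A ≠ 9 → A ≠ 10 → s5.arr A = s4.arr A := by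
    intro A hA hA'
    rw [hF5.arr A (by simp [Program.writesArr, bucket, hA, hA'])]
    rfl
  have hits5 : CyclesAt (s5.arr 0) s5 (taggedCycles 0 gens) := by
    rw [b5 0 (by simp) (by simp), hF4.arr 0 rfl, a3, ← a1]
    refine h2c.congr ?_ ?_ ?_
    · rw [b5 13 (by simp) (by simp), hF4.arr 13 rfl, hF3.arr 13 rfl]
    · rw [b5 14 (by simp) (by simp), hF4.arr 14 rfl, hF3.arr 14 rfl]
    · rw [b5 15 (by simp) (by simp), hF4.arr 15 rfl, hF3.arr 15 rfl]
  have hmem : ∀ x ∈ taggedCycles 0 gens, x.1 ≠ [] := by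
    intro x hx
    have : ∀ k (l : List (Cycles n)), x ∈ taggedCycles k l → ∃ cs ∈ l, x.1 ∈ cs := by
      intro k l
      induction l generalizing k with
      | nil => simp [taggedCycles]
      | cons cs l ih =>
        rw [taggedCycles, List.mem_append]
        rintro (h | h)
        · obtain ⟨c, hc, rfl⟩ := List.mem_map.1 h
          exact ⟨cs, by simp, hc⟩
        · obtain ⟨cs', h1, h2⟩ := ih _ h
          exact ⟨cs', by simp [h1], h2⟩
    obtain ⟨cs, hcs, hx⟩ := this 0 gens hx
    exact hc cs hcs _ hx
  have hL5 : Loaded nb orb s5 := by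
    refine Loaded.frame ?_ hF5 rfl
    exact hL4.congr rfl rfl rfl rfl
  refine (wp_bucket (s := s5.setReg 25 (s5.reg 9)) (A := 15) (H := 11) (N := 12) (l := taggedCycles 0 gens)
    (key := fun x => cycleKey (s4.comp n ∘ orb) x.1) (by simp) (by simp) (by simp) (by simp)
    hL5.zero ?_ ?_ ?_).frame.mono ?_
  · have r9 : s5.reg 9 = s2.reg 9 := by
      rw [hF5.reg 9 rfl, ← hF3.reg 9 rfl, ← hF4.reg 9 rfl]
      rfl
    simp [r9, h2b]
  · intro i x hx
    obtain ⟨-, -, h6⟩ := hits5 i x hx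
    have hne := hmem x (List.mem_of_getElem? hx)
    obtain ⟨c, tag⟩ := x
    cases c with
    | nil => exact absurd rfl hne
    | cons v c =>
      simp only [State.setReg_arr]
      rw [h6 v (by simp), hL5.label, b5 6 (by simp) (by simp)]
      rfl
  · intro c
    rw [State.setReg_arr, b5 11 (by simp) (by simp), hF4.arr 11 rfl]
    exact hzero 11 (by simp) c
  rintro t6 s6 ⟨⟨h6a, ht6⟩, hF6⟩
  have b6 : ∀ A, A ≠ 11 → A ≠ 12 → s6.arr A = s5.arr A := by
    intro A hA hA'
    rw [hF6.arr A (by simp [Program.writesArr, bucket, hA, hA'])]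
    rfl
  have hL6 : Loaded nb orb s6 := by
    refine Loaded.frame ?_ hF6 rfl
    exact hL5.congr rfl rfl rfl rfl
  have hT : Tables nb orb (s4.comp n ∘ orb) (taggedCycles 0 gens)
      (s6.setArr 13 (s6.reg 0) (s6.reg 0)) := by
    rw [hL6.zero]
    refine ⟨hL6.congr rfl rfl rfl rfl, ?_, ?_, ?_, ?_, ?_⟩
    · intro v
      change s6.arr 6 _ = _
      rw [b6 6 (by simp) (by simp), b5 6 (by simp) (by simp)]
      rfl
    · change ∀ v : Fin n, s6.arr 16 _ = _
      rw [b6 16 (by simp) (by simp), b5 16 (by simp) (by simp), hF4.arr 16 rfl]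
      exact h3d
    · change ∀ c, Linked (s6.arr 10) _ (s6.arr 9 c) _
      rw [b6 9 (by simp) (by simp), b6 10 (by simp) (by simp)]
      intro c
      refine (h5a c).mono ?_
      rintro q v ⟨hq, hv⟩
      rw [List.getElem?_eq_some_iff] at hv
      obtain ⟨h7, rfl⟩ := hv
      simp
      omega
    · intro c
      change Linked (s6.arr 12) (CycleAt (s6.arr 0) _) (s6.arr 11 c) _
      refine (h6a c).mono ?_
      rintro q x ⟨hq, hx⟩
      have h7 := hits5 _ x hx
      rw [Nat.sub_add_cancel hq] at h7
      rw [b6 0 (by simp) (by simp)]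
      unfold CycleAt at *
      -- Setting the tag of the end cell 0 affects no cycle, since cycles occupy cells q > 0.
      change Reads _ (s6.arr 14 q) _ ∧ Function.update (s6.arr 13) 0 0 q = _ ∧
        ∀ v ∈ x.1.head?, s6.arr 15 q = _
      rwa [Function.update_of_ne hq.ne', b6 13 (by simp) (by simp), b6 14 (by simp) (by simp),
        b6 15 (by simp) (by simp)]
    · simp
  have r11 : s6.reg 11 = s4.reg 11 := by
    rw [hF6.reg 11 rfl]
    exact hF5.reg 11 rfl
  have r3 : s6.reg 3 = 0 := by
    rw [hF6.reg 3 rfl]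
    refine (hF5.reg 3 rfl).trans ?_
    rw [State.setReg_reg]
    simp only [if_false, Nat.reduceEqDiff]
    rw [hF4.reg 3 rfl, hF3.reg 3 rfl, hF2.reg 3 rfl, hF1.reg 3 rfl]
    rfl
  refine (wp_emitAll (m := s4.reg 11) hT r11 r3).mono ?_
  rintro t7 s7 ⟨h7, ht7⟩
  refine ⟨rep, s4.comp n, s4.reg 11, P, hrep1, hI, h4b, h7, ?_⟩
  have e1 := hI.le_card
  have e2 := sum_taggedCycles_le 0 gens
  have e3 := length_taggedCycles_le 0 gens
  have e4 : (encPerms gens).length =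
    (gens.flatMap (encList (encList encVertex))).length + 1 := by
    simp only [encPerms]
    rw [encList, List.length_cons]
  have e5 : 1 ≤ (encList encRow rows).length := by
    rw [encList, List.length_cons]
    omega
  rw [Fintype.card_fin] at e1
  rw [List.length_finRange] at ht5
  omega

end RAM

/-! ### The decomposition of the automorphism group -/

/-- Some vertex of the orbit `o` is adjacent to some but not to all vertices of the orbit `o'`. -/
def NonHomogeneous {Ω C : Type} (G : ColoredGraph Ω) (orb : Ω → C) (o o' : C) : Prop :=
  ∃ x y y', orb x = o ∧ orb y = o' ∧ orb y' = o' ∧ s(x, y) ∈ G.E ∧ s(x, y') ∉ G.E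

/-- The numbers `κ v`, which are at most `m`, describe the connected components of the orbit graph;
the trivial orbits have number `0`. -/
structure IsComponentColoring {Ω C : Type} (G : ColoredGraph Ω) (orb : Ω → C) (κ : Ω → ℕ)
    (m : ℕ) : Prop where
  mem_V : ∀ v, v ∈ G.V
  orbits : IsOrbitColoring G.Aut orb
  of_orb : ∀ u v, orb u = orb v → κ u = κ v
  ne_zero_iff : ∀ v, κ v ≠ 0 ↔ ∃ u, u ≠ v ∧ orb u = orb v
  of_nonHomogeneous : ∀ x y, NonHomogeneous G orb (orb x) (orb y) → κ x = κ y
  connected : ∀ x y, κ x ≠ 0 → κ y = κ x → Relation.EqvGen (NonHomogeneous G orb) (orb x) (orb y)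
  le : ∀ v, κ v ≤ m
  attained : ∀ c, 1 ≤ c → c ≤ m → ∃ v, κ v = c

/-- The subgraph induced on the component `c`, with the orbits as colors. -/
def ColoredGraph.component {n : ℕ} (G : ColoredGraph (Fin n)) (orb : Fin n → Fin n)
    (κ : Fin n → ℕ) (c : ℕ) : ColoredGraph (Fin n) where
  V := Finset.univ.filter (κ · = c)
  E := G.E.filter (∀ v ∈ ·, κ v = c)
  mem_V := by
    intro e he v hv
    simpa using (Finset.mem_filter.1 he).2 v hv
  color := fun v => orb v

namespace IsComponentColoring

variable {n m : ℕ} {G : ColoredGraph (Fin n)} {orb : Fin n → Fin n} {κ : Fin n → ℕ}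

theorem orb_apply (h : IsComponentColoring G orb κ m) {σ : Perm (Fin n)} (hσ : σ ∈ G.Aut)
    (x : Fin n) : orb (σ x) = orb x :=
  (h.orbits _ _).2 ⟨⟨σ, hσ⟩, rfl⟩

theorem exists_of_orb_eq (h : IsComponentColoring G orb κ m) {x y : Fin n} (hxy : orb x = orb y) :
    ∃ σ ∈ G.Aut, σ y = x := by
  obtain ⟨⟨σ, hσ⟩, h1⟩ := (h.orbits _ _).1 hxy
  exact ⟨σ, hσ, h1⟩

theorem apply (h : IsComponentColoring G orb κ m) {σ : Perm (Fin n)} (hσ : σ ∈ G.Aut)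
    (x : Fin n) : κ (σ x) = κ x :=
  h.of_orb _ _ (h.orb_apply hσ x)

/-- Move one end point at a time within its orbit. Losing the edge at either step would make the two
orbits non-homogeneous and so put them in the same component. -/
theorem edge_of_ne (h : IsComponentColoring G orb κ m) {x y x' y' : Fin n} (hne : κ x ≠ κ y)
    (hx : orb x = orb x') (hy : orb y = orb y') (he : s(x, y) ∈ G.E) : s(x', y') ∈ G.E := by
  have h1 : s(x, y') ∈ G.E := by
    by_contra h2
    exact hne (h.of_nonHomogeneous x y ⟨x, y, y', rfl, rfl, hy.symm, he, h2⟩)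
  by_contra h2
  rw [Sym2.eq_swap] at h1 h2
  refine hne (h.of_nonHomogeneous y x ⟨y', x, x', hy.symm, rfl, hx.symm, h1, h2⟩).symm

theorem edge_iff_of_ne (h : IsComponentColoring G orb κ m) {x y x' y' : Fin n} (hne : κ x ≠ κ y)
    (hx : orb x = orb x') (hy : orb y = orb y') : s(x', y') ∈ G.E ↔ s(x, y) ∈ G.E := by
  refine ⟨h.edge_of_ne ?_ hx.symm hy.symm, h.edge_of_ne hne hx hy⟩
  rwa [← h.of_orb _ _ hx, ← h.of_orb _ _ hy]

theorem apply_eq_of_mem {c : ℕ} {σ : Perm (Fin n)} (hσ : σ ∈ (G.component orb κ c).Aut) {x : Fin n}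
    (hx : κ x ≠ c) : σ x = x :=
  hσ.1 x (by simpa [ColoredGraph.component] using hx)

/-- The orbit colors force an automorphism of the component to preserve the orbits of Aut(G). Pairs
inside component c are governed by the subgraph, pairs inside another component are fixed, and
adjacency between components depends only on the orbits. -/
theorem aut_component_le (h : IsComponentColoring G orb κ m) (c : ℕ) :
    (G.component orb κ c).Aut ≤ G.Aut := by
  intro σ hσ
  have hfix := fun x => apply_eq_of_mem hσ (x := x)
  obtain ⟨h1, h2, h3⟩ := hσ
  have horb : ∀ x, orb (σ x) = orb x := by
    intro x
    by_cases hx : κ x = c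
    · exact Fin.ext (h3 x (by simpa [ColoredGraph.component] using hx))
    · rw [hfix x hx]
  refine ⟨fun x hx => absurd (h.mem_V x) hx, fun x y => ?_, fun x _ => ?_⟩
  · by_cases hxy : κ x = κ y
    · by_cases hx : κ x = c
      · have h4 := h2 x y
        have h5 := h.of_orb _ _ (horb x)
        have h6 := h.of_orb _ _ (horb y)
        simpa [ColoredGraph.component, h5, h6, hx, ← hxy] using h4
      · rw [hfix x hx, hfix y (hxy ▸ hx)]
    · exact h.edge_iff_of_ne hxy (horb x).symm (horb y).symm
  -- The original color is constant on orbits, so preserving orbits preserves it.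
  · obtain ⟨τ, hτ, h4⟩ := h.exists_of_orb_eq (horb x)
    rw [← h4]
    exact hτ.2.2 x (h.mem_V x)

/-- The restriction of an automorphism to a component. -/
theorem exists_restriction (h : IsComponentColoring G orb κ m) {σ : Perm (Fin n)} (hσ : σ ∈ G.Aut)
    (c : ℕ) : ∃ ρ ∈ (G.component orb κ c).Aut, ∀ x, ρ x = if κ x = c then σ x else x := by
  have hκ := h.apply hσ
  have hκ' : ∀ x, κ (σ.symm x) = κ x := h.apply (inv_mem hσ)
  refine ⟨⟨fun x => if κ x = c then σ x else x, fun x => if κ x = c then σ⁻¹ x else x, ?_, ?_⟩,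
    ⟨?_, ?_, ?_⟩, fun x => rfl⟩
  · intro x
    by_cases hx : κ x = c <;> simp [hx, hκ]
  · intro x
    by_cases hx : κ x = c <;> simp [hx, hκ']
  · intro x hx
    have hx : κ x ≠ c := by simpa [ColoredGraph.component] using hx
    simp [hx]
  · intro x y
    by_cases hx : κ x = c <;> by_cases hy : κ y = c <;>
      simp [ColoredGraph.component, hx, hy, hκ, hσ.2.1]
  · intro x hx
    have hx : κ x = c := by simpa [ColoredGraph.component] using hx
    simp [ColoredGraph.component, hx, h.orb_apply hσ]

/-- A point with non-zero number is moved by some automorphism, hence also by its restriction to the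
component. Number 0 is excluded because it collects the fixed points. -/
theorem groupSupport_component (h : IsComponentColoring G orb κ m) {c : ℕ} (hc : c ≠ 0) :
    groupSupport (G.component orb κ c).Aut = {x | κ x = c} := by
  ext x
  constructor
  · rintro ⟨σ, hσ, hx⟩
    by_contra h1
    exact hx (apply_eq_of_mem hσ h1)
  · intro hx
    have hx : κ x = c := hx
    obtain ⟨u, hu, hux⟩ := (h.ne_zero_iff x).1 (by rwa [hx])
    obtain ⟨σ, hσ, h1⟩ := h.exists_of_orb_eq hux
    obtain ⟨ρ, hρ, h2⟩ := h.exists_restriction hσ c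
    exact ⟨ρ, hρ, by rwa [h2, if_pos hx, h1]⟩

theorem aut_le_iSup (h : IsComponentColoring G orb κ m) :
    G.Aut ≤ ⨆ i : Fin m, (G.component orb κ (i + 1)).Aut := by
  intro σ hσ
  -- σ is assembled component by component: ρ agrees with σ up to number k, and multiplying by the
  -- restriction of σ to component k + 1 extends the agreement. For k = 0 the identity works, as σ
  -- fixes the points with number 0.
  have key : ∀ k ≤ m, ∃ ρ ∈ ⨆ i : Fin m, (G.component orb κ (i + 1)).Aut,
      ∀ x, ρ x = if κ x ≤ k then σ x else x := by
    intro k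
    induction k with
    | zero =>
      refine fun _ => ⟨1, one_mem _, fun x => ?_⟩
      split_ifs with hx
      · by_contra h1
        exact (h.ne_zero_iff x).2 ⟨σ x, fun h2 => h1 h2.symm, h.orb_apply hσ x⟩ (by omega)
      · rfl
    | succ k ih =>
      intro hk
      obtain ⟨ρ, hρ, h1⟩ := ih (by omega)
      obtain ⟨τ, hτ, h2⟩ := h.exists_restriction hσ (k + 1)
      have hk' : (G.component orb κ (k + 1)).Aut ≤
          ⨆ i : Fin m, (G.component orb κ (i + 1)).Aut :=
        le_iSup (fun i : Fin m => (G.component orb κ (i + 1)).Aut) ⟨k, hk⟩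
      refine ⟨ρ * τ, mul_mem hρ (hk' hτ), fun x => ?_⟩
      rw [Perm.mul_apply, h2]
      by_cases hx : κ x = k + 1
      · rw [if_pos hx, h1, if_neg (by rw [h.apply hσ]; omega), if_pos hx.le]
      · rw [if_neg hx, h1]
        simp only [show κ x ≤ k + 1 ↔ κ x ≤ k by omega]
  obtain ⟨ρ, hρ, h1⟩ := key m le_rfl
  have h2 : ρ = σ := by
    ext x
    rw [h1, if_pos (h.le x)]
  rwa [← h2]

theorem isDisjointDirectDecomposition (h : IsComponentColoring G orb κ m) :
    IsDisjointDirectDecomposition G.Aut fun i : Fin m => (G.component orb κ (i + 1)).Aut := by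
  have hne : ∀ {i j : Fin m}, i ≠ j → ((i : ℕ) + 1 ≠ j + 1) := by
    intro i j hij h1
    exact hij (Fin.ext (by omega))
  refine ⟨?_, ?_, le_antisymm (iSup_le fun i => h.aut_component_le _) h.aut_le_iSup, ?_⟩
  · intro i j hij σ hσ τ hτ
    refine Perm.Disjoint.commute fun x => ?_
    by_cases hx : κ x = i + 1
    · exact .inr (apply_eq_of_mem hτ (by rw [hx]; exact hne hij))
    · exact .inl (apply_eq_of_mem hσ hx)
  · intro i
    -- The other factors together fix component i + 1 pointwise, while factor i fixes everything
    -- else.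
    have h1 : ⨆ j, ⨆ (_ : j ≠ i), (G.component orb κ (j + 1)).Aut ≤
        fixingSubgroup (Perm (Fin n)) {x | κ x = i + 1} := by
      refine iSup₂_le fun j hj σ hσ => ?_
      rw [mem_fixingSubgroup_iff]
      intro x hx
      have hx : κ x = i + 1 := hx
      exact apply_eq_of_mem hσ (by rw [hx]; exact hne hj.symm)
    rw [Subgroup.disjoint_def]
    intro σ hσ hσ'
    have h2 := (mem_fixingSubgroup_iff _).1 (h1 hσ')
    ext x
    by_cases hx : κ x = i + 1
    · rw [Perm.one_apply]
      exact congrArg Fin.val (h2 x hx)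
    · rw [apply_eq_of_mem hσ hx, Perm.one_apply]
  · intro i j hij
    simp only [h.groupSupport_component (Nat.succ_ne_zero _), Set.disjoint_left]
    intro x hx hx'
    exact hne hij (Eq.trans (Eq.symm hx) hx')

end IsComponentColoring

/-! ### Disjoint direct decompositions and orbits -/

theorem apply_mem_groupSupport {Ω : Type} {Γ : Subgroup (Perm Ω)} {σ : Perm Ω} (hσ : σ ∈ Γ) {x : Ω}
    (hx : x ∈ groupSupport Γ) : σ x ∈ groupSupport Γ := by
  obtain ⟨τ, hτ, h⟩ := hx
  refine ⟨σ * τ * σ⁻¹, mul_mem (mul_mem hσ hτ) (inv_mem hσ), ?_⟩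
  simpa using h

theorem apply_eq_of_notMem_groupSupport {Ω : Type} {Γ : Subgroup (Perm Ω)} {σ : Perm Ω}
    (hσ : σ ∈ Γ) {x : Ω} (hx : x ∉ groupSupport Γ) : σ x = x := by
  by_contra h
  exact hx ⟨σ, hσ, h⟩

/-- On the support of a factor, every element of the group agrees with an element of the factor. -/
theorem IsDisjointDirectDecomposition.exists_agree {Ω ι : Type} {Γ : Subgroup (Perm Ω)}
    {K : ι → Subgroup (Perm Ω)} (hK : IsDisjointDirectDecomposition Γ K) (j : ι) {σ : Perm Ω}
    (hσ : σ ∈ Γ) : ∃ k ∈ K j, ∀ x ∈ groupSupport (K j), σ x = k x := by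
  rw [← hK.iSup_eq] at hσ
  refine Subgroup.iSup_induction K
    (C := fun σ => ∃ k ∈ K j, ∀ x ∈ groupSupport (K j), σ x = k x) hσ ?_ ?_ ?_
  · intro i σ hσ
    by_cases hij : i = j
    · subst hij
      exact ⟨σ, hσ, fun _ _ => rfl⟩
    · refine ⟨1, one_mem _, fun x hx => ?_⟩
      rw [apply_eq_of_notMem_groupSupport hσ
        (Set.disjoint_right.1 (hK.disjoint_supports i j hij) hx), Perm.one_apply]
  · exact ⟨1, one_mem _, fun _ _ => rfl⟩
  · rintro σ τ ⟨k, hk, h1⟩ ⟨k', hk', h2⟩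
    refine ⟨k * k', mul_mem hk hk', fun x hx => ?_⟩
    rw [Perm.mul_apply, Perm.mul_apply, h2 x hx, h1 _ (apply_mem_groupSupport hk' hx)]

/-- A group with disjoint factors acts transitively on products of orbits in different factors. -/
theorem IsDisjointDirectDecomposition.exists_apply_eq {Ω ι : Type} {Γ : Subgroup (Perm Ω)}
    {K : ι → Subgroup (Perm Ω)} (hK : IsDisjointDirectDecomposition Γ K) {i j : ι} (hij : i ≠ j)
    {x y : Ω} (hx : x ∈ groupSupport (K i)) (hy : y ∈ groupSupport (K j)) {σ τ : Perm Ω}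
    (hσ : σ ∈ Γ) (hτ : τ ∈ Γ) : ∃ ρ ∈ Γ, ρ x = σ x ∧ ρ y = τ y := by
  obtain ⟨k, hk, h1⟩ := hK.exists_agree i hσ
  obtain ⟨k', hk', h2⟩ := hK.exists_agree j hτ
  have hd := hK.disjoint_supports i j hij
  have hle : ∀ i, K i ≤ Γ := fun i => by
    rw [← hK.iSup_eq]
    exact le_iSup K i
  refine ⟨k * k', mul_mem (hle i hk) (hle j hk'), ?_, ?_⟩
  · rw [Perm.mul_apply, apply_eq_of_notMem_groupSupport hk' (Set.disjoint_left.1 hd hx), h1 x hx]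
  · rw [Perm.mul_apply, h2 y hy, apply_eq_of_notMem_groupSupport hk
      (Set.disjoint_right.1 hd (apply_mem_groupSupport hk' hy))]

theorem IsDisjointDirectDecomposition.exists_mem_groupSupport {Ω ι : Type} {Γ : Subgroup (Perm Ω)}
    {K : ι → Subgroup (Perm Ω)} (hK : IsDisjointDirectDecomposition Γ K) {x : Ω}
    (hx : x ∈ groupSupport Γ) : ∃ j, x ∈ groupSupport (K j) := by
  by_contra! h
  obtain ⟨σ, hσ, h1⟩ := hx
  have h2 : Γ ≤ fixingSubgroup (Perm Ω) {x} := by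
    rw [← hK.iSup_eq]
    refine iSup_le fun j τ hτ => ?_
    rw [mem_fixingSubgroup_iff]
    rintro _ rfl
    exact apply_eq_of_notMem_groupSupport hτ (h j)
  exact h1 ((mem_fixingSubgroup_iff _).1 (h2 hσ) x rfl)

theorem eq_bot_of_groupSupport {Ω : Type} {Γ : Subgroup (Perm Ω)}
    (h : ∀ x, x ∉ groupSupport Γ) : Γ = ⊥ := by
  rw [Subgroup.eq_bot_iff_forall]
  intro σ hσ
  ext x
  exact apply_eq_of_notMem_groupSupport hσ (h x)

namespace IsComponentColoring

variable {n m : ℕ} {G : ColoredGraph (Fin n)} {orb : Fin n → Fin n} {κ : Fin n → ℕ}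

/-- Non-homogeneous orbits of the component must lie in the support of the same part. By
connectedness a non-trivial part then supports the whole component, and the other parts have empty
support. -/
theorem isDisjointlyIndecomposable (h : IsComponentColoring G orb κ m) {c : ℕ} (hc : c ≠ 0) :
    IsDisjointlyIndecomposable (G.component orb κ c).Aut := by
  intro r K hK j
  by_cases hj : K j = ⊥
  · exact .inl hj
  right
  have hsupp := h.groupSupport_component hc
  have hle : ∀ i, K i ≤ (G.component orb κ c).Aut := fun i => by
    rw [← hK.iSup_eq]
    exact le_iSup K i
  have hsub : ∀ i, ∀ x ∈ groupSupport (K i), κ x = c := by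
    rintro i x ⟨σ, hσ, h1⟩
    by_contra h2
    exact h1 (apply_eq_of_mem (hle i hσ) h2)
  -- Membership in the support of a factor only depends on the orbit.
  have horb : ∀ i x y, orb x = orb y → x ∈ groupSupport (K i) → y ∈ groupSupport (K i) := by
    intro i x y hxy hx
    obtain ⟨σ, hσ, rfl⟩ := h.exists_of_orb_eq hxy.symm
    obtain ⟨ρ, hρ, h1⟩ := h.exists_restriction hσ c
    obtain ⟨k, hk, h2⟩ := hK.exists_agree i hρ
    have h3 := h1 x
    rw [if_pos (hsub i x hx), h2 x hx] at h3
    rw [← h3]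
    exact apply_mem_groupSupport hk hx
  have hmem : ∀ y, κ y = c → ∃ i, y ∈ groupSupport (K i) := by
    intro y hy
    refine hK.exists_mem_groupSupport ?_
    rw [hsupp]
    exact hy
  -- If the parts were different, their independent action would give an automorphism fixing x and
  -- sending y to y', thus mapping an edge to a non-edge.
  have hstep : ∀ o o', NonHomogeneous G orb o o' → ∀ i i' x y, orb x = o → orb y = o' →
      x ∈ groupSupport (K i) → y ∈ groupSupport (K i') → i = i' := by
    rintro _ _ ⟨x, y, y', rfl, rfl, hyy', he, hne⟩ i i' a b ha hb hx hy
    replace hx := horb i a x ha hx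
    replace hy := horb i' b y hb hy
    by_contra hii'
    obtain ⟨τ, hτ, h1⟩ := h.exists_of_orb_eq hyy'
    obtain ⟨τ', hτ', h2⟩ := h.exists_restriction hτ c
    obtain ⟨ρ, hρ, h3, h4⟩ := hK.exists_apply_eq hii' hx hy (one_mem _) hτ'
    rw [h2, if_pos (hsub i' y hy), h1] at h4
    have h5 := ((h.aut_component_le c hρ).2.1 x y).2 he
    rw [h3, h4] at h5
    exact hne h5
  set p : Fin n → Prop := fun o => ∃ x, orb x = o ∧ x ∈ groupSupport (K j) with hp
  have hpstep : ∀ o o', NonHomogeneous G orb o o' → (p o ↔ p o') := by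
    intro o o' hoo'
    obtain ⟨x, y, y', rfl, rfl, -, -, -⟩ := id hoo'
    have hxy := h.of_nonHomogeneous x y hoo'
    constructor
    · rintro ⟨a, ha, haj⟩
      have hx := horb j a x ha haj
      obtain ⟨i, hy⟩ := hmem y (by rw [← hxy]; exact hsub j x hx)
      obtain rfl := hstep _ _ hoo' j i x y rfl rfl hx hy
      exact ⟨y, rfl, hy⟩
    · rintro ⟨a, ha, haj⟩
      have hy := horb j a y ha haj
      obtain ⟨i, hx⟩ := hmem x (by rw [hxy]; exact hsub j y hy)
      obtain rfl := hstep _ _ hoo' i j x y rfl rfl hx hy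
      exact ⟨x, rfl, hx⟩
  have hpconn : ∀ o o', Relation.EqvGen (NonHomogeneous G orb) o o' → (p o ↔ p o') := by
    intro o o' hoo'
    induction hoo' with
    | rel _ _ h => exact hpstep _ _ h
    | refl => rfl
    | symm _ _ _ ih => exact ih.symm
    | trans _ _ _ _ _ ih ih' => exact ih.trans ih'
  obtain ⟨x, hx⟩ : ∃ x, x ∈ groupSupport (K j) := by
    by_contra! h1
    exact hj (eq_bot_of_groupSupport h1)
  have hall : ∀ y, κ y = c → y ∈ groupSupport (K j) := by
    intro y hy
    have hxc := hsub j x hx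
    obtain ⟨a, ha, haj⟩ := (hpconn _ _ (h.connected x y (by rwa [hxc]) (by rw [hy, hxc]))).1
      ⟨x, rfl, hx⟩
    exact horb j a y ha haj
  refine le_antisymm (hle j) ?_
  rw [← hK.iSup_eq]
  refine iSup_le fun i => ?_
  by_cases hij : i = j
  · rw [hij]
  · rw [eq_bot_of_groupSupport (Γ := K i)]
    · exact bot_le
    · intro y hy
      exact Set.disjoint_left.1 (hK.disjoint_supports i j hij) hy (hall y (hsub i y hy))

theorem isFinestDecomposition (h : IsComponentColoring G orb κ m) :
    IsFinestDecomposition G.Aut fun i : Fin m => (G.component orb κ (i + 1)).Aut := by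
  refine ⟨h.isDisjointDirectDecomposition, fun i => ?_,
    fun i => h.isDisjointlyIndecomposable (Nat.succ_ne_zero _)⟩
  obtain ⟨v, hv⟩ := h.attained (i + 1) (by omega) (by omega)
  intro hbot
  have h1 : v ∈ groupSupport (G.component orb κ (i + 1)).Aut := by
    rw [h.groupSupport_component (Nat.succ_ne_zero _)]
    exact hv
  obtain ⟨σ, hσ, h2⟩ := h1
  rw [hbot, Subgroup.mem_bot] at hσ
  rw [hσ] at h2
  exact h2 rfl

/-- A set of automorphisms of a component generates the automorphism group of the component if it
contains the restrictions of generators of the automorphism group of the graph. -/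
theorem closure_eq (h : IsComponentColoring G orb κ m) {c : ℕ} {S T : Set (Perm (Fin n))}
    (hS : Subgroup.closure S = G.Aut) (hT : ∀ ρ ∈ T, ρ ∈ (G.component orb κ c).Aut)
    (hres : ∀ σ ∈ S, ∃ ρ ∈ Subgroup.closure T, ∀ x, ρ x = if κ x = c then σ x else x) :
    Subgroup.closure T = (G.component orb κ c).Aut := by
  refine le_antisymm ((Subgroup.closure_le _).2 hT) fun τ hτ => ?_
  -- Restriction to the component is multiplicative, since automorphisms preserve κ; so it suffices
  -- to control it on generators.
  have key : ∀ σ ∈ Subgroup.closure S,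
      ∃ ρ ∈ Subgroup.closure T, ∀ x, ρ x = if κ x = c then σ x else x := by
    intro σ hσ
    induction hσ using Subgroup.closure_induction with
    | mem σ hσ => exact hres σ hσ
    | one => exact ⟨1, one_mem _, fun x => by simp⟩
    | mul σ σ' hσ hσ' ih ih' =>
      obtain ⟨ρ, hρ, h1⟩ := ih
      obtain ⟨ρ', hρ', h2⟩ := ih'
      rw [hS] at hσ'
      refine ⟨ρ * ρ', mul_mem hρ hρ', fun x => ?_⟩
      rw [Perm.mul_apply, h2]
      by_cases hx : κ x = c
      · rw [if_pos hx, if_pos hx, h1, if_pos (by rwa [h.apply hσ']), Perm.mul_apply]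
      · rw [if_neg hx, if_neg hx, h1, if_neg hx]
    | inv σ hσ ih =>
      obtain ⟨ρ, hρ, h1⟩ := ih
      rw [hS] at hσ
      refine ⟨ρ⁻¹, inv_mem hρ, fun x => ?_⟩
      rw [Perm.inv_eq_iff_eq, h1]
      by_cases hx : κ x = c
      · rw [if_pos hx, if_pos (by rwa [h.apply (inv_mem hσ)])]
        simp
      · rw [if_neg hx, if_neg hx]
  obtain ⟨ρ, hρ, h1⟩ := key τ (by rw [hS]; exact h.aut_component_le c hτ)
  have h2 : ρ = τ := by
    ext x
    rw [h1]
    split_ifs with hx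
    · rfl
    · rw [apply_eq_of_mem hτ hx]
  rwa [← h2]

end IsComponentColoring

/-! ### Permutations in cycle notation -/

theorem permOfCycles_cons {n : ℕ} (c : List (Fin n)) (cs : Cycles n) :
    permOfCycles (c :: cs) = c.formPerm * permOfCycles cs := by
  simp [permOfCycles]

theorem permOfCycles_apply_of_notMem {n : ℕ} {cs : Cycles n} {x : Fin n} (h : x ∉ cs.flatten) :
    permOfCycles cs x = x := by
  induction cs with
  | nil => rfl
  | cons c cs ih =>
    rw [List.flatten_cons, List.mem_append, not_or] at h
    rw [permOfCycles_cons, Perm.mul_apply, ih h.2, List.formPerm_apply_of_notMem h.1]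

theorem permOfCycles_apply_of_mem {n : ℕ} {cs : Cycles n} (h : cs.flatten.Nodup)
    {c : List (Fin n)} (hc : c ∈ cs) {x : Fin n} (hx : x ∈ c) :
    permOfCycles cs x = c.formPerm x := by
  induction cs with
  | nil => simp at hc
  | cons c' cs ih =>
    rw [List.flatten_cons, List.nodup_append'] at h
    obtain ⟨h1, h2, h3⟩ := h
    rw [permOfCycles_cons, Perm.mul_apply]
    rw [List.mem_cons] at hc
    rcases hc with rfl | hc
    · rw [permOfCycles_apply_of_notMem (h3 hx)]
    · rw [ih h2 hc]
      refine List.formPerm_apply_of_notMem fun h4 => h3 h4 ?_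
      exact List.mem_flatten.2 ⟨c, hc, List.formPerm_apply_mem_of_mem hx⟩

theorem IsCycleNotation.nodup_of_mem {n : ℕ} {cs : Cycles n} (h : IsCycleNotation cs)
    {c : List (Fin n)} (hc : c ∈ cs) : c.Nodup :=
  (List.nodup_flatten.1 h.2).1 c hc

theorem IsCycleNotation.apply_ne_iff {n : ℕ} {cs : Cycles n} (h : IsCycleNotation cs)
    (x : Fin n) : permOfCycles cs x ≠ x ↔ x ∈ cs.flatten := by
  constructor
  · intro hx
    by_contra h1
    exact hx (permOfCycles_apply_of_notMem h1)
  · intro hx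
    obtain ⟨c, hc, hxc⟩ := List.mem_flatten.1 hx
    rw [permOfCycles_apply_of_mem h.2 hc hxc]
    exact (List.formPerm_apply_mem_ne_self_iff _ (h.nodup_of_mem hc) x hxc).2 (h.1 c hc)

theorem IsCycleNotation.card_support {n : ℕ} {cs : Cycles n} (h : IsCycleNotation cs) :
    (permOfCycles cs).support.card = cs.flatten.length := by
  rw [← List.toFinset_card_of_nodup h.2]
  congr 1
  ext x
  rw [Perm.mem_support, h.apply_ne_iff, List.mem_toFinset]

theorem IsCycleNotation.ne_one {n : ℕ} {cs : Cycles n} (h : IsCycleNotation cs) (hne : cs ≠ []) :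
    ∃ x, permOfCycles cs x ≠ x := by
  obtain ⟨c, hc⟩ := List.exists_mem_of_ne_nil cs hne
  have h1 := h.1 c hc
  obtain ⟨x, hx⟩ := List.exists_mem_of_length_pos (show 0 < c.length by omega)
  exact ⟨x, (h.apply_ne_iff x).2 (List.mem_flatten.2 ⟨c, hc, hx⟩)⟩

theorem IsCycleNotation.filter {n : ℕ} {cs : Cycles n} (h : IsCycleNotation cs)
    (p : List (Fin n) → Bool) : IsCycleNotation (cs.filter p) :=
  ⟨fun c hc => h.1 c (List.mem_filter.1 hc).1, h.2.sublist List.filter_sublist.flatten⟩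

/-- All points of a cycle are images of its head under powers of the cycle, and one step does not
change κ. So the head alone determines the component. -/
theorem IsCycleNotation.cycleKey_eq {n : ℕ} {cs : Cycles n} (h : IsCycleNotation cs)
    {κ : Fin n → ℕ} (hκ : ∀ x, κ (permOfCycles cs x) = κ x) {c : List (Fin n)} (hc : c ∈ cs)
    {x : Fin n} (hx : x ∈ c) : RAM.cycleKey κ c = κ x := by
  have hnd := h.nodup_of_mem hc
  have h1 : ∀ y, κ (c.formPerm y) = κ y := by
    intro y
    by_cases hy : y ∈ c
    · rw [← permOfCycles_apply_of_mem h.2 hc hy, hκ]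
    · rw [List.formPerm_apply_of_notMem hy]
  have h2 : ∀ (k : ℤ) y, κ ((c.formPerm ^ k) y) = κ y := by
    intro k
    induction k with
    | zero => simp
    | succ k ih =>
      intro y
      rw [zpow_add_one, Perm.mul_apply, ih, h1]
    | pred k ih =>
      intro y
      rw [zpow_sub_one, Perm.mul_apply, ih, ← h1]
      simp
  cases c with
  | nil => simp at hx
  | cons a c =>
    obtain ⟨k, hk⟩ := (hnd.isCycleOn_formPerm).2 (show a ∈ {b | b ∈ a :: c} by simp) hx
    rw [← hk, h2]
    rfl

/-- Omitting the cycles outside a component restricts the permutation to the component. -/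
theorem IsCycleNotation.filter_apply {n : ℕ} {cs : Cycles n} (h : IsCycleNotation cs)
    {κ : Fin n → ℕ} (hκ : ∀ x, κ (permOfCycles cs x) = κ x) (c : ℕ) (x : Fin n) :
    permOfCycles (cs.filter (RAM.cycleKey κ · = c)) x =
      if κ x = c then permOfCycles cs x else x := by
  have h' := h.filter (RAM.cycleKey κ · = c)
  by_cases hx : x ∈ cs.flatten
  · obtain ⟨a, ha, hxa⟩ := List.mem_flatten.1 hx
    have hkey := h.cycleKey_eq hκ ha hxa
    split_ifs with hc
    · have ha' : a ∈ cs.filter (RAM.cycleKey κ · = c) :=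
        List.mem_filter.2 ⟨ha, by simp [hkey, hc]⟩
      rw [permOfCycles_apply_of_mem h'.2 ha' hxa, permOfCycles_apply_of_mem h.2 ha hxa]
    · refine permOfCycles_apply_of_notMem fun h1 => ?_
      obtain ⟨b, hb, hxb⟩ := List.mem_flatten.1 h1
      obtain ⟨hb1, hb2⟩ := List.mem_filter.1 hb
      rw [h.cycleKey_eq hκ hb1 hxb] at hb2
      exact hc (by simpa using hb2)
  · rw [permOfCycles_apply_of_notMem hx, ite_self]
    refine permOfCycles_apply_of_notMem fun h1 => hx ?_
    exact List.filter_sublist.flatten.subset h1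

/-! ### Sizes -/

/-- Only the identity contributes nothing to the encoding size. -/
theorem card_le_encSize {n : ℕ} (S : Finset (Perm (Fin n))) : S.card ≤ encSize S + 1 := by
  have h1 : (S.erase 1).card ≤ encSize S := by
    calc (S.erase 1).card = ∑ σ ∈ S.erase 1, 1 := by simp
      _ ≤ ∑ σ ∈ S.erase 1, σ.support.card := by
        refine Finset.sum_le_sum fun σ hσ => ?_
        rw [Nat.one_le_iff_ne_zero, Finset.card_ne_zero, Finset.nonempty_iff_ne_empty, Ne,
          Perm.support_eq_empty_iff]
        exact (Finset.mem_erase.1 hσ).1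
      _ ≤ encSize S := Finset.sum_le_sum_of_subset (Finset.erase_subset _ _)
  have h2 := Finset.pred_card_le_card_erase (s := S) (a := 1)
  omega

/-- A cycle of length ℓ ≥ 2 takes ℓ + 1 ≤ 2ℓ cells and each generator one more. Without repetitions
there are at most `encSize S + 1` generators. -/
theorem length_encPerms_le {n : ℕ} {gens : List (Cycles n)} {S : Finset (Perm (Fin n))}
    (h : ListsPerms gens S) (hnd : (gens.map permOfCycles).Nodup) :
    (encPerms gens).length ≤ 3 * encSize S + 2 := by
  have hS : S = (gens.map permOfCycles).toFinset := by
    ext σ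
    rw [h.2, List.mem_toFinset, List.mem_map]
  have h1 : gens.length ≤ encSize S + 1 := by
    refine le_trans ?_ (card_le_encSize S)
    rw [hS, List.toFinset_card_of_nodup hnd, List.length_map]
  have h2 : encSize S = (gens.map fun cs => cs.flatten.length).sum := by
    rw [encSize, hS, List.sum_toFinset _ hnd, List.map_map]
    congr 1
    refine List.map_congr_left fun cs hcs => ?_
    exact (h.1 cs hcs).card_support
  have h3 : ∀ cs ∈ gens, (encList (encList encVertex) cs).length ≤ 1 + 2 * cs.flatten.length := by
    intro cs hcs
    have h4 := (h.1 cs hcs).1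
    rw [encList, List.length_cons, List.length_flatMap, List.length_flatten,
      ← List.sum_map_mul_left, Nat.add_comm]
    refine Nat.add_le_add_left (List.sum_le_sum fun c hc => ?_) 1
    have := h4 c hc
    rw [RAM.length_encList_encVertex]
    omega
  have h5 : (gens.flatMap (encList (encList encVertex))).length ≤
      gens.length + 2 * (gens.map fun cs => cs.flatten.length).sum := by
    rw [List.length_flatMap]
    refine (List.sum_le_sum h3).trans ?_
    rw [List.sum_map_add, List.sum_map_mul_left]
    simp
  have h6 : (encPerms gens).length =
      (gens.flatMap (encList (encList encVertex))).length + 1 := by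
    rw [encPerms, encList, List.length_cons]
  omega

/-- Each edge comes from at most two ordered pairs, and a loop from only one. -/
theorem sum_degrees_le {n : ℕ} {E : Finset (Sym2 (Fin n))} {nb : Fin n → List (Fin n)}
    (hnd : ∀ v, (nb v).Nodup) (hnb : ∀ v u, u ∈ nb v ↔ s(v, u) ∈ E) :
    ∑ v, (nb v).length ≤ 2 * E.card := by
  have h1 : ∑ v, (nb v).length = (Finset.univ.sigma fun v => (nb v).toFinset).card := by
    rw [Finset.card_sigma]
    exact Finset.sum_congr rfl fun v _ => (List.toFinset_card_of_nodup (hnd v)).symm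
  rw [h1]
  refine Finset.card_le_mul_card_image_of_maps_to (f := fun p => s(p.1, p.2)) ?_ 2 ?_
  · rintro ⟨v, u⟩ hp
    simpa [hnb] using hp
  · intro e _
    induction e using Sym2.ind with
    | _ a b =>
      have h2 : ({p ∈ Finset.univ.sigma fun v => (nb v).toFinset | s(p.1, p.2) = s(a, b)}) ⊆
          {⟨a, b⟩, ⟨b, a⟩} := by
        rintro ⟨v, u⟩ hp
        have h3 := (Finset.mem_filter.1 hp).2
        rw [Sym2.eq_iff] at h3
        rcases h3 with ⟨rfl, rfl⟩ | ⟨rfl, rfl⟩ <;> simp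
      exact (Finset.card_le_card h2).trans Finset.card_le_two

theorem length_encRows_le {n : ℕ} {rows : List (Row n)} {nb : Fin n → List (Fin n)}
    (hnd : (rows.map Prod.fst).Nodup) (hnb : ∀ r ∈ rows, r.2.2 = nb r.1) :
    (encList encRow rows).length ≤ ∑ v, (nb v).length + 3 * n + 1 := by
  have h1 := RAM.sum_map_le_sum_of_nodup hnd fun v => (nb v).length + 3
  rw [List.map_map, Finset.sum_add_distrib] at h1
  have h2 : (rows.flatMap encRow).length =
      (rows.map ((fun v => (nb v).length + 3) ∘ Prod.fst)).sum := by
    rw [List.length_flatMap]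
    congr 1
    refine List.map_congr_left fun r hr => ?_
    simp [encRow, hnb r hr]
  rw [encList, List.length_cons, h2]
  simp at h1
  omega

/-! ### Reading the component coloring off the input -/

theorem count_map_of_nodup {α β : Type} [DecidableEq α] [DecidableEq β] {l : List α} (h : l.Nodup)
    (f : α → β) (b : β) : (l.map f).count b = (l.toFinset.filter (f · = b)).card := by
  have h1 : l.toFinset.filter (f · = b) = (l.filter (f · = b)).toFinset := by
    ext
    simp
  rw [h1, List.toFinset_card_of_nodup (h.filter _), List.count_eq_countP,
    List.countP_map, List.countP_eq_length_filter]
  congr 1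

theorem orbitSize_eq_card {n : ℕ} (orb : Fin n → Fin n) (o : Fin n) :
    RAM.orbitSize orb o = (Finset.univ.filter (orb · = o)).card := by
  rw [RAM.orbitSize, count_map_of_nodup (List.nodup_finRange n), List.toFinset_finRange]

theorem one_lt_orbitSize_iff {n : ℕ} {orb : Fin n → Fin n} {v : Fin n} :
    1 < RAM.orbitSize orb (orb v) ↔ ∃ u, u ≠ v ∧ orb u = orb v := by
  rw [orbitSize_eq_card, Finset.one_lt_card_iff]
  simp only [Finset.mem_filter, Finset.mem_univ, true_and]
  constructor
  · rintro ⟨a, b, ha, hb, hab⟩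
    by_cases hav : a = v
    · exact ⟨b, fun h => hab (hav.trans h.symm), hb⟩
    · exact ⟨a, hav, ha⟩
  · rintro ⟨u, hu, h⟩
    exact ⟨u, v, h, rfl, hu⟩

/-- Without repetitions the count is the size of a subset of the orbit, so it equals the orbit size
only if the whole orbit is contained in `l`. -/
theorem meetsProperly_iff {n : ℕ} {orb : Fin n → Fin n} {l : List (Fin n)} (h : l.Nodup)
    (o : Fin n) : RAM.MeetsProperly orb l o ↔
      (∃ y, orb y = o ∧ y ∈ l) ∧ ∃ y, orb y = o ∧ y ∉ l := by
  rw [RAM.MeetsProperly, orbitSize_eq_card, count_map_of_nodup h, Finset.card_ne_zero]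
  have hsub : l.toFinset.filter (orb · = o) ⊆ Finset.univ.filter (orb · = o) :=
    Finset.filter_subset_filter _ (Finset.subset_univ _)
  refine and_congr ?_ ?_
  · simp [Finset.Nonempty, and_comm]
  · constructor
    · intro h1
      by_contra! h2
      refine h1 (congrArg Finset.card (hsub.antisymm fun y hy => ?_))
      have hy := (Finset.mem_filter.1 hy).2
      exact Finset.mem_filter.2 ⟨List.mem_toFinset.2 (h2 y hy), hy⟩
    · rintro ⟨y, hy, hyl⟩ h1
      have h2 := Finset.eq_of_subset_of_card_le hsub h1.ge
      have h3 : y ∈ l.toFinset.filter (orb · = o) := by rw [h2]; simpa using hy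
      exact hyl (List.mem_toFinset.1 (Finset.mem_filter.1 h3).1)

theorem IsOrbitColoring.exists_apply_eq {n : ℕ} {G : ColoredGraph (Fin n)} {orb : Fin n → Fin n}
    (h : IsOrbitColoring G.Aut orb) {x y : Fin n} (hxy : orb x = orb y) :
    ∃ σ ∈ G.Aut, σ y = x ∧ ∀ z, orb (σ z) = orb z := by
  obtain ⟨⟨σ, hσ⟩, h1⟩ := (h _ _).1 hxy
  exact ⟨σ, hσ, h1, fun z => (h _ _).2 ⟨⟨σ, hσ⟩, rfl⟩⟩

/-- Let x ~ y and x ≁ y', and let σ send y to y'. Then y' is adjacent to σ x but not to x. -/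
theorem NonHomogeneous.symm {n : ℕ} {G : ColoredGraph (Fin n)} {orb : Fin n → Fin n}
    (h : IsOrbitColoring G.Aut orb) {o o' : Fin n} (ho : NonHomogeneous G orb o o') :
    NonHomogeneous G orb o' o := by
  obtain ⟨x, y, y', rfl, rfl, hy, he, hne⟩ := ho
  obtain ⟨σ, hσ, rfl, h1⟩ := h.exists_apply_eq hy
  refine ⟨σ y, σ x, x, hy, h1 x, rfl, ?_, ?_⟩
  · rw [Sym2.eq_swap]
    exact (hσ.2.1 x y).2 he
  · rwa [Sym2.eq_swap]

theorem NonHomogeneous.mem_nontrivialOrbits {n : ℕ} {G : ColoredGraph (Fin n)}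
    {orb : Fin n → Fin n} {o o' : Fin n} (ho : NonHomogeneous G orb o o') :
    o' ∈ RAM.nontrivialOrbits orb := by
  obtain ⟨x, y, y', rfl, rfl, hy, he, hne⟩ := ho
  refine ⟨⟨y, rfl⟩, one_lt_orbitSize_iff.2 ⟨y', ?_, hy⟩⟩
  rintro rfl
  exact hne he

section

variable {n : ℕ} {G : ColoredGraph (Fin n)} {orb : Fin n → Fin n} {nb : Fin n → List (Fin n)}

/-- By transitivity any witness can be moved to the given vertex x, and the target orbit is
preserved. So one representative suffices for the whole orbit, which is the source of the linear
running time. -/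
theorem meetsProperly_iff_nonHomogeneous (horb : IsOrbitColoring G.Aut orb)
    (hnd : ∀ v, (nb v).Nodup) (hnb : ∀ v u, u ∈ nb v ↔ s(v, u) ∈ G.E) (x o : Fin n) :
    RAM.MeetsProperly orb (nb x) o ↔ NonHomogeneous G orb (orb x) o := by
  rw [meetsProperly_iff (hnd x)]
  constructor
  · rintro ⟨⟨y, hy, h1⟩, y', hy', h2⟩
    exact ⟨x, y, y', rfl, hy, hy', (hnb _ _).1 h1, fun h3 => h2 ((hnb _ _).2 h3)⟩
  · rintro ⟨z, y, y', hz, hy, hy', h1, h2⟩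
    obtain ⟨σ, hσ, rfl, h3⟩ := horb.exists_apply_eq hz.symm
    refine ⟨⟨σ y, (h3 y).trans hy, (hnb _ _).2 ((hσ.2.1 _ _).2 h1)⟩, σ y', (h3 y').trans hy', ?_⟩
    rw [hnb]
    exact fun h4 => h2 ((hσ.2.1 _ _).1 h4)

theorem meetsProperly_symm (horb : IsOrbitColoring G.Aut orb)
    (hnd : ∀ v, (nb v).Nodup) (hnb : ∀ v u, u ∈ nb v ↔ s(v, u) ∈ G.E) (rep : Fin n → Fin n)
    (hrep : ∀ v, orb (rep (orb v)) = orb v) (x : Fin n) (hx : x ∈ RAM.nontrivialOrbits orb)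
    (y : Fin n) (hxy : RAM.MeetsProperly orb (nb (rep x)) y) :
    RAM.MeetsProperly orb (nb (rep y)) x ∧ y ∈ RAM.nontrivialOrbits orb := by
  rw [meetsProperly_iff_nonHomogeneous horb hnd hnb] at hxy ⊢
  obtain ⟨v, rfl⟩ := hx.1
  have hy := hxy.mem_nontrivialOrbits
  obtain ⟨u, rfl⟩ := hy.1
  rw [hrep] at hxy ⊢
  exact ⟨hxy.symm horb, hy⟩

theorem RAM.SearchInv.isComponentColoring (hV : G.V = Finset.univ)
    (horb : IsOrbitColoring G.Aut orb) (hnd : ∀ v, (nb v).Nodup)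
    (hnb : ∀ v u, u ∈ nb v ↔ s(v, u) ∈ G.E) {rep comp : Fin n → _} {m : ℕ} {P : List (Fin n)}
    (hrep : ∀ v, orb (rep (orb v)) = orb v)
    (h : RAM.SearchInv (RAM.nontrivialOrbits orb)
      (fun x y => RAM.MeetsProperly orb (nb (rep x)) y) comp m P [])
    (hcomp : ∀ v, 1 < RAM.orbitSize orb (orb v) → comp (orb v) ≠ 0) :
    IsComponentColoring G orb (comp ∘ orb) m where
  mem_V v := by simp [hV]
  orbits := horb
  of_orb u v huv := congrArg comp huv
  ne_zero_iff v := by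
    rw [← one_lt_orbitSize_iff]
    exact ⟨fun h1 => (h.mem _ ((h.ne_zero_iff _).1 h1)).2, hcomp v⟩
  of_nonHomogeneous x y hxy := by
    have h1 : comp (orb x) ≠ 0 := hcomp x (hxy.symm horb).mem_nontrivialOrbits.2
    refine (h.closed (orb x) (by simpa using (h.ne_zero_iff _).1 h1) _ ?_).symm
    rwa [meetsProperly_iff_nonHomogeneous horb hnd hnb, hrep]
  connected x y hx hxy := by
    refine (h.connected _ _ hx hxy).mono ?_
    rintro _ o' ⟨⟨⟨v, rfl⟩, -⟩, h1⟩
    rwa [meetsProperly_iff_nonHomogeneous horb hnd hnb, hrep] at h1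
  le v := h.le _
  attained c h1 h2 := by
    obtain ⟨o, rfl⟩ := h.attained c h1 h2
    obtain ⟨v, rfl⟩ := (h.mem o ((h.ne_zero_iff o).1 (by omega))).1
    exact ⟨v, rfl⟩

theorem IsAdjacencyLists.exists_neighbors {rows : List (Row n)} (h : IsAdjacencyLists rows G)
    (hV : G.V = Finset.univ) : ∃ nb : Fin n → List (Fin n), (∀ r ∈ rows, r.2.2 = nb r.1) ∧
      (∀ v, (nb v).Nodup) ∧ ∀ v u, u ∈ nb v ↔ s(v, u) ∈ G.E := by
  obtain ⟨h1, h2, h3⟩ := h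
  have h4 : ∀ v, ∃ r ∈ rows, r.1 = v := fun v => by
    have := (h2 v).2 (by simp [hV])
    simpa using this
  choose f hf hfv using h4
  refine ⟨fun v => (f v).2.2, fun r hr => ?_, fun v => (h3 _ (hf v)).2.1, fun v u => ?_⟩
  · exact congrArg (fun r : Row n => r.2.2)
      (List.inj_on_of_nodup_map h1 hr (hf r.1) (hfv r.1).symm)
  · rw [(h3 _ (hf v)).2.2, hfv]

end

/-! ### The output -/

section

variable {n m : ℕ} {G : ColoredGraph (Fin n)} {orb : Fin n → Fin n} {κ : Fin n → ℕ}
  {nb : Fin n → List (Fin n)} {gens : List (Cycles n)} {S : Finset (Perm (Fin n))}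

theorem isAdjacencyLists_componentRows (hnd : ∀ v, (nb v).Nodup)
    (hnb : ∀ v u, u ∈ nb v ↔ s(v, u) ∈ G.E) (c : ℕ) :
    IsAdjacencyLists (RAM.componentRows nb orb κ c) (G.component orb κ c) := by
  have h1 : (RAM.componentRows nb orb κ c).map Prod.fst =
      (List.finRange n).filter (κ · = c) := by
    rw [RAM.componentRows, List.map_map]
    exact List.map_id _
  refine ⟨?_, fun v => ?_, fun r hr => ?_⟩
  · rw [h1]
    exact (List.nodup_finRange n).filter _
  · rw [h1]
    simp [ColoredGraph.component]
  · obtain ⟨v, hv, rfl⟩ := List.mem_map.1 hr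
    have hv : κ v = c := by simpa using hv
    exact ⟨rfl, (hnd v).filter _, fun u => by simp [ColoredGraph.component, hnb, hv]⟩

/-- The permutations denoted by a list of lists of cycles. -/
def permsOf (gens : List (Cycles n)) : Finset (Perm (Fin n)) := (gens.map permOfCycles).toFinset

theorem mem_permsOf {σ : Perm (Fin n)} : σ ∈ permsOf gens ↔ ∃ cs ∈ gens, permOfCycles cs = σ := by
  simp [permsOf]

theorem listsPerms_permsOf (h : ∀ cs ∈ gens, IsCycleNotation cs) :
    ListsPerms gens (permsOf gens) :=
  ⟨h, fun _ => mem_permsOf⟩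

theorem mem_componentGens {c : ℕ} {cs : Cycles n} : cs ∈ RAM.componentGens κ c gens ↔
    cs ≠ [] ∧ ∃ cs' ∈ gens, cs'.filter (RAM.cycleKey κ · = c) = cs := by
  simp [RAM.componentGens, and_comm]

theorem isCycleNotation_of_mem_componentGens (h : ListsPerms gens S) {c : ℕ} {cs : Cycles n}
    (hcs : cs ∈ RAM.componentGens κ c gens) : IsCycleNotation cs := by
  obtain ⟨-, cs', hcs', rfl⟩ := mem_componentGens.1 hcs
  exact (h.1 cs' hcs').filter _

theorem encodesOutput_outputWord (hnd : ∀ v, (nb v).Nodup)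
    (hnb : ∀ v u, u ∈ nb v ↔ s(v, u) ∈ G.E) (h : ListsPerms gens S) :
    EncodesOutput (RAM.outputWord nb orb κ gens m)
      (fun i : Fin m => G.component orb κ (i + 1))
      (fun i => permsOf (RAM.componentGens κ (i + 1) gens))
      (permsOf ((List.range m).flatMap fun c => RAM.componentGens κ (c + 1) gens)) := by
  refine ⟨fun i => RAM.componentWord nb orb κ gens (i + 1), _, fun i => ⟨_, _,
    isAdjacencyLists_componentRows hnd hnb _, listsPerms_permsOf fun cs hcs =>
      isCycleNotation_of_mem_componentGens h hcs, rfl⟩, listsPerms_permsOf fun cs hcs => ?_, ?_⟩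
  · obtain ⟨c, -, hcs⟩ := List.mem_flatMap.1 hcs
    exact isCycleNotation_of_mem_componentGens h hcs
  · rw [RAM.outputWord, encList, List.length_ofFn, List.ofFn_eq_map, List.flatMap_map,
      ← List.map_coe_finRange_eq_range, List.flatMap_map, List.flatMap_map]
    rfl

theorem IsComponentColoring.permOfCycles_mem (hκ : IsComponentColoring G orb κ m)
    (hS : IsJointPair G S) (h : ListsPerms gens S) {c : ℕ} {cs : Cycles n}
    (hcs : cs ∈ RAM.componentGens κ c gens) :
    permOfCycles cs ∈ (G.component orb κ c).Aut := by
  obtain ⟨-, cs', hcs', rfl⟩ := mem_componentGens.1 hcs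
  have h1 : permOfCycles cs' ∈ G.Aut := by
    rw [← hS]
    exact Subgroup.subset_closure ((h.2 _).2 ⟨cs', hcs', rfl⟩)
  obtain ⟨ρ, hρ, h2⟩ := hκ.exists_restriction h1 c
  convert hρ
  ext x
  rw [(h.1 cs' hcs').filter_apply (hκ.apply h1), h2]

theorem IsComponentColoring.isJointPair (hκ : IsComponentColoring G orb κ m)
    (hS : IsJointPair G S) (h : ListsPerms gens S) (c : ℕ) :
    IsJointPair (G.component orb κ c) (permsOf (RAM.componentGens κ c gens)) := by
  refine hκ.closure_eq hS (fun ρ hρ => ?_) fun σ hσ => ?_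
  · obtain ⟨cs, hcs, rfl⟩ := mem_permsOf.1 hρ
    exact hκ.permOfCycles_mem hS h hcs
  · obtain ⟨cs, hcs, rfl⟩ := (h.2 σ).1 hσ
    have h1 : permOfCycles cs ∈ G.Aut := by
      rw [← hS]
      exact Subgroup.subset_closure hσ
    refine ⟨permOfCycles (cs.filter (RAM.cycleKey κ · = c)), ?_,
      (h.1 cs hcs).filter_apply (hκ.apply h1) c⟩
    -- Restrictions with no cycles are omitted from the list; they are the identity.
    by_cases hne : cs.filter (RAM.cycleKey κ · = c) = []
    · rw [hne]
      exact one_mem _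
    · exact Subgroup.subset_closure
        (mem_permsOf.2 ⟨_, mem_componentGens.2 ⟨hne, cs, hcs, rfl⟩, rfl⟩)

theorem IsComponentColoring.closure_permsOf_flatMap (hκ : IsComponentColoring G orb κ m)
    (hS : IsJointPair G S) (h : ListsPerms gens S) :
    Subgroup.closure (permsOf ((List.range m).flatMap fun c =>
      RAM.componentGens κ (c + 1) gens) : Set (Perm (Fin n))) = G.Aut := by
  refine le_antisymm ((Subgroup.closure_le _).2 fun σ hσ => ?_) ?_
  · obtain ⟨cs, hcs, rfl⟩ := mem_permsOf.1 hσ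
    obtain ⟨c, -, hcs⟩ := List.mem_flatMap.1 hcs
    exact hκ.aut_component_le _ (hκ.permOfCycles_mem hS h hcs)
  · refine hκ.aut_le_iSup.trans (iSup_le fun i => ?_)
    rw [← hκ.isJointPair hS h]
    refine Subgroup.closure_mono fun σ hσ => ?_
    obtain ⟨cs, hcs, rfl⟩ := mem_permsOf.1 hσ
    exact mem_permsOf.2 ⟨cs, List.mem_flatMap.2 ⟨i, List.mem_range.2 i.2, hcs⟩, rfl⟩

/-- A listed permutation moves points of only one component, and it moves at least one because empty
restrictions were dropped; the identity would meet no factor. -/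
theorem IsComponentColoring.isSeparableSet (hκ : IsComponentColoring G orb κ m)
    (hS : IsJointPair G S) (h : ListsPerms gens S) :
    IsSeparableSet (permsOf ((List.range m).flatMap fun c => RAM.componentGens κ (c + 1) gens))
      fun i : Fin m => (G.component orb κ (i + 1)).Aut := by
  intro σ hσ
  obtain ⟨cs, hcs, rfl⟩ := mem_permsOf.1 hσ
  obtain ⟨c, hc, hcs⟩ := List.mem_flatMap.1 hcs
  have h1 := hκ.permOfCycles_mem hS h hcs
  have h2 : ∀ x, permOfCycles cs x ≠ x → κ x = c + 1 := fun x hx => by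
    by_contra h3
    exact hx (apply_eq_of_mem h1 h3)
  obtain ⟨x, hx⟩ := (isCycleNotation_of_mem_componentGens h hcs).ne_one (mem_componentGens.1 hcs).1
  refine ⟨⟨c, List.mem_range.1 hc⟩, ⟨x, hx, _, h1, hx⟩, ?_⟩
  rintro i ⟨y, hy, hyi⟩
  rw [hκ.groupSupport_component (Nat.succ_ne_zero _)] at hyi
  have h3 := (h2 y hy).symm.trans hyi
  exact Fin.ext (by simpa using h3.symm)

end

/-! ### The theorem. -/

theorem mainTheorem1 :
    ∃ (P : RAM.Program) (C : ℕ),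
      ∀ (n : ℕ) (G : ColoredGraph (Fin n)) (S : Finset (Equiv.Perm (Fin n)))
        (orb : Fin n → Fin n) (w : List ℕ),
        G.V = Finset.univ →
        IsJointPair G S →
        IsOrbitColoring (Subgroup.closure (S : Set (Equiv.Perm (Fin n)))) orb →
        EncodesInput w G S orb →
        ∃ (t : ℕ) (out : List ℕ),
          RAM.Outputs P w t out ∧
          t ≤ C * (G.V.card + G.E.card + encSize S + 1) ∧
          ∃ (m : ℕ) (H : Fin m → Subgroup (Equiv.Perm (Fin n)))
            (S' : Finset (Equiv.Perm (Fin n)))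
            (Gs : Fin m → ColoredGraph (Fin n))
            (Ss : Fin m → Finset (Equiv.Perm (Fin n))),
            EncodesOutput out Gs Ss S' ∧
            IsFinestDecomposition (Subgroup.closure (S : Set (Equiv.Perm (Fin n)))) H ∧
            Subgroup.closure (S' : Set (Equiv.Perm (Fin n))) =
              Subgroup.closure (S : Set (Equiv.Perm (Fin n))) ∧
            IsSeparableSet S' H ∧
            ∀ i, IsJointPair (Gs i) (Ss i) ∧
              Subgroup.closure (Ss i : Set (Equiv.Perm (Fin n))) = H i ∧
              ((Gs i).V : Set (Fin n)) = groupSupport (H i) := by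
  -- The run takes at most 100(D + n + r + p) steps, where the sum D of degrees is at most 2|E|, the
  -- rows have length r ≤ D + 3n + 1, and the permutations have length p ≤ 3 enc(S) + 2. The total
  -- is 100(4|E| + 4n + 3 enc(S) + 3), whence 400.
  refine ⟨RAM.decompose, 400, fun n G S orb w hV hS horb hw => ?_⟩
  obtain ⟨rows, gens, hrows, hgens, hgnd, hw⟩ := hw
  obtain ⟨nb, hnb, hnd, hE⟩ := hrows.exists_neighbors hV
  have hS' : Subgroup.closure (S : Set (Perm (Fin n))) = G.Aut := hS
  rw [hS'] at horb ⊢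
  obtain ⟨t, s', hexec, rep, comp, m, Q, hrep, hinv, hcomp, hout, ht⟩ :=
    RAM.wp_decompose hw hrows.1 (fun v => (hrows.2.1 v).2 (by simp [hV])) hnb
      (fun cs hcs c hc h0 => by simpa [h0] using (hgens.1 cs hcs).1 c hc)
      (meetsProperly_symm horb hnd hE)
  have hκ := hinv.isComponentColoring hV horb hnd hE hrep hcomp
  refine ⟨t, _, ⟨s', hexec, fun k hk => ?_⟩, ?_, m,
    fun i => (G.component orb (comp ∘ orb) (i + 1)).Aut, _, _, _,
    encodesOutput_outputWord hnd hE hgens, hκ.isFinestDecomposition,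
    hκ.closure_permsOf_flatMap hS hgens, hκ.isSeparableSet hS hgens, fun i =>
    ⟨hκ.isJointPair hS hgens _, hκ.isJointPair hS hgens _, ?_⟩⟩
  · have h1 := RAM.reads_iff.1 hout.1 k hk
    rwa [Nat.zero_add] at h1
  · have h1 := sum_degrees_le hnd hE
    have h2 := length_encPerms_le hgens hgnd
    have h3 := length_encRows_le hrows.1 hnb
    have h4 : G.V.card = n := by rw [hV, Finset.card_univ, Fintype.card_fin]
    omega
  · rw [hκ.groupSupport_component (Nat.succ_ne_zero _)]
    simp [ColoredGraph.component]
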